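/- Let $\bar M$ be a smooth compact $(n+1)$-dimensional manifold with boundary, $n\ge 1$, with interior $M$, and let $\rho\colon\bar M\to[0,\infty)$ be a smooth defining function: $\rho^{-1}(0)=\partial M$ and $d\rho\ne0$ on $\partial M$. *Hölder spaces.* Let $B_r$ be the hyperbolic ball of radius $r$ about $(0,1)$ in the upper half-space $\{(x,y):x\in\mathbb R^n,\ y>0\}$. Fix finitely many smooth boundary charts $\Theta=(\theta,\rho)$ of $\bar M$ whose last coordinate is $\rho$, each used only on a set with compact closure in the domain of the chart. A Möbius parametrization $\Phi\colon B_2\to M$ centred at $(\theta_0,\rho_0)$, $\rho_0>0$, is $\Phi(x,y)=\Theta^{-1}(\theta_0+\rho_0x,\rho_0y)$. Fix a collection $\{\Phi_i\}$ of such parametrizations, together with finitely many smooth parametrizations $B_2\to M$ that extend as diffeomorphisms onto their images past $\overline{B_2}$, such that the sets $\Phi_i(B_1)$ cover $M$. For $k\in\mathbb N_0$, $\alpha\in[0,1)$ and $\delta\in\mathbb R$, a tensor field $u$ on $M$ lies in $C^{k,\alpha}_\delta(M)$ if $\sup_i\|\Phi_i^*(\rho^{-\delta}u)\|_{C^{k,\alpha}(B_2)}<\infty$,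 where $C^{k,0}$ means $C^k$. *The class of metrics.* For $k\ge2$ and $\alpha\in[0,1)$, $\mathscr M_{\rm weak}^{k,\alpha;2}$ is the set of Riemannian metrics $g$ on $M$ such that $\bar g=\rho^2g$ extends to a continuous nondegenerate metric on $\bar M$, $$\bar g\in C^{k,\alpha}_2(M),\qquad \mathcal L_{X_1}\bar g\in C^{k-1,\alpha}_2(M),\qquad \mathcal L_{X_1}\mathcal L_{X_2}\bar g\in C^{k-2,\alpha}_2(M)$$ for all smooth vector fields $X_1,X_2$ on $\bar M$, and the curvature operator satisfies $|\mathrm{Riem}[g]+\mathrm{Id}|_g\to0$ as $\rho\to0$. **Theorem.** Let $k\ge2$, $\alpha\in[0,1)$ and $g\in\mathscr M_{\rm weak}^{k,\alpha;2}$. Write $R[g]$ for the scalar curvature of $g$ and $\Delta_{\bar g}$ for the Laplacian (trace of the Hessian) of $\bar g$. Then the following are equivalent: 1. $|d\rho|^2_{\bar g}-1-\frac{2}{n+1}\,\rho\,\Delta_{\bar g}\rho\in C^{k-1,\alpha}_2(M)$; 2. $|d\rho|^2_{\bar g}-1-\frac{2}{n+1}\,\rho\,\Delta_{\bar g}\rho=O(\rho^2)$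 as $\rho\to0$; 3. $R[g]+n(n+1)\in C^{k-2,\alpha}_2(M)$; 4. $R[g]+n(n+1)=O(\rho^2)$ as $\rho\to0$. -/

import Mathlib

open scoped Manifold ContDiff Topology Bundle

noncomputable section

namespace WeakAH

/-! ### Local (Euclidean) notions

Coordinates on the half-space of dimension `n + 1` are indexed by `Fin (n + 1)`; the coordinate with
index `0` is the one that is nonnegative (the `ρ`, respectively `y`, coordinate). -/

/-- The model vector space `ℝ^(n+1)`. -/
abbrev E (n : ℕ) : Type := EuclideanSpace ℝ (Fin (n + 1))

/-- Bilinear forms on `ℝ^(n+1)`. -/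
abbrev Bil (n : ℕ) : Type := E n →L[ℝ] E n →L[ℝ] ℝ

/-- The pullback `(v, w) ↦ B (L v) (L w)` of a bilinear form under a linear map. -/
def compBil {n : ℕ} (B : Bil n) (L : E n →L[ℝ] E n) : Bil n := B.bilinearComp L L

/-- The standard basis vectors of `ℝ^(n+1)`. -/
def e (n : ℕ) (i : Fin (n + 1)) : E n := EuclideanSpace.single i 1

/-- Distance in the upper half-space model of hyperbolic space. -/
def hypDist {n : ℕ} (z w : E n) : ℝ := 2 * Real.arsinh (dist z w / (2 * √(z 0 * w 0)))

/-- The hyperbolic ball `B_r` about the point of height one on the vertical axis. -/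
def hypBall (n : ℕ) (r : ℝ) : Set (E n) := {z | 0 < z 0 ∧ hypDist z (e n 0) < r}

/-- The affine map `(y, x) ↦ (ρ₀ y, θ₀ + ρ₀ x)`, where `c = (ρ₀, θ₀)`; it maps `e₀ = (1, 0)`
to `c`. -/
def rescale {n : ℕ} (c z : E n) : E n := c + c 0 • (z - e n 0)

/-- The map `v` is of class `C^{k,α}` on the open set `B`, with `C^{k,α}` norm bounded by (a
multiple of) `C`: all derivatives of order at most `k` are bounded by `C`, and the derivatives of
order `k` have `α`-Hölder seminorm at most `C`. For `α = 0` this is boundedness in `C^k`. -/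
def HolderBound {n : ℕ} {F : Type*} [NormedAddCommGroup F] [NormedSpace ℝ F]
    (k : ℕ) (α : ℝ) (v : E n → F) (B : Set (E n)) (C : ℝ) : Prop :=
  ContDiffOn ℝ k v B ∧
  (∀ j ≤ k, ∀ x ∈ B, ‖iteratedFDeriv ℝ j v x‖ ≤ C) ∧
  ∀ x ∈ B, ∀ y ∈ B, ‖iteratedFDeriv ℝ k v x - iteratedFDeriv ℝ k v y‖ ≤ C * ‖x - y‖ ^ α

/-- The partial derivative `∂_i f`. -/
def pd {n : ℕ} (i : Fin (n + 1)) (f : E n → ℝ) (x : E n) : ℝ := fderiv ℝ f x (e n i)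

/-- The component matrix of a field of bilinear forms. -/
def gram {n : ℕ} (T : E n → Bil n) (x : E n) : Matrix (Fin (n + 1)) (Fin (n + 1)) ℝ :=
  Matrix.of fun i j => T x (e n i) (e n j)

section Coordinates

variable {n : ℕ} (G : E n → Matrix (Fin (n + 1)) (Fin (n + 1)) ℝ)

/-- Christoffel symbols `Γ^k_{ij}` of the metric with component matrix `G`. -/
def christoffel (k i j : Fin (n + 1)) (x : E n) : ℝ :=
  (1 / 2) * ∑ l, (G x)⁻¹ k l *
    (pd i (fun y => G y j l) x + pd j (fun y => G y i l) x - pd l (fun y => G y i j) x)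

/-- Riemann curvature: `R(∂_i, ∂_j) ∂_m = ∑_k (riemann k) ∂_k`, where
`R(X, Y) = ∇_X ∇_Y - ∇_Y ∇_X - ∇_[X,Y]`. -/
def riemann (i j m k : Fin (n + 1)) (x : E n) : ℝ :=
  pd i (christoffel G k j m) x - pd j (christoffel G k i m) x
    + ∑ p, (christoffel G k i p x * christoffel G p j m x
      - christoffel G k j p x * christoffel G p i m x)

/-- Components `R_{ij}^{kl}` of the curvature operator as a `(2,2)` tensor. For a metric of
constant sectional curvature `κ` these are `κ (δ_i^k δ_j^l - δ_i^l δ_j^k)`. -/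
def curvOp (i j k l : Fin (n + 1)) (x : E n) : ℝ := ∑ m, (G x)⁻¹ l m * riemann G i j m k x

/-- The components `δ_i^k δ_j^l - δ_i^l δ_j^k` of the identity of `Λ²`. -/
def idOp (i j k l : Fin (n + 1)) : ℝ :=
  (if i = k then 1 else 0) * (if j = l then 1 else 0)
    - (if i = l then 1 else 0) * (if j = k then 1 else 0)

/-- The scalar curvature: the full contraction of the curvature operator. -/
def scalar (x : E n) : ℝ := ∑ i, ∑ j, curvOp G i j i j x

/-- The square of the norm, with respect to the metric, of the `(2,2)` tensor `Riem + Id`. -/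
def curvDefectSq (x : E n) : ℝ :=
  ∑ i, ∑ i', ∑ j, ∑ j', ∑ k, ∑ k', ∑ l, ∑ l',
    (G x)⁻¹ i i' * (G x)⁻¹ j j' * G x k k' * G x l l' *
      (curvOp G i j k l x + idOp i j k l) * (curvOp G i' j' k' l' x + idOp i' j' k' l')

/-- `|df|²` with respect to the metric. -/
def gradSq (f : E n → ℝ) (x : E n) : ℝ := ∑ i, ∑ j, (G x)⁻¹ i j * pd i f x * pd j f x

/-- The Laplacian (trace of the Hessian) of `f`. -/
def laplace (f : E n → ℝ) (x : E n) : ℝ :=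
  ∑ i, ∑ j, (G x)⁻¹ i j * (pd i (pd j f) x - ∑ k, christoffel G k i j x * pd k f x)

end Coordinates

/-- The Lie derivative of a field of bilinear forms along a vector field on an open set of
`ℝ^(n+1)`: `(L_X T)(v, w) = (D_X T)(v, w) + T(D_v X, w) + T(v, D_w X)`. -/
def lieE {n : ℕ} (X : E n → E n) (T : E n → Bil n) (x : E n) : Bil n :=
  fderiv ℝ T x (X x)
    + (T x).bilinearComp (fderiv ℝ X x) (ContinuousLinearMap.id ℝ (E n))
    + (T x).bilinearComp (ContinuousLinearMap.id ℝ (E n)) (fderiv ℝ X x)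

/-! ### Tensor fields on a manifold with boundary -/

section Manifold

variable (n : ℕ) {M : Type*} [TopologicalSpace M] [ChartedSpace (EuclideanHalfSpace (n + 1)) M]

variable (M) in
/-- Fields of bilinear forms. Only the values in the interior of the manifold are used. -/
abbrev BilField : Type _ :=
  ∀ p : M, TangentSpace (𝓡∂ (n + 1)) p →L[ℝ] TangentSpace (𝓡∂ (n + 1)) p →L[ℝ] ℝ

variable (M) in
/-- The space of smooth vector fields on the whole manifold, boundary included. -/
abbrev SmoothVF [IsManifold (𝓡∂ (n + 1)) ∞ M] : Type _ :=
  ContMDiffSection (𝓡∂ (n + 1)) (E n) ∞ (fun p : M => TangentSpace (𝓡∂ (n + 1)) p)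

variable {n}

/-- The pullback of a field of bilinear forms under a parametrization. -/
def pullBil (Φ : E n → M) (T : BilField n M) (z : E n) : Bil n :=
  compBil (T (Φ z)) (mfderiv 𝓘(ℝ, E n) (𝓡∂ (n + 1)) Φ z)

/-- The inverse of the preferred chart at `p`. -/
def param (p : M) : E n → M := (extChartAt (𝓡∂ (n + 1)) p).symm

/-- The coordinates of `p` in the preferred chart at `p`. -/
def coord (p : M) : E n := extChartAt (𝓡∂ (n + 1)) p p

/-- The vector field `X` in the preferred chart at `p`. -/
def chartVF (p : M) (X : ∀ q : M, TangentSpace (𝓡∂ (n + 1)) q) (z : E n) : E n :=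
  mfderiv (𝓡∂ (n + 1)) 𝓘(ℝ, E n) (extChartAt (𝓡∂ (n + 1)) p) (param p z) (X (param p z))

/-- The Lie derivative `L_X T` at interior points, computed at `p` in the preferred chart at `p`
and transported back by the differential of the chart. -/
def lieDeriv (X : ∀ q : M, TangentSpace (𝓡∂ (n + 1)) q) (T : BilField n M) : BilField n M :=
  fun p => compBil (lieE (chartVF p X) (pullBil (param p) T) (coord p))
    (mfderiv (𝓡∂ (n + 1)) 𝓘(ℝ, E n) (extChartAt (𝓡∂ (n + 1)) p) p)

/-- Components of a metric in the preferred chart at `p`. -/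
def chartGram (g : BilField n M) (p : M) : E n → Matrix (Fin (n + 1)) (Fin (n + 1)) ℝ :=
  gram (pullBil (param p) g)

/-- The scalar curvature `R[g]` (at interior points). -/
def scalarCurvature (g : BilField n M) (p : M) : ℝ := scalar (chartGram g p) (coord p)

/-- The function `|Riem[g] + Id|_g ^ 2` (at interior points). -/
def curvatureDefectSq (g : BilField n M) (p : M) : ℝ := curvDefectSq (chartGram g p) (coord p)

/-- The function `|df|_g ^ 2` (at interior points). -/
def normDiffSq (g : BilField n M) (f : M → ℝ) (p : M) : ℝ :=
  gradSq (chartGram g p) (fun z => f (param p z)) (coord p)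

/-- The Laplacian `Δ_g f` (at interior points). -/
def laplacian (g : BilField n M) (f : M → ℝ) (p : M) : ℝ :=
  laplace (chartGram g p) (fun z => f (param p z)) (coord p)

/-- The conformally rescaled metric `ρ² g`. -/
def compactify (ρ : M → ℝ) (g : BilField n M) : BilField n M := fun p => ρ p ^ 2 • g p

/-- `g` is a Riemannian metric on the interior of `M` (its regularity is imposed separately). -/
structure IsMetric (g : BilField n M) : Prop where
  symm : ∀ p ∈ (𝓡∂ (n + 1)).interior M, ∀ v w, g p v w = g p w v
  pos : ∀ p ∈ (𝓡∂ (n + 1)).interior M, ∀ v, v ≠ 0 → 0 < g p v v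

variable (n) in
/-- Smooth defining functions for the boundary of `M`. -/
structure IsDefiningFunction (ρ : M → ℝ) : Prop where
  smooth : ContMDiff (𝓡∂ (n + 1)) 𝓘(ℝ, ℝ) ∞ ρ
  nonneg : ∀ p, 0 ≤ ρ p
  zero_iff : ∀ p, ρ p = 0 ↔ p ∈ (𝓡∂ (n + 1)).boundary M
  mfderiv_ne : ∀ p ∈ (𝓡∂ (n + 1)).boundary M, mfderiv (𝓡∂ (n + 1)) 𝓘(ℝ, ℝ) ρ p ≠ 0

/-- The filter `ρ → 0` in the interior. -/
def nearBoundary (ρ : M → ℝ) : Filter M := Filter.comap ρ (𝓝[>] 0)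

variable (n) in
/-- A choice of background coordinates near the boundary and of Möbius parametrizations
`B_2 → M`, together with finitely many further parametrizations `B_2 → M`, such that the images
of `B_1` cover the interior of `M`.

Background coordinates are smooth charts `Θ = (ρ, θ)` whose coordinate with index `0` is `ρ`. Each
one is used on a set `dom` whose closure (which is compact when `M` is) lies in the domain of the
chart, and the Möbius parametrization centred at `c = (ρ₀, θ₀)` is
`(y, x) ↦ Θ⁻¹ (ρ₀ y, θ₀ + ρ₀ x)`. The remaining parametrizations are diffeomorphisms onto their
image that extend smoothly past the closure of `B_2`. The set of centres is arbitrary; countability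
and uniform local finiteness are not required. -/
structure MobiusCover (ρ : M → ℝ) where
  numBg : ℕ
  bg : Fin numBg → OpenPartialHomeomorph M (EuclideanHalfSpace (n + 1))
  bg_mem : ∀ b, bg b ∈ IsManifold.maximalAtlas (𝓡∂ (n + 1)) ∞ M
  bg_zero : ∀ b, ∀ p ∈ (bg b).source, (bg b).extend (𝓡∂ (n + 1)) p 0 = ρ p
  dom : Fin numBg → Set M
  closure_dom : ∀ b, closure (dom b) ⊆ (bg b).source
  centers : Fin numBg → Set (E n)
  centers_pos : ∀ b, ∀ c ∈ centers b, 0 < c 0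
  centers_dom : ∀ b, ∀ c ∈ centers b, ∀ z ∈ hypBall n 2,
    rescale c z ∈ (bg b).extend (𝓡∂ (n + 1)) '' dom b
  numInt : ℕ
  int : Fin numInt → OpenPartialHomeomorph M (EuclideanHalfSpace (n + 1))
  int_mem : ∀ i, int i ∈ IsManifold.maximalAtlas (𝓡∂ (n + 1)) ∞ M
  int_target : ∀ i, closure (hypBall n 2) ⊆ ((int i).extend (𝓡∂ (n + 1))).target
  cover : ∀ p ∈ (𝓡∂ (n + 1)).interior M,
    (∃ b, ∃ c ∈ centers b, ∃ z ∈ hypBall n 1,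
      ((bg b).extend (𝓡∂ (n + 1))).symm (rescale c z) = p) ∨
    ∃ i, ∃ z ∈ hypBall n 1, ((int i).extend (𝓡∂ (n + 1))).symm z = p

/-- The collection of all parametrizations `Φ : B_2 → M` of a Möbius cover. -/
def MobiusCover.maps {ρ : M → ℝ} (A : MobiusCover n ρ) : Set (E n → M) :=
  {Φ | (∃ b, ∃ c ∈ A.centers b, Φ = fun z => ((A.bg b).extend (𝓡∂ (n + 1))).symm (rescale c z)) ∨
    ∃ i, Φ = ((A.int i).extend (𝓡∂ (n + 1))).symm}

/-- The weighted Hölder space `C^{k,α}_δ(M) = ρ^δ C^{k,α}(M)` of functions: the `C^{k,α}(B_2)` norms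
of the pullbacks `Φ^* (ρ^{-δ} u)` are uniformly bounded. -/
def HolderFun {ρ : M → ℝ} (A : MobiusCover n ρ) (k : ℕ) (α δ : ℝ) (u : M → ℝ) : Prop :=
  ∃ C : ℝ, ∀ Φ ∈ A.maps,
    HolderBound k α (fun z => ρ (Φ z) ^ (-δ) * u (Φ z)) (hypBall n 2) C

/-- The weighted Hölder space `C^{k,α}_δ(M) = ρ^δ C^{k,α}(M)` of fields of bilinear forms. -/
def HolderBil {ρ : M → ℝ} (A : MobiusCover n ρ) (k : ℕ) (α δ : ℝ) (T : BilField n M) : Prop :=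
  ∃ C : ℝ, ∀ Φ ∈ A.maps,
    HolderBound k α (pullBil Φ (fun p => ρ p ^ (-δ) • T p)) (hypBall n 2) C

variable [IsManifold (𝓡∂ (n + 1)) ∞ M]

/-- The space `𝒞^{k,α;m}(M)` of fields `T` of bilinear forms (which have weight `2`):
`L_{X_1} ⋯ L_{X_j} T ∈ C^{k-j,α}_2(M)` for all `j ≤ m` and all vector fields `X_1, …, X_j` that are
smooth up to the boundary. -/
def MemScriptC {ρ : M → ℝ} (A : MobiusCover n ρ) (k : ℕ) (α : ℝ) (m : ℕ)
    (T : BilField n M) : Prop :=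
  ∀ Xs : List (SmoothVF n M), Xs.length ≤ m →
    HolderBil A (k - Xs.length) α 2 (Xs.foldr (fun X S => lieDeriv (fun p => X p) S) T)

/-- The class `𝓜_weak^{k,α;m}` of metrics `g` on the interior of `M` such that `ρ² g` lies in
`𝒞^{k,α;m}(M)` and extends to a continuous (nondegenerate) Riemannian metric on `M`, boundary
included, and such that `Riem[g] → -Id` as `ρ → 0`. -/
structure MWeak {ρ : M → ℝ} (A : MobiusCover n ρ) (k : ℕ) (α : ℝ) (m : ℕ)
    (g : BilField n M) : Prop where
  isMetric : IsMetric g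
  memScriptC : MemScriptC A k α m (compactify ρ g)
  extends_continuously : ∃ G : Bundle.ContinuousRiemannianMetric (E n)
      (fun p : M => TangentSpace (𝓡∂ (n + 1)) p),
    ∀ p ∈ (𝓡∂ (n + 1)).interior M, G.inner p = compactify ρ g p
  curvature_tendsto : Filter.Tendsto (curvatureDefectSq g) (nearBoundary ρ) (𝓝 0)

end Manifold

end WeakAH

end

namespace WeakAH

/-! ### Hyperbolic balls are Euclidean balls -/

/-! Write `ḡ = ρ² g` and `F = |dρ|²_ḡ - 1 - 2/(n+1) ρ Δ_ḡ ρ` (`gradDefect`). The conformal law of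
the scalar curvature in dimension `n + 1` (`scalar_conformal`) reads `R[g] = ρ² R[ḡ] + 2n ρ Δ_ḡ ρ -
n(n+1) |dρ|²_ḡ`, that is, `R[g] + n(n+1) = ρ² R[ḡ] - n(n+1) F`. So everything depends on bounding
`R[ḡ]` in weight zero and on comparing the two regularity statements for `F`.

A Möbius parametrization scales by `c 0`, so a bilinear form of weight 2 has uniformly bounded
components in background coordinates (`PatchChart.pullBil_eq`). Background coordinate fields, cut
off, are smooth vector fields on the whole manifold, and Lie derivatives along them are coordinate
derivatives of components (`chartBil_lieDeriv`). Hence membership in the class gives two bounded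
unscaled coordinate derivatives of `ḡ` (`PatchChart.smoothBounded_gram`). The continuous extension
of `ḡ` bounds its determinant away from zero, so the inverse metric is controlled too. It follows
that `R[ḡ]` lies in `C^{k-2,α}_0`. This gives 1 → 3 and 4 → 2 by the identity; 3 → 4 is the sup part
of the norm.

The substance is 2 → 1, in `unifHolder_of_isBigO_sq`. Near the boundary `F = f - x₀ h`, where `f`
has two and `h` one bounded coordinate derivatives. On the ball of scale `c 0`, the quotient `F / (c
0)²` is the sum of Taylor remainders, bounded in `C^{k-1,α}` whatever the size of `F`, and of an
affine function of the rescaled variable. The pointwise bound `F = O(ρ²)` bounds this affine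
function, and a bounded affine function on a fixed ball is bounded in every Hölder norm. -/

/-- Squaring the distance condition gives `|z - e₀|² < 4 sinh²(r/2) z₀`; completing the square with
`cosh r = 1 + 2 sinh²(r/2)` turns it into a Euclidean ball. The ball of radius 2 is therefore open,
convex and bounded, with heights between `exp (-2)` and `exp 2`. -/
lemma hypBall_eq_ball (n : ℕ) {r : ℝ} (hr : 0 < r) :
    hypBall n r = Metric.ball (Real.cosh r • e n 0) (Real.sinh r) := by
  ext z
  have hs : 0 < Real.sinh r := Real.sinh_pos_iff.2 hr
  have hs2 : 0 < Real.sinh (r / 2) := Real.sinh_pos_iff.2 (by linarith)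
  have hc : Real.cosh r = 1 + 2 * Real.sinh (r / 2) ^ 2 := by
    have := Real.cosh_two_mul (r / 2)
    rw [show 2 * (r / 2) = r by ring] at this
    rw [this, Real.cosh_sq]; ring
  have hcs : Real.cosh r ^ 2 = Real.sinh r ^ 2 + 1 := Real.cosh_sq r
  have hd1 : dist z (e n 0) ^ 2 = (z 0 - 1) ^ 2 + ∑ i : Fin n, z i.succ ^ 2 := by
    rw [EuclideanSpace.dist_eq, Real.sq_sqrt (by positivity), Fin.sum_univ_succ]
    simp [e, Real.dist_eq, sq_abs]
  have hd2 : dist z (Real.cosh r • e n 0) ^ 2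
      = (z 0 - Real.cosh r) ^ 2 + ∑ i : Fin n, z i.succ ^ 2 := by
    rw [EuclideanSpace.dist_eq, Real.sq_sqrt (by positivity), Fin.sum_univ_succ]
    simp [e, Real.dist_eq, sq_abs]
  have key : 0 < z 0 → (hypDist z (e n 0) < r ↔ dist z (Real.cosh r • e n 0) < Real.sinh r) := by
    intro hz
    have hz' : 0 < √(z 0) := Real.sqrt_pos.2 hz
    have h1 : hypDist z (e n 0) < r ↔ dist z (e n 0) < Real.sinh (r / 2) * (2 * √(z 0)) := by
      rw [← div_lt_iff₀ (by positivity)]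
      have : hypDist z (e n 0) < r ↔ Real.arsinh (dist z (e n 0) / (2 * √(z 0))) < r / 2 := by
        simp only [hypDist, e, PiLp.single_apply, if_true, mul_one]
        constructor <;> intro h <;> linarith
      rw [this, ← Real.sinh_lt_sinh, Real.sinh_arsinh]
    rw [h1, ← sq_lt_sq₀ dist_nonneg (by positivity), ← sq_lt_sq₀ dist_nonneg hs.le, hd1, hd2,
      mul_pow, mul_pow, Real.sq_sqrt hz.le]
    constructor <;> intro h <;> nlinarith
  constructor
  · rintro ⟨h0, h⟩
    exact (key h0).1 h
  · intro h
    have h' : dist z (Real.cosh r • e n 0) ^ 2 < Real.sinh r ^ 2 :=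
      (sq_lt_sq₀ dist_nonneg hs.le).2 h
    -- The Euclidean ball stays in the upper half-space because `sinh² r = cosh² r - 1 < cosh² r`.
    have h0 : 0 < z 0 := by
      have : 0 ≤ ∑ i : Fin n, z i.succ ^ 2 := by positivity
      have hcp := Real.cosh_pos r
      nlinarith
    exact ⟨h0, (key h0).2 h⟩

lemma eq_sum_smul_e {n : ℕ} (y : E n) : y = ∑ l, y l • e n l := by
  ext j; simp [e, Pi.single_apply]

lemma isOpen_hypBall_two (n : ℕ) : IsOpen (hypBall n 2) := by
  rw [hypBall_eq_ball n two_pos]; exact Metric.isOpen_ball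

lemma convex_hypBall_two (n : ℕ) : Convex ℝ (hypBall n 2) := by
  rw [hypBall_eq_ball n two_pos]; exact convex_ball _ _

lemma e_zero_mem_hypBall (n : ℕ) {r : ℝ} (hr : 0 < r) : e n 0 ∈ hypBall n r := by
  simp [hypBall, hypDist, e, hr]

lemma hypBall_mono (n : ℕ) : hypBall n 1 ⊆ hypBall n 2 :=
  fun _ hz => ⟨hz.1, hz.2.trans one_lt_two⟩

lemma abs_apply_sub_le_of_mem_closure {n : ℕ} {z : E n} (hz : z ∈ closure (hypBall n 2)) :
    |z 0 - Real.cosh 2| ≤ Real.sinh 2 := by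
  rw [hypBall_eq_ball n two_pos] at hz
  have h := Metric.closure_ball_subset_closedBall hz
  have h2 := PiLp.norm_apply_le (z - Real.cosh 2 • e n 0) 0
  rw [Metric.mem_closedBall, dist_eq_norm] at h
  refine le_trans ?_ (h2.trans h)
  simp [e]

/-- Lower bound for the height on the ball of radius two. -/
lemma exp_le_apply_zero {n : ℕ} {z : E n} (hz : z ∈ closure (hypBall n 2)) :
    Real.exp (-2) ≤ z 0 := by
  have h := (abs_le.1 (abs_apply_sub_le_of_mem_closure hz)).1
  have := Real.cosh_sub_sinh 2
  linarith

lemma apply_zero_le_exp {n : ℕ} {z : E n} (hz : z ∈ closure (hypBall n 2)) :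
    z 0 ≤ Real.exp 2 := by
  have h := (abs_le.1 (abs_apply_sub_le_of_mem_closure hz)).2
  have := Real.cosh_add_sinh 2
  linarith

lemma isCompact_closure_hypBall_two (n : ℕ) : IsCompact (closure (hypBall n 2)) := by
  rw [hypBall_eq_ball n two_pos]
  exact Metric.isBounded_ball.isCompact_closure

lemma norm_sub_le_of_mem_hypBall {n : ℕ} {x y : E n} (hx : x ∈ hypBall n 2) (hy : y ∈ hypBall n 2) :
    ‖x - y‖ ≤ 2 * Real.sinh 2 := by
  rw [hypBall_eq_ball n two_pos] at hx hy
  rw [← dist_eq_norm]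
  have := dist_triangle_right x y (Real.cosh 2 • e n 0)
  rw [Metric.mem_ball] at hx hy
  linarith

/-! ### Uniform Hölder bounds for families of functions -/

section HolderBound

variable {n : ℕ} {F F' : Type*} [NormedAddCommGroup F] [NormedSpace ℝ F]
  [NormedAddCommGroup F'] [NormedSpace ℝ F'] {k : ℕ} {α : ℝ} {v w : E n → F} {B : Set (E n)}
  {C C' : ℝ}

lemma HolderBound.mono (h : HolderBound k α v B C) (hC : C ≤ C') : HolderBound k α v B C' :=
  ⟨h.1, fun j hj x hx => (h.2.1 j hj x hx).trans hC, fun x hx y hy =>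
    (h.2.2 x hx y hy).trans (by gcongr)⟩

lemma HolderBound.congr (hB : IsOpen B) (h : HolderBound k α v B C) (hvw : ∀ x ∈ B, w x = v x) :
    HolderBound k α w B C := by
  have hD : ∀ j, ∀ x ∈ B, iteratedFDeriv ℝ j w x = iteratedFDeriv ℝ j v x := fun j x hx =>
    (Filter.EventuallyEq.iteratedFDeriv ℝ
      (Filter.eventually_of_mem (hB.mem_nhds hx) hvw) j).eq_of_nhds
  refine ⟨h.1.congr hvw, fun j hj x hx => ?_, fun x hx y hy => ?_⟩
  · rw [hD j x hx]; exact h.2.1 j hj x hx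
  · rw [hD k x hx, hD k y hy]; exact h.2.2 x hx y hy

lemma HolderBound.add (hB : IsOpen B) (h : HolderBound k α v B C) (h' : HolderBound k α w B C') :
    HolderBound k α (fun x => v x + w x) B (C + C') := by
  have hD : ∀ j ≤ k, ∀ x ∈ B, iteratedFDeriv ℝ j (fun x => v x + w x) x
      = iteratedFDeriv ℝ j v x + iteratedFDeriv ℝ j w x := fun j hj x hx =>
    iteratedFDeriv_add_apply (((h.1.contDiffAt (hB.mem_nhds hx))).of_le (by exact_mod_cast hj))
      (((h'.1.contDiffAt (hB.mem_nhds hx))).of_le (by exact_mod_cast hj))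
  refine ⟨h.1.add h'.1, fun j hj x hx => ?_, fun x hx y hy => ?_⟩
  · rw [hD j hj x hx]
    exact norm_add_le_of_le (h.2.1 j hj x hx) (h'.2.1 j hj x hx)
  · rw [hD k le_rfl x hx, hD k le_rfl y hy, add_mul, add_sub_add_comm]
    exact norm_add_le_of_le (h.2.2 x hx y hy) (h'.2.2 x hx y hy)

lemma HolderBound.clm_comp (hB : IsOpen B) (L : F →L[ℝ] F') (h : HolderBound k α v B C) :
    HolderBound k α (fun x => L (v x)) B (‖L‖ * C) := by
  have hD : ∀ j ≤ k, ∀ x ∈ B, iteratedFDeriv ℝ j (fun x => L (v x)) x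
      = L.compContinuousMultilinearMap (iteratedFDeriv ℝ j v x) := fun j hj x hx =>
    L.iteratedFDeriv_comp_left (h.1.contDiffAt (hB.mem_nhds hx)) (by exact_mod_cast hj)
  refine ⟨L.contDiff.comp_contDiffOn h.1, fun j hj x hx => ?_, fun x hx y hy => ?_⟩
  · rw [hD j hj x hx]
    exact (L.norm_compContinuousMultilinearMap_le _).trans
      (mul_le_mul_of_nonneg_left (h.2.1 j hj x hx) (norm_nonneg _))
  · rw [hD k le_rfl x hx, hD k le_rfl y hy]
    have : L.compContinuousMultilinearMap (iteratedFDeriv ℝ k v x)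
        - L.compContinuousMultilinearMap (iteratedFDeriv ℝ k v y)
        = L.compContinuousMultilinearMap (iteratedFDeriv ℝ k v x - iteratedFDeriv ℝ k v y) := by
      ext m; simp
    rw [this, mul_assoc]
    exact (L.norm_compContinuousMultilinearMap_le _).trans
      (mul_le_mul_of_nonneg_left (h.2.2 x hx y hy) (norm_nonneg _))

lemma holderBound_zero_iff : HolderBound 0 α v B C ↔ ContinuousOn v B ∧ (∀ x ∈ B, ‖v x‖ ≤ C) ∧
    ∀ x ∈ B, ∀ y ∈ B, ‖v x - v y‖ ≤ C * ‖x - y‖ ^ α := by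
  simp only [HolderBound, Nat.cast_zero, contDiffOn_zero, Nat.le_zero, forall_eq,
    iteratedFDeriv_zero_eq_comp, Function.comp_apply, ← map_sub,
    LinearIsometryEquiv.norm_map]

/-- Currying the last derivative is an isometry, so the top-order seminorm of `v` is that of `fderiv
ℝ v`, with the same constant. Every later estimate becomes an induction on `k`. -/
lemma holderBound_succ_iff (hB : IsOpen B) : HolderBound (k + 1) α v B C ↔
    DifferentiableOn ℝ v B ∧ (∀ x ∈ B, ‖v x‖ ≤ C) ∧ HolderBound k α (fderiv ℝ v) B C := by
  have h3 : ∀ x y, ‖iteratedFDeriv ℝ (k + 1) v x - iteratedFDeriv ℝ (k + 1) v y‖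
      = ‖iteratedFDeriv ℝ k (fderiv ℝ v) x - iteratedFDeriv ℝ k (fderiv ℝ v) y‖ := by
    intro x y
    simp only [iteratedFDeriv_succ_eq_comp_right, Function.comp_apply, ← dist_eq_norm]
    exact LinearIsometryEquiv.dist_map _ _ _
  simp only [HolderBound, h3]
  have h1 : ContDiffOn ℝ ((k + 1 : ℕ) : WithTop ℕ∞) v B ↔
      DifferentiableOn ℝ v B ∧ ContDiffOn ℝ k (fderiv ℝ v) B := by
    rw [Nat.cast_add, Nat.cast_one, contDiffOn_succ_iff_fderiv_of_isOpen hB]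
    simp
  rw [h1]
  constructor
  · rintro ⟨⟨hd, hc⟩, hb, hh⟩
    refine ⟨hd, fun x hx => by simpa using hb 0 (Nat.zero_le _) x hx, hc, fun j hj x hx => ?_, hh⟩
    rw [norm_iteratedFDeriv_fderiv]
    exact hb (j + 1) (by omega) x hx
  · rintro ⟨hd, h0, hc, hb, hh⟩
    refine ⟨⟨hd, hc⟩, fun j hj x hx => ?_, hh⟩
    cases j with
    | zero => simpa using h0 x hx
    | succ j =>
      rw [← norm_iteratedFDeriv_fderiv]
      exact hb j (by omega) x hx

end HolderBound

/-- The members of a family of functions on the ball of radius two are uniformly bounded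
in `C^{k,α}`. -/
def UnifHolder {n : ℕ} {ι F : Type*} [NormedAddCommGroup F] [NormedSpace ℝ F]
    (k : ℕ) (α : ℝ) (v : ι → E n → F) : Prop :=
  ∃ C : ℝ, ∀ i, HolderBound k α (v i) (hypBall n 2) C

namespace UnifHolder

section General

variable {n : ℕ} {ι : Type*} {F F' : Type*} [NormedAddCommGroup F] [NormedSpace ℝ F]
  [NormedAddCommGroup F'] [NormedSpace ℝ F'] {k : ℕ} {α : ℝ} {v w : ι → E n → F}

lemma exists_nonneg (h : UnifHolder k α v) :
    ∃ C : ℝ, 0 ≤ C ∧ ∀ i, HolderBound k α (v i) (hypBall n 2) C := by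
  obtain ⟨C, hC⟩ := h
  exact ⟨max C 0, le_max_right _ _, fun i => (hC i).mono (le_max_left _ _)⟩

lemma bound (h : UnifHolder k α v) :
    ∃ C : ℝ, 0 ≤ C ∧ ∀ i, ∀ x ∈ hypBall n 2, ‖v i x‖ ≤ C := by
  obtain ⟨C, hC0, hC⟩ := h.exists_nonneg
  exact ⟨C, hC0, fun i x hx => by simpa using (hC i).2.1 0 (Nat.zero_le _) x hx⟩

lemma congr (h : UnifHolder k α v) (hvw : ∀ i, ∀ x ∈ hypBall n 2, w i x = v i x) :
    UnifHolder k α w := by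
  obtain ⟨C, hC⟩ := h
  exact ⟨C, fun i => (hC i).congr (isOpen_hypBall_two n) (hvw i)⟩

lemma add (h : UnifHolder k α v) (h' : UnifHolder k α w) :
    UnifHolder k α (fun i x => v i x + w i x) := by
  obtain ⟨C, hC⟩ := h
  obtain ⟨C', hC'⟩ := h'
  exact ⟨C + C', fun i => (hC i).add (isOpen_hypBall_two n) (hC' i)⟩

lemma clm_comp (L : F →L[ℝ] F') (h : UnifHolder k α v) :
    UnifHolder k α (fun i x => L (v i x)) := by
  obtain ⟨C, hC⟩ := h
  exact ⟨‖L‖ * C, fun i => (hC i).clm_comp (isOpen_hypBall_two n) L⟩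

lemma zero_iff : UnifHolder 0 α v ↔ (∀ i, ContinuousOn (v i) (hypBall n 2)) ∧
    (∃ C, 0 ≤ C ∧ ∀ i, ∀ x ∈ hypBall n 2, ‖v i x‖ ≤ C) ∧
    ∃ C, 0 ≤ C ∧ ∀ i, ∀ x ∈ hypBall n 2, ∀ y ∈ hypBall n 2,
      ‖v i x - v i y‖ ≤ C * ‖x - y‖ ^ α := by
  constructor
  · intro h
    obtain ⟨C, hC0, hC⟩ := h.exists_nonneg
    simp only [holderBound_zero_iff] at hC
    exact ⟨fun i => (hC i).1, ⟨C, hC0, fun i => (hC i).2.1⟩, ⟨C, hC0, fun i => (hC i).2.2⟩⟩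
  · rintro ⟨hc, ⟨C, hC0, hC⟩, ⟨C', hC'0, hC'⟩⟩
    refine ⟨C + C', fun i => holderBound_zero_iff.2 ⟨hc i, fun x hx => ?_, fun x hx y hy => ?_⟩⟩
    · exact (hC i x hx).trans (by linarith)
    · exact (hC' i x hx y hy).trans (by gcongr; linarith)

lemma succ_iff : UnifHolder (k + 1) α v ↔ (∀ i, DifferentiableOn ℝ (v i) (hypBall n 2)) ∧
    (∃ C, ∀ i, ∀ x ∈ hypBall n 2, ‖v i x‖ ≤ C) ∧ UnifHolder k α (fun i => fderiv ℝ (v i)) := by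
  have hB := isOpen_hypBall_two n
  simp only [UnifHolder, holderBound_succ_iff hB]
  constructor
  · rintro ⟨C, hC⟩
    exact ⟨fun i => (hC i).1, ⟨C, fun i => (hC i).2.1⟩, ⟨C, fun i => (hC i).2.2⟩⟩
  · rintro ⟨hd, ⟨C, hC⟩, ⟨C', hC'⟩⟩
    exact ⟨max C C', fun i => ⟨hd i, fun x hx => (hC i x hx).trans (le_max_left _ _),
      (hC' i).mono (le_max_right _ _)⟩⟩

end General

/-- Converts Lipschitz bounds on a set of diameter at most `D` into `α`-Hölder bounds: `t ≤ t ^ α`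
when `t ≤ 1`, and `1 ≤ t ^ α` when `t ≥ 1`. -/
lemma rpow_aux {D t α : ℝ} (hD : 1 ≤ D) (ht : 0 ≤ t) (htD : t ≤ D) (hα : α ∈ Set.Ico (0 : ℝ) 1) :
    t ≤ D * t ^ α := by
  rcases le_total t 1 with h | h
  · have h1 : t ^ (1 : ℝ) ≤ t ^ α := by
      rcases eq_or_lt_of_le ht with h0 | h0
      · subst h0
        -- At `t = 0` the power `t ^ α` is `1` when `α = 0` and `0` otherwise.
        rcases eq_or_lt_of_le hα.1 with h2 | h2
        · simp [← h2]
        · rw [Real.zero_rpow h2.ne']; simp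
      · exact Real.rpow_le_rpow_of_exponent_ge h0 h hα.2.le
    rw [Real.rpow_one] at h1
    have : 0 ≤ t ^ α := Real.rpow_nonneg ht _
    nlinarith
  · have h1 : 1 ≤ t ^ α := Real.one_le_rpow h hα.1
    nlinarith

/-- The mean value inequality on the convex ball gives a uniform Lipschitz constant, and boundedness
of the ball turns Lipschitz into Hölder. -/
lemma zero_of_fderiv_bound {n : ℕ} {ι : Type*} {F : Type*} [NormedAddCommGroup F]
    [NormedSpace ℝ F] {α : ℝ} (hα : α ∈ Set.Ico (0 : ℝ) 1) {v : ι → E n → F}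
    (hd : ∀ i, DifferentiableOn ℝ (v i) (hypBall n 2))
    (hb : ∃ C, 0 ≤ C ∧ ∀ i, ∀ x ∈ hypBall n 2, ‖v i x‖ ≤ C)
    (hb' : ∃ C, 0 ≤ C ∧ ∀ i, ∀ x ∈ hypBall n 2, ‖fderiv ℝ (v i) x‖ ≤ C) :
    UnifHolder 0 α v := by
  obtain ⟨C, hC0, hC⟩ := hb'
  refine zero_iff.2 ⟨fun i => (hd i).continuousOn, hb,
    ⟨C * (2 * Real.sinh 2 + 1), by have := Real.sinh_nonneg_iff.2 (zero_le_two (α := ℝ)); positivity,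
    fun i x hx y hy => ?_⟩⟩
  have hD : (1 : ℝ) ≤ 2 * Real.sinh 2 + 1 := by
    have := Real.sinh_nonneg_iff.2 (zero_le_two (α := ℝ)); linarith
  have h1 : ‖v i x - v i y‖ ≤ C * ‖x - y‖ :=
    (convex_hypBall_two n).norm_image_sub_le_of_norm_fderiv_le (𝕜 := ℝ)
      (fun z hz => (hd i).differentiableAt ((isOpen_hypBall_two n).mem_nhds hz)) (hC i) hy hx
  refine h1.trans ?_
  rw [mul_assoc]
  refine mul_le_mul_of_nonneg_left ?_ hC0
  exact rpow_aux hD (norm_nonneg _) ((norm_sub_le_of_mem_hypBall hx hy).trans (by linarith)) hα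

lemma of_succ {n : ℕ} {ι : Type*} {F : Type*} [NormedAddCommGroup F] [NormedSpace ℝ F]
    {k : ℕ} {α : ℝ} (hα : α ∈ Set.Ico (0 : ℝ) 1) {v : ι → E n → F}
    (h : UnifHolder (k + 1) α v) : UnifHolder k α v := by
  induction k generalizing F with
  | zero =>
    have h' := succ_iff.1 h
    exact zero_of_fderiv_bound hα h'.1 h.bound h'.2.2.bound
  | succ k ih =>
    rw [succ_iff] at h ⊢
    exact ⟨h.1, h.2.1, ih h.2.2⟩

lemma of_le {n : ℕ} {ι : Type*} {F : Type*} [NormedAddCommGroup F] [NormedSpace ℝ F]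
    {k l : ℕ} {α : ℝ} (hα : α ∈ Set.Ico (0 : ℝ) 1) {v : ι → E n → F}
    (h : UnifHolder k α v) (hl : l ≤ k) : UnifHolder l α v := by
  induction hl with
  | refl => exact h
  | step _ ih => exact ih (of_succ hα h)

section Real

variable {n : ℕ} {ι : Type*} {k : ℕ} {α : ℝ} {v w : ι → E n → ℝ}

lemma const {c : ι → ℝ} (hc : ∃ C, 0 ≤ C ∧ ∀ i, |c i| ≤ C) :
    UnifHolder k α (fun i (_ : E n) => c i) := by
  obtain ⟨C, hC0, hC⟩ := hc
  refine ⟨C, fun i => ⟨contDiffOn_const, fun j _ x _ => ?_, fun x _ y _ => ?_⟩⟩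
  · cases j with
    | zero => simpa using hC i
    | succ j =>
      rw [iteratedFDeriv_const_of_ne (Nat.succ_ne_zero j)]
      simpa using hC0
  · have : 0 ≤ C * ‖x - y‖ ^ α := by positivity
    cases k with
    | zero => simpa [iteratedFDeriv_zero_eq_comp] using this
    | succ j =>
      rw [iteratedFDeriv_const_of_ne (Nat.succ_ne_zero j)]
      simpa using this

lemma const' (c : ℝ) : UnifHolder k α (fun (_ : ι) (_ : E n) => c) :=
  const ⟨|c|, abs_nonneg _, fun _ => le_rfl⟩

lemma sum {σ : Type*} {s : Finset σ} {u : σ → ι → E n → ℝ} (h : ∀ j ∈ s, UnifHolder k α (u j)) :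
    UnifHolder k α (fun i x => ∑ j ∈ s, u j i x) := by
  classical
  induction s using Finset.induction_on with
  | empty => simpa using const' 0
  | insert a s ha ih =>
    simp only [Finset.sum_insert ha]
    exact (h a (Finset.mem_insert_self a s)).add (ih fun j hj => h j (Finset.mem_insert_of_mem hj))

/-- Replaces the operator-valued derivative by finitely many real functions, so that products and
inverses have to be estimated only for scalars. -/
lemma fderiv_iff : UnifHolder k α (fun i => fderiv ℝ (v i)) ↔
    ∀ l, UnifHolder k α (fun i => pd l (v i)) := by
  constructor
  · intro h l
    exact h.clm_comp (ContinuousLinearMap.apply ℝ ℝ (e n l))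
  · intro h
    let L : Fin (n + 1) → ℝ →L[ℝ] (E n →L[ℝ] ℝ) := fun l =>
      (ContinuousLinearMap.smulRightL ℝ (E n) ℝ (EuclideanSpace.proj l))
    have h1 : UnifHolder k α (fun i x => ∑ l, L l (pd l (v i) x)) := by
      classical
      have : ∀ s : Finset (Fin (n + 1)),
          UnifHolder k α (fun i x => ∑ l ∈ s, L l (pd l (v i) x)) := by
        intro s
        induction s using Finset.induction_on with
        | empty =>
          simpa using (const' (n := n) (ι := ι) (k := k) (α := α) 0).clm_comp (L 0)
        | insert a s ha ih =>
          simp only [Finset.sum_insert ha]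
          exact ((h a).clm_comp (L a)).add ih
      exact this Finset.univ
    refine h1.congr fun i x _ => ?_
    ext y
    conv_lhs => rw [eq_sum_smul_e y]
    simp only [map_sum, map_smul, sum_apply, L]
    rfl

lemma succ_iff_pd : UnifHolder (k + 1) α v ↔ (∀ i, DifferentiableOn ℝ (v i) (hypBall n 2)) ∧
    (∃ C, ∀ i, ∀ x ∈ hypBall n 2, ‖v i x‖ ≤ C) ∧ ∀ l, UnifHolder k α (fun i => pd l (v i)) := by
  rw [succ_iff, fderiv_iff]

lemma differentiableAt (h : UnifHolder (k + 1) α v) (i : ι) {x : E n} (hx : x ∈ hypBall n 2) :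
    DifferentiableAt ℝ (v i) x :=
  (succ_iff.1 h).1 i |>.differentiableAt ((isOpen_hypBall_two n).mem_nhds hx)

lemma pd_mul {u v : E n → ℝ} {x : E n} (hu : DifferentiableAt ℝ u x)
    (hv : DifferentiableAt ℝ v x) (l : Fin (n + 1)) :
    pd l (fun y => u y * v y) x = pd l u x * v x + u x * pd l v x := by
  simp only [pd, fderiv_fun_mul hu hv, add_apply,
    smul_apply, smul_eq_mul]
  ring

lemma pd_inv {u : E n → ℝ} {x : E n} (hu : DifferentiableAt ℝ u x) (h0 : u x ≠ 0)
    (l : Fin (n + 1)) :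
    pd l (fun y => (u y)⁻¹) x = -1 * (pd l u x * ((u x)⁻¹ * (u x)⁻¹)) := by
  have h := ((hasDerivAt_inv h0).comp_hasFDerivAt x hu.hasFDerivAt).fderiv
  simp only [Function.comp_def] at h
  simp only [pd, h, smul_apply, smul_eq_mul]
  field_simp

lemma mul (hα : α ∈ Set.Ico (0 : ℝ) 1) (hv : UnifHolder k α v) (hw : UnifHolder k α w) :
    UnifHolder k α (fun i x => v i x * w i x) := by
  have hbd : ∃ C, 0 ≤ C ∧ ∀ i, ∀ x ∈ hypBall n 2, ‖v i x * w i x‖ ≤ C := by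
    obtain ⟨C, hC0, hC⟩ := hv.bound
    obtain ⟨C', hC'0, hC'⟩ := hw.bound
    refine ⟨C * C', by positivity, fun i x hx => ?_⟩
    rw [norm_mul]
    exact mul_le_mul (hC i x hx) (hC' i x hx) (norm_nonneg _) hC0
  induction k generalizing v w with
  | zero =>
    obtain ⟨hvc, ⟨C₁, hC₁0, hC₁⟩, ⟨C₂, hC₂0, hC₂⟩⟩ := zero_iff.1 hv
    obtain ⟨hwc, ⟨C₃, hC₃0, hC₃⟩, ⟨C₄, hC₄0, hC₄⟩⟩ := zero_iff.1 hw
    refine zero_iff.2 ⟨fun i => (hvc i).mul (hwc i), hbd,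
      ⟨C₁ * C₄ + C₂ * C₃, by positivity, fun i x hx y hy => ?_⟩⟩
    have : v i x * w i x - v i y * w i y = v i x * (w i x - w i y) + (v i x - v i y) * w i y := by
      ring
    rw [this]
    refine (norm_add_le _ _).trans ?_
    rw [norm_mul, norm_mul]
    have h1 := mul_le_mul (hC₁ i x hx) (hC₄ i x hx y hy) (norm_nonneg _) hC₁0
    have h2 := mul_le_mul (hC₂ i x hx y hy) (hC₃ i y hy) (norm_nonneg _) (by positivity)
    calc _ ≤ _ := add_le_add h1 h2
      _ = _ := by ring
  | succ k ih =>
    refine succ_iff_pd.2 ⟨fun i => ((succ_iff.1 hv).1 i).mul ((succ_iff.1 hw).1 i),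
      ⟨hbd.choose, hbd.choose_spec.2⟩, fun l => ?_⟩
    have hv' := of_succ hα hv
    have hw' := of_succ hα hw
    have bd : ∀ {a b : ι → E n → ℝ}, UnifHolder k α a → UnifHolder k α b →
        ∃ C, 0 ≤ C ∧ ∀ i, ∀ x ∈ hypBall n 2, ‖a i x * b i x‖ ≤ C := by
      intro a b ha hb
      obtain ⟨C, hC0, hC⟩ := ha.bound
      obtain ⟨C', hC'0, hC'⟩ := hb.bound
      refine ⟨C * C', by positivity, fun i x hx => ?_⟩
      rw [norm_mul]
      exact mul_le_mul (hC i x hx) (hC' i x hx) (norm_nonneg _) hC0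
    have h1 := ih ((succ_iff_pd.1 hv).2.2 l) hw' (bd ((succ_iff_pd.1 hv).2.2 l) hw')
    have h2 := ih hv' ((succ_iff_pd.1 hw).2.2 l) (bd hv' ((succ_iff_pd.1 hw).2.2 l))
    exact (h1.add h2).congr fun i x hx =>
      pd_mul (hv.differentiableAt i hx) (hw.differentiableAt i hx) l

lemma const_mul (hα : α ∈ Set.Ico (0 : ℝ) 1) (c : ℝ) (hv : UnifHolder k α v) :
    UnifHolder k α (fun i x => c * v i x) :=
  (const' c).mul hα hv

lemma neg (hα : α ∈ Set.Ico (0 : ℝ) 1) (hv : UnifHolder k α v) :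
    UnifHolder k α (fun i x => -v i x) :=
  (hv.const_mul hα (-1)).congr fun i x _ => by ring

lemma sub (hα : α ∈ Set.Ico (0 : ℝ) 1) (hv : UnifHolder k α v) (hw : UnifHolder k α w) :
    UnifHolder k α (fun i x => v i x - w i x) :=
  (hv.add (hw.neg hα)).congr fun i x _ => by ring

/-- Induction on `k`: the derivative of `1/v` is `-(∂v) v⁻²`, which involves `1/v` only at the
previous order. -/
lemma inv (hα : α ∈ Set.Ico (0 : ℝ) 1) (hv : UnifHolder k α v) {δ : ℝ} (hδ : 0 < δ)
    (hlow : ∀ i, ∀ x ∈ hypBall n 2, δ ≤ |v i x|) :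
    UnifHolder k α (fun i x => (v i x)⁻¹) := by
  have hne : ∀ i, ∀ x ∈ hypBall n 2, v i x ≠ 0 := fun i x hx h0 => by
    have := hlow i x hx
    rw [h0, abs_zero] at this
    linarith
  have hle : ∀ i, ∀ x ∈ hypBall n 2, ‖(v i x)⁻¹‖ ≤ δ⁻¹ := fun i x hx => by
    rw [norm_inv]
    exact inv_anti₀ hδ (hlow i x hx)
  induction k with
  | zero =>
    obtain ⟨hvc, -, ⟨C₂, hC₂0, hC₂⟩⟩ := zero_iff.1 hv
    refine zero_iff.2 ⟨fun i => (hvc i).inv₀ (hne i), ⟨δ⁻¹, by positivity, hle⟩,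
      ⟨δ⁻¹ * δ⁻¹ * C₂, by positivity, fun i x hx y hy => ?_⟩⟩
    have : (v i x)⁻¹ - (v i y)⁻¹ = (v i x)⁻¹ * (v i y)⁻¹ * (v i y - v i x) := by
      have := hne i x hx
      have := hne i y hy
      field_simp
    rw [this, norm_mul, norm_mul, mul_assoc (δ⁻¹ * δ⁻¹), norm_sub_rev (v i y)]
    exact mul_le_mul (mul_le_mul (hle i x hx) (hle i y hy) (norm_nonneg _) (by positivity))
      (hC₂ i x hx y hy) (norm_nonneg _) (by positivity)
  | succ k ih =>
    have h' := ih (of_succ hα hv)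
    refine succ_iff_pd.2 ⟨fun i => ((succ_iff.1 hv).1 i).inv (hne i), ⟨δ⁻¹, hle⟩, fun l => ?_⟩
    exact ((((succ_iff_pd.1 hv).2.2 l).mul hα (h'.mul hα h')).const_mul hα (-1)).congr
      fun i x hx => pd_inv (hv.differentiableAt i hx) (hne i x hx) l

/-- Coordinate functions. -/
lemma coordinate (hα : α ∈ Set.Ico (0 : ℝ) 1) (j : Fin (n + 1)) :
    UnifHolder k α (fun (_ : ι) (x : E n) => x j) := by
  have hd : ∀ x : E n, fderiv ℝ (fun x : E n => x j) x = EuclideanSpace.proj j := fun x =>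
    (EuclideanSpace.proj j : E n →L[ℝ] ℝ).fderiv
  have hc : UnifHolder k α (fun (_ : ι) => fderiv ℝ (fun x : E n => x j)) :=
    fderiv_iff.2 fun l => (const' (e n l j)).congr fun i x _ => by simp [pd, hd]
  refine of_succ hα (succ_iff.2 ⟨fun i => ?_, ?_, hc⟩)
  · exact (EuclideanSpace.proj j : E n →L[ℝ] ℝ).differentiable.differentiableOn
  · obtain ⟨C, hC⟩ := (isCompact_closure_hypBall_two n).isBounded.exists_norm_le
    exact ⟨C, fun i x hx => (PiLp.norm_apply_le x j).trans (hC x (subset_closure hx))⟩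

/-- A function that is smooth near the closed ball is bounded in every Hölder space. -/
lemma of_contDiffOn (hα : α ∈ Set.Ico (0 : ℝ) 1) {V : Set (E n)} (hV : IsOpen V)
    (hBV : closure (hypBall n 2) ⊆ V) {f : E n → ℝ} (hf : ContDiffOn ℝ ∞ f V) :
    UnifHolder k α (fun _ : ι => f) := by
  have hbd : ∀ g : E n → ℝ, ContDiffOn ℝ ∞ g V →
      ∃ C, ∀ i : ι, ∀ x ∈ hypBall n 2, ‖g x‖ ≤ C := by
    intro g hg
    obtain ⟨C, hC⟩ := (isCompact_closure_hypBall_two n).exists_bound_of_continuousOn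
      (hg.continuousOn.mono hBV)
    exact ⟨C, fun _ x hx => hC x (subset_closure hx)⟩
  have hpd : ∀ g : E n → ℝ, ContDiffOn ℝ ∞ g V → ∀ l, ContDiffOn ℝ ∞ (pd l g) V := by
    intro g hg l
    exact ((contDiffOn_infty_iff_fderiv_of_isOpen hV).1 hg).2.clm_apply contDiffOn_const
  have hdiff : ∀ g : E n → ℝ, ContDiffOn ℝ ∞ g V → DifferentiableOn ℝ g (hypBall n 2) :=
    fun g hg => (hg.differentiableOn (by simp)).mono (subset_closure.trans hBV)
  induction k generalizing f with
  | zero =>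
    refine zero_of_fderiv_bound hα (fun _ => hdiff f hf) ?_ ?_
    · obtain ⟨C, hC⟩ := hbd f hf
      exact ⟨max C 0, le_max_right _ _, fun i x hx => (hC i x hx).trans (le_max_left _ _)⟩
    · obtain ⟨C, hC⟩ := (isCompact_closure_hypBall_two n).exists_bound_of_continuousOn
        (((contDiffOn_infty_iff_fderiv_of_isOpen hV).1 hf).2.continuousOn.mono hBV)
      exact ⟨max C 0, le_max_right _ _, fun i x hx =>
        (hC x (subset_closure hx)).trans (le_max_left _ _)⟩
  | succ k ih =>
    exact succ_iff_pd.2 ⟨fun _ => hdiff f hf, hbd f hf, fun l => ih (hpd f hf l)⟩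

end Real

end UnifHolder

end WeakAH

namespace WeakAH

set_option synthInstance.maxHeartbeats 400000
set_option maxHeartbeats 1000000

/-! ### Levi-Civita connections on open subsets of a vector space -/

section Connection

variable {V : Type*} [NormedAddCommGroup V] [NormedSpace ℝ V]

lemma hasFDerivAt_apply₂ {U W Z : Type*} [NormedAddCommGroup U] [NormedSpace ℝ U]
    [NormedAddCommGroup W] [NormedSpace ℝ W] [NormedAddCommGroup Z] [NormedSpace ℝ Z]
    {T : V → U →L[ℝ] W →L[ℝ] Z} {x : V} (h : DifferentiableAt ℝ T x) (v : U) (w : W) :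
    HasFDerivAt (fun y => T y v w) ((((fderiv ℝ T x).flip v)).flip w) x := by
  have := (h.hasFDerivAt.clm_apply (hasFDerivAt_const v x)).clm_apply (hasFDerivAt_const w x)
  refine this.congr_fderiv ?_
  ext u; simp

lemma fderiv_apply₂ {U W Z : Type*} [NormedAddCommGroup U] [NormedSpace ℝ U]
    [NormedAddCommGroup W] [NormedSpace ℝ W] [NormedAddCommGroup Z] [NormedSpace ℝ Z]
    {T : V → U →L[ℝ] W →L[ℝ] Z} {x : V} (h : DifferentiableAt ℝ T x) (u : V) (v : U) (w : W) :
    fderiv ℝ (fun y => T y v w) x u = fderiv ℝ T x u v w := by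
  rw [(hasFDerivAt_apply₂ h v w).fderiv]; rfl

/-- `Γ` is at `x` the Levi-Civita connection of the field `T` of symmetric bilinear forms. -/
structure IsLeviCivita (T : V → V →L[ℝ] V →L[ℝ] ℝ) (Γ : V → V →L[ℝ] V →L[ℝ] V) (x : V) :
    Prop where
  diff : DifferentiableAt ℝ T x
  symm : ∀ᶠ y in 𝓝 x, ∀ v w, T y v w = T y w v
  nondeg : ∀ a b, (∀ w, T x a w = T x b w) → a = b
  koszul : ∀ u v w, T x (Γ x u v) w
    = (1 / 2) * (fderiv ℝ T x u v w + fderiv ℝ T x v u w - fderiv ℝ T x w u v)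

/-- The curvature of a field of bilinear maps regarded as a connection. -/
noncomputable def curvVec (Γ : V → V →L[ℝ] V →L[ℝ] V) (x u v w : V) : V :=
  fderiv ℝ Γ x u v w - fderiv ℝ Γ x v u w + Γ x u (Γ x v w) - Γ x v (Γ x u w)

variable {T T' : V → V →L[ℝ] V →L[ℝ] ℝ} {Γ Γ' : V → V →L[ℝ] V →L[ℝ] V} {x : V}

namespace IsLeviCivita

lemma symm_apply (h : IsLeviCivita T Γ x) (v w : V) : T x v w = T x w v :=
  h.symm.self_of_nhds v w

lemma fderiv_symm (h : IsLeviCivita T Γ x) (u v w : V) :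
    fderiv ℝ T x u v w = fderiv ℝ T x u w v := by
  rw [← fderiv_apply₂ h.diff, ← fderiv_apply₂ h.diff]
  have : (fun y => T y v w) =ᶠ[𝓝 x] fun y => T y w v := h.symm.mono fun y hy => hy v w
  rw [this.fderiv_eq]

lemma gam_symm (h : IsLeviCivita T Γ x) (u v : V) : Γ x u v = Γ x v u := by
  refine h.nondeg _ _ fun w => ?_
  rw [h.koszul, h.koszul, h.fderiv_symm w u v]
  ring

lemma compat (h : IsLeviCivita T Γ x) (u v w : V) :
    fderiv ℝ T x u v w = T x (Γ x u v) w + T x v (Γ x u w) := by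
  rw [h.symm_apply v, h.koszul, h.koszul, h.fderiv_symm w u v, h.fderiv_symm u w v]
  ring

end IsLeviCivita

lemma hasFDerivAt_pullback {φ : V → V} (hφ : DifferentiableAt ℝ φ x)
    (hφ' : DifferentiableAt ℝ (fderiv ℝ φ) x) (hT : DifferentiableAt ℝ T (φ x)) (u v w : V) :
    fderiv ℝ (fun y => T (φ y) (fderiv ℝ φ y v) (fderiv ℝ φ y w)) x u
      = fderiv ℝ T (φ x) (fderiv ℝ φ x u) (fderiv ℝ φ x v) (fderiv ℝ φ x w)
        + T (φ x) (fderiv ℝ (fderiv ℝ φ) x u v) (fderiv ℝ φ x w)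
        + T (φ x) (fderiv ℝ φ x v) (fderiv ℝ (fderiv ℝ φ) x u w) := by
  have h1 : HasFDerivAt (fun y => T (φ y)) ((fderiv ℝ T (φ x)).comp (fderiv ℝ φ x)) x :=
    HasFDerivAt.comp (G := V →L[ℝ] V →L[ℝ] ℝ) x hT.hasFDerivAt hφ.hasFDerivAt
  have h2 : ∀ v, HasFDerivAt (fun y => fderiv ℝ φ y v) ((fderiv ℝ (fderiv ℝ φ) x).flip v) x := by
    intro v
    refine (hφ'.hasFDerivAt.clm_apply (hasFDerivAt_const v x)).congr_fderiv ?_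
    ext u; simp
  rw [((h1.clm_apply (h2 v)).clm_apply (h2 w)).fderiv]
  simp only [add_apply, ContinuousLinearMap.comp_apply, ContinuousLinearMap.flip_apply]
  ring

lemma second_fderiv_symm {W : Type*} [NormedAddCommGroup W] [NormedSpace ℝ W] {f : V → W}
    (hf : ContDiffAt ℝ 2 f x) (u v : V) :
    fderiv ℝ (fderiv ℝ f) x u v = fderiv ℝ (fderiv ℝ f) x v u :=
  (hf.isSymmSndFDerivAt (by simp)) u v

/-- Transformation of the Levi-Civita connection under a change of coordinates. -/
lemma IsLeviCivita.pullback {φ : V → V} (hφ : ContDiffAt ℝ 2 φ x)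
    (hsurj : Function.Surjective (fderiv ℝ φ x)) (h : IsLeviCivita T Γ (φ x))
    (h' : IsLeviCivita T' Γ' x)
    (hT : ∀ᶠ y in 𝓝 x, ∀ v w, T' y v w = T (φ y) (fderiv ℝ φ y v) (fderiv ℝ φ y w)) (u v : V) :
    fderiv ℝ φ x (Γ' x u v) = Γ (φ x) (fderiv ℝ φ x u) (fderiv ℝ φ x v)
      + fderiv ℝ (fderiv ℝ φ) x u v := by
  have hd : DifferentiableAt ℝ φ x := hφ.differentiableAt (by simp)
  have hd' : DifferentiableAt ℝ (fderiv ℝ φ) x :=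
    (hφ.fderiv_right (m := 1) (by norm_num)).differentiableAt (by simp)
  have hDT : ∀ u v w, fderiv ℝ T' x u v w
      = fderiv ℝ T (φ x) (fderiv ℝ φ x u) (fderiv ℝ φ x v) (fderiv ℝ φ x w)
        + T (φ x) (fderiv ℝ (fderiv ℝ φ) x u v) (fderiv ℝ φ x w)
        + T (φ x) (fderiv ℝ φ x v) (fderiv ℝ (fderiv ℝ φ) x u w) := by
    intro u v w
    rw [← fderiv_apply₂ h'.diff, ← hasFDerivAt_pullback hd hd' h.diff]
    have : (fun y => T' y v w) =ᶠ[𝓝 x] fun y => T (φ y) (fderiv ℝ φ y v) (fderiv ℝ φ y w) :=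
      hT.mono fun y hy => hy v w
    rw [this.fderiv_eq]
  -- Test against `w = dφ w'` and compare the Koszul formulas. Of the six terms containing `D²φ`,
  -- four cancel by symmetry and the other two give `2 T(D²φ(u, v), dφ w')`.
  refine h.nondeg _ _ fun w => ?_
  obtain ⟨w, rfl⟩ := hsurj w
  have h1 := h'.koszul u v w
  rw [hT.self_of_nhds, hDT, hDT, hDT] at h1
  rw [h1, map_add, add_apply, h.koszul, second_fderiv_symm hφ v u, second_fderiv_symm hφ w u,
    second_fderiv_symm hφ w v, h.symm_apply _ (fderiv ℝ (fderiv ℝ φ) x v w),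
    h.symm_apply (fderiv ℝ φ x v) (fderiv ℝ (fderiv ℝ φ) x u w)]
  ring

/-- Transformation of the curvature under a change of coordinates. -/
lemma curvVec_pullback {φ : V → V} (hφ : ContDiffAt ℝ 3 φ x)
    (hΓ : DifferentiableAt ℝ Γ (φ x)) (hΓ' : DifferentiableAt ℝ Γ' x)
    (hsymm : ∀ u v, Γ (φ x) u v = Γ (φ x) v u)
    (hgam : ∀ᶠ y in 𝓝 x, ∀ u v, fderiv ℝ φ y (Γ' y u v)
      = Γ (φ y) (fderiv ℝ φ y u) (fderiv ℝ φ y v) + fderiv ℝ (fderiv ℝ φ) y u v) (u v w : V) :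
    fderiv ℝ φ x (curvVec Γ' x u v w)
      = curvVec Γ (φ x) (fderiv ℝ φ x u) (fderiv ℝ φ x v) (fderiv ℝ φ x w) := by
  have hφ' : ContDiffAt ℝ 2 (fderiv ℝ φ) x := hφ.fderiv_right (by norm_num)
  have hd : DifferentiableAt ℝ φ x := hφ.differentiableAt (by simp)
  have hd' : DifferentiableAt ℝ (fderiv ℝ φ) x := hφ'.differentiableAt (by simp)
  have hd2 : DifferentiableAt ℝ (fderiv ℝ (fderiv ℝ φ)) x :=
    (hφ'.fderiv_right (m := 1) (by norm_num)).differentiableAt (by simp)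
  have h2 : ∀ v, HasFDerivAt (fun y => fderiv ℝ φ y v) ((fderiv ℝ (fderiv ℝ φ) x).flip v) x := by
    intro v
    refine (hd'.hasFDerivAt.clm_apply (hasFDerivAt_const v x)).congr_fderiv ?_
    ext u; simp
  -- The transformation law of the connection, applied to `v, w` and differentiated along `u`.
  have key : ∀ u v w, fderiv ℝ (fderiv ℝ φ) x u (Γ' x v w) + fderiv ℝ φ x (fderiv ℝ Γ' x u v w)
      = fderiv ℝ Γ (φ x) (fderiv ℝ φ x u) (fderiv ℝ φ x v) (fderiv ℝ φ x w)
        + Γ (φ x) (fderiv ℝ (fderiv ℝ φ) x u v) (fderiv ℝ φ x w)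
        + Γ (φ x) (fderiv ℝ φ x v) (fderiv ℝ (fderiv ℝ φ) x u w)
        + fderiv ℝ (fderiv ℝ (fderiv ℝ φ)) x u v w := by
    intro u v w
    have hl := hd'.hasFDerivAt.clm_apply (hasFDerivAt_apply₂ hΓ' v w)
    have h1 : HasFDerivAt (fun y => Γ (φ y)) ((fderiv ℝ Γ (φ x)).comp (fderiv ℝ φ x)) x :=
      HasFDerivAt.comp (G := V →L[ℝ] V →L[ℝ] V) x hΓ.hasFDerivAt hd.hasFDerivAt
    have hr := ((h1.clm_apply (h2 v)).clm_apply (h2 w)).add (hasFDerivAt_apply₂ hd2 v w)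
    have hlr := hl.unique (hr.congr_of_eventuallyEq (hgam.mono fun y hy => hy v w))
    have := congrArg (fun L : V →L[ℝ] V => L u) hlr
    simp only [add_apply, ContinuousLinearMap.comp_apply, ContinuousLinearMap.flip_apply] at this
    rw [add_comm, this]
    abel
  -- Antisymmetrising in `u, v` kills the third derivative of `φ`, and the terms with `D²φ` cancel
  -- against those coming from the quadratic part of the curvature.
  have hg := hgam.self_of_nhds
  have k1 := eq_sub_of_add_eq' (key u v w)
  have k2 := eq_sub_of_add_eq' (key v u w)
  simp only [curvVec, map_add, map_sub, hg, k1, k2]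
  rw [second_fderiv_symm hφ' u v, second_fderiv_symm (hφ.of_le (by norm_num)) u v,
    hsymm (fderiv ℝ φ x u) (fderiv ℝ (fderiv ℝ φ) x v w),
    hsymm (fderiv ℝ φ x v) (fderiv ℝ (fderiv ℝ φ) x u w)]
  abel

/-! ### Conformal changes -/

/-- The change of the Levi-Civita connection under a conformal change of the metric. -/
lemma IsLeviCivita.conformal {c : V → ℝ} {a : V →L[ℝ] ℝ} {N : V} (h : IsLeviCivita T Γ x)
    (h' : IsLeviCivita T' Γ' x) (hc : HasFDerivAt c (-(2 * c x) • a) x)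
    (hT : ∀ᶠ y in 𝓝 x, T' y = c y • T y) (hN : ∀ w, T x N w = a w) (u v : V) :
    Γ' x u v = Γ x u v - (a u • v + a v • u - T x u v • N) := by
  -- The hypothesis on `c` is that of `c = exp (-2s)` with `a = ds`; `N` is the gradient of `s`.
  -- Each derivative of `T'` thus produces the extra term `-2 c a ⊗ T`, and the Koszul formula sums
  -- three of them.
  have hD : ∀ u v w, fderiv ℝ T' x u v w
      = c x * fderiv ℝ T x u v w - 2 * c x * a u * T x v w := by
    intro u v w
    have h1 := (hc.mul (hasFDerivAt_apply₂ h.diff v w)).congr_of_eventuallyEq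
      (f₁ := fun y => T' y v w) (hT.mono fun y hy => by simp [hy])
    rw [← fderiv_apply₂ h'.diff, h1.fderiv]
    simp only [add_apply, smul_apply, ContinuousLinearMap.flip_apply, smul_eq_mul]
    ring
  refine h'.nondeg _ _ fun w => ?_
  rw [h'.koszul, hD, hD, hD, hT.self_of_nhds]
  simp only [smul_apply, map_sub, map_add, map_smul, sub_apply, add_apply, smul_eq_mul, hN,
    h.koszul]
  ring

/-- The covariant derivative of the gradient is dual to the Hessian. -/
lemma IsLeviCivita.nabla_grad {a : V → V →L[ℝ] ℝ} {N : V → V} (h : IsLeviCivita T Γ x)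
    (ha : DifferentiableAt ℝ a x) (hNd : DifferentiableAt ℝ N x)
    (hN : ∀ᶠ y in 𝓝 x, ∀ w, T y (N y) w = a y w) (u w : V) :
    T x (fderiv ℝ N x u + Γ x u (N x)) w = fderiv ℝ a x u w - a x (Γ x u w) := by
  have h1 := (h.diff.hasFDerivAt.clm_apply hNd.hasFDerivAt).clm_apply (hasFDerivAt_const w x)
  have h2 := ha.hasFDerivAt.clm_apply (hasFDerivAt_const w x)
  have h3 := h1.unique (h2.congr_of_eventuallyEq (hN.mono fun y hy => hy w))
  have := congrArg (fun L : V →L[ℝ] ℝ => L u) h3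
  simp only [add_apply, ContinuousLinearMap.comp_apply, ContinuousLinearMap.flip_apply,
    zero_apply, map_zero, zero_add, h.compat u (N x) w, hN.self_of_nhds] at this
  rw [map_add, add_apply]
  linarith

/-- The change of the curvature under a conformal change of the metric. -/
lemma curvVec_conformal {a : V → V →L[ℝ] ℝ} {N : V → V} (h : IsLeviCivita T Γ x)
    (hΓ : DifferentiableAt ℝ Γ x) (hΓ' : DifferentiableAt ℝ Γ' x)
    (ha : DifferentiableAt ℝ a x) (hNd : DifferentiableAt ℝ N x)
    (hasymm : ∀ u v, fderiv ℝ a x u v = fderiv ℝ a x v u)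
    (hN : ∀ w, T x (N x) w = a x w)
    (hgam : ∀ᶠ y in 𝓝 x, ∀ u v, Γ' y u v
      = Γ y u v - (a y u • v + a y v • u - T y u v • N y)) (u v w : V) :
    curvVec Γ' x u v w = curvVec Γ x u v w
      - (fderiv ℝ a x u w - a x (Γ x u w)) • v + (fderiv ℝ a x v w - a x (Γ x v w)) • u
      + T x v w • (fderiv ℝ N x u + Γ x u (N x)) - T x u w • (fderiv ℝ N x v + Γ x v (N x))
      + (a x w * a x v) • u - (a x w * a x u) • v
      - a x (N x) • (T x v w • u - T x u w • v)
      + (T x v w * a x u - T x u w * a x v) • N x := by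
  have hD : ∀ u v w, fderiv ℝ Γ' x u v w = fderiv ℝ Γ x u v w
      - (fderiv ℝ a x u v • w + fderiv ℝ a x u w • v
        - (fderiv ℝ T x u v w • N x + T x v w • fderiv ℝ N x u)) := by
    intro u v w
    have ha' : ∀ v, HasFDerivAt (fun y => a y v) ((fderiv ℝ a x).flip v) x := by
      intro v
      refine (ha.hasFDerivAt.clm_apply (hasFDerivAt_const v x)).congr_fderiv ?_
      ext u; simp
    have h1 := (hasFDerivAt_apply₂ hΓ v w).sub (((((ha' v).smul (hasFDerivAt_const w x))).add
      ((ha' w).smul (hasFDerivAt_const v x))).sub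
        ((hasFDerivAt_apply₂ h.diff v w).smul hNd.hasFDerivAt))
    have h2 := (hasFDerivAt_apply₂ hΓ' v w).unique
      (h1.congr_of_eventuallyEq (hgam.mono fun y hy => hy v w))
    have := congrArg (fun L : V →L[ℝ] V => L u) h2
    simp only [add_apply, sub_apply, smul_apply, ContinuousLinearMap.smulRight_apply,
      ContinuousLinearMap.flip_apply, smul_zero, zero_add] at this
    rw [this]
    module
  have hg := hgam.self_of_nhds
  -- Metric compatibility replaces the derivative of `T` by terms in `Γ`; these complete the
  -- derivatives of `a` and `N` to covariant ones.
  simp only [curvVec, hD, hg, map_sub, map_add, map_smul, smul_eq_mul,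
    h.compat]
  rw [hasymm v u, h.gam_symm v u, h.symm_apply v u, h.symm_apply u (N x), h.symm_apply v (N x),
    hN, hN, h.symm_apply (Γ x u v) w, h.symm_apply u (Γ x v w), h.symm_apply v (Γ x u w)]
  module

end Connection

end WeakAH

namespace WeakAH

set_option synthInstance.maxHeartbeats 400000
set_option maxHeartbeats 1000000

/-! ### Linear algebra on `ℝ^(n+1)` -/

lemma e_induction {n : ℕ} {P : E n → Prop} (he : ∀ i, P (e n i))
    (hadd : ∀ u v, P u → P v → P (u + v)) (hsmul : ∀ (c : ℝ) u, P u → P (c • u)) (u : E n) :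
    P u := by
  rw [eq_sum_smul_e u]
  have h0 : P 0 := by simpa using hsmul 0 _ (he 0)
  exact Finset.sum_induction _ P hadd h0 fun i _ => hsmul _ _ (he i)

@[simp] lemma e_apply {n : ℕ} (i j : Fin (n + 1)) : e n i j = if j = i then 1 else 0 := by
  simp [e]

/-- The matrix of a bilinear map. -/
noncomputable def bilMatrix {n : ℕ} (B : E n →ₗ[ℝ] E n →ₗ[ℝ] ℝ) : Matrix (Fin (n + 1)) (Fin (n + 1)) ℝ :=
  Matrix.of fun i j => B (e n i) (e n j)

/-- The contraction of a bilinear map with the inverse of a matrix. -/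
noncomputable def contr {n : ℕ} (G : Matrix (Fin (n + 1)) (Fin (n + 1)) ℝ) (B : E n →ₗ[ℝ] E n →ₗ[ℝ] ℝ) : ℝ :=
  ∑ i, ∑ j, G⁻¹ i j * B (e n i) (e n j)

/-- The matrix of a linear map. -/
noncomputable def linMatrix {n : ℕ} (P : E n →L[ℝ] E n) : Matrix (Fin (n + 1)) (Fin (n + 1)) ℝ :=
  Matrix.of fun k i => P (e n i) k

lemma linMatrix_mul {n : ℕ} (P Q : E n →L[ℝ] E n) :
    linMatrix (P.comp Q) = linMatrix P * linMatrix Q := by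
  ext k i
  simp only [linMatrix, Matrix.of_apply, Matrix.mul_apply, ContinuousLinearMap.comp_apply]
  conv_lhs => rw [eq_sum_smul_e (Q (e n i))]
  simp [map_sum, mul_comm]

lemma linMatrix_id (n : ℕ) : linMatrix (ContinuousLinearMap.id ℝ (E n)) = 1 := by
  ext k i
  simp [linMatrix, Matrix.one_apply]

/-- Pulling back a bilinear map conjugates its matrix. -/
lemma pullback_matrix {n : ℕ} (B B' : E n →ₗ[ℝ] E n →ₗ[ℝ] ℝ) (P : E n →L[ℝ] E n)
    (h : ∀ v w, B' v w = B (P v) (P w)) :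
    bilMatrix B' = (linMatrix P).transpose * bilMatrix B * linMatrix P := by
  ext i j
  simp only [bilMatrix, Matrix.of_apply, Matrix.mul_apply, h, linMatrix, Matrix.transpose_apply]
  conv_lhs => rw [eq_sum_smul_e (P (e n i)), eq_sum_smul_e (P (e n j))]
  simp only [map_sum, map_smul, LinearMap.sum_apply, LinearMap.smul_apply, smul_eq_mul,
    Finset.mul_sum, Finset.sum_mul]
  refine Finset.sum_congr rfl fun k _ => ?_
  refine Finset.sum_congr rfl fun l _ => ?_
  ring

lemma contr_eq_trace {n : ℕ} (G : Matrix (Fin (n + 1)) (Fin (n + 1)) ℝ)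
    (B : E n →ₗ[ℝ] E n →ₗ[ℝ] ℝ) : contr G B = (G⁻¹ * (bilMatrix B).transpose).trace := by
  simp [contr, Matrix.trace, Matrix.mul_apply, bilMatrix]

/-- The contraction is `tr (G⁻¹ Bᵀ)`. If `G` and `B` both change by `Pᵀ · P`, then `G⁻¹ Bᵀ` is
conjugated by `P` and its trace is unchanged. This carries the coordinate invariance of `gradSq`,
`laplace` and `scalar`. -/
lemma contr_pullback {n : ℕ} (G G' : Matrix (Fin (n + 1)) (Fin (n + 1)) ℝ)
    (B B' : E n →ₗ[ℝ] E n →ₗ[ℝ] ℝ) (P Q : E n →L[ℝ] E n)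
    (hPQ : P.comp Q = ContinuousLinearMap.id ℝ (E n))
    (hQP : Q.comp P = ContinuousLinearMap.id ℝ (E n))
    (hB : ∀ v w, B' v w = B (P v) (P w))
    (hG : G' = (linMatrix P).transpose * G * linMatrix P) :
    contr G' B' = contr G B := by
  have h1 : linMatrix P * linMatrix Q = 1 := by rw [← linMatrix_mul, hPQ, linMatrix_id]
  have h2 : linMatrix Q * linMatrix P = 1 := by rw [← linMatrix_mul, hQP, linMatrix_id]
  have h3 : (linMatrix P)⁻¹ = linMatrix Q := Matrix.inv_eq_left_inv h2
  have h4 : ((linMatrix P).transpose)⁻¹ = (linMatrix Q).transpose := by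
    rw [← Matrix.transpose_nonsing_inv, h3]
  rw [contr_eq_trace, contr_eq_trace, pullback_matrix B B' P hB, hG, Matrix.mul_inv_rev,
    Matrix.mul_inv_rev, h3, h4, Matrix.transpose_mul, Matrix.transpose_mul,
    Matrix.transpose_transpose]
  have h5 : (linMatrix Q).transpose * (linMatrix P).transpose = 1 := by
    rw [← Matrix.transpose_mul, h1, Matrix.transpose_one]
  have h6 : linMatrix Q * (G⁻¹ * (linMatrix Q).transpose)
        * ((linMatrix P).transpose * ((bilMatrix B).transpose * linMatrix P))
      = linMatrix Q * (G⁻¹ * ((linMatrix Q).transpose * (linMatrix P).transpose)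
        * (bilMatrix B).transpose * linMatrix P) := by
    simp only [Matrix.mul_assoc]
  rw [h6, h5, Matrix.mul_one, Matrix.trace_mul_comm, Matrix.mul_assoc, h1, Matrix.mul_one]

/-- Conjugation invariance of the trace, needed because the Ricci tensor is the trace of a curvature
endomorphism. -/
lemma sum_conj_apply {n : ℕ} (A : E n →ₗ[ℝ] E n) (P Q : E n →L[ℝ] E n)
    (hPQ : P.comp Q = ContinuousLinearMap.id ℝ (E n)) :
    ∑ i, (Q (A (P (e n i)))) i = ∑ i, (A (e n i)) i := by
  have key : ∀ A : E n →ₗ[ℝ] E n, ∑ i, (A (e n i)) i = LinearMap.trace ℝ _ A := by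
    intro A
    rw [LinearMap.trace_eq_matrix_trace ℝ (EuclideanSpace.basisFun (Fin (n + 1)) ℝ).toBasis]
    simp [Matrix.trace, LinearMap.toMatrix_apply, e]
  have h1 := key (Q.toLinearMap ∘ₗ A ∘ₗ P.toLinearMap)
  have h2 : A ∘ₗ P.toLinearMap ∘ₗ Q.toLinearMap = A := by
    ext1 v
    have := congrArg (fun L : E n →L[ℝ] E n => L v) hPQ
    simp only [ContinuousLinearMap.comp_apply] at this
    simp [this]
  rw [LinearMap.trace_comp_comm', LinearMap.comp_assoc, h2, ← key] at h1
  simpa using h1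

lemma nondeg {n : ℕ} {B : Bil n} (h : (Matrix.of fun i j => B (e n i) (e n j)).det ≠ 0)
    {a b : E n} (hab : ∀ w, B a w = B b w) : a = b := by
  have h0 : ∀ j, ∑ i, (a - b) i * B (e n i) (e n j) = 0 := by
    intro j
    have : B (a - b) (e n j) = 0 := by simp [hab]
    rw [eq_sum_smul_e (a - b)] at this
    simpa only [map_sum, map_smul, sum_apply, smul_apply, smul_eq_mul] using this
  have h1 := Matrix.eq_zero_of_vecMul_eq_zero h (v := fun i => (a - b) i) (by
    ext j
    simpa [Matrix.vecMul, dotProduct] using h0 j)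
  have h2 : a - b = 0 := by
    ext i
    exact congrFun h1 i
  exact sub_eq_zero.1 h2

/-! ### Metrics on open subsets of `ℝ^(n+1)` -/

/-- `T` is a nondegenerate symmetric field of bilinear forms near `x` which is `C²` at `x`. -/
structure RegMetric {n : ℕ} (T : E n → Bil n) (x : E n) : Prop where
  smooth : ContDiffAt ℝ 2 T x
  symm : ∀ᶠ y in 𝓝 x, ∀ v w, T y v w = T y w v
  det_ne : (gram T x).det ≠ 0

section

variable {n : ℕ} {T : E n → Bil n} {x : E n}

lemma contDiffAt_gram {k : WithTop ℕ∞} (h : ContDiffAt ℝ k T x) (i j : Fin (n + 1)) :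
    ContDiffAt ℝ k (fun y => gram T y i j) x := by
  simp only [gram, Matrix.of_apply]
  exact (h.clm_apply contDiffAt_const).clm_apply contDiffAt_const

lemma contDiffAt_det {m : Type*} [Fintype m] [DecidableEq m] {k : WithTop ℕ∞}
    {G : E n → Matrix m m ℝ} (h : ∀ i j, ContDiffAt ℝ k (fun y => G y i j) x) :
    ContDiffAt ℝ k (fun y => (G y).det) x := by
  simp only [Matrix.det_apply]
  refine ContDiffAt.sum fun σ _ => ?_
  exact (contDiffAt_prod fun i _ => h _ _).const_smul _

lemma contDiffAt_inv {k : WithTop ℕ∞} {G : E n → Matrix (Fin (n + 1)) (Fin (n + 1)) ℝ}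
    (h : ∀ i j, ContDiffAt ℝ k (fun y => G y i j) x) (h0 : (G x).det ≠ 0) (i j : Fin (n + 1)) :
    ContDiffAt ℝ k (fun y => (G y)⁻¹ i j) x := by
  have h1 : (fun y => (G y)⁻¹ i j) = fun y => (G y).det⁻¹ * (G y).adjugate i j := by
    ext y
    rw [Matrix.inv_def, Ring.inverse_eq_inv', Matrix.smul_apply, smul_eq_mul]
  rw [h1]
  refine ((contDiffAt_det h).inv h0).mul ?_
  simp only [Matrix.adjugate_apply]
  refine contDiffAt_det fun i' j' => ?_
  simp only [Matrix.updateRow_apply]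
  by_cases hij : i' = j
  · simp only [hij, if_true]; exact contDiffAt_const
  · simp only [hij, if_false]; exact h _ _

lemma contDiffAt_pd {k m : WithTop ℕ∞} {f : E n → ℝ} (h : ContDiffAt ℝ k f x) (hm : m + 1 ≤ k)
    (i : Fin (n + 1)) : ContDiffAt ℝ m (pd i f) x :=
  (h.fderiv_right hm).clm_apply contDiffAt_const

lemma RegMetric.eventually (h : RegMetric T x) : ∀ᶠ y in 𝓝 x, RegMetric T y := by
  have h1 := h.smooth.eventually (by simp)
  have h2 := eventually_eventually_nhds.2 h.symm
  have h3 : ∀ᶠ y in 𝓝 x, (gram T y).det ≠ 0 :=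
    (contDiffAt_det (k := 2) fun i j => contDiffAt_gram h.smooth i j).continuousAt.eventually_ne
      h.det_ne
  filter_upwards [h1, h2, h3] with y h1 h2 h3 using ⟨h1, h2, h3⟩

lemma RegMetric.congr (h : RegMetric T x) {T' : E n → Bil n} (hT : T' =ᶠ[𝓝 x] T) :
    RegMetric T' x where
  smooth := h.smooth.congr_of_eventuallyEq hT
  symm := by
    filter_upwards [hT, h.symm] with y h1 h2
    rw [h1]; exact h2
  det_ne := by
    have := h.det_ne
    simp only [gram] at this ⊢
    rwa [hT.eq_of_nhds]

lemma pd_gram (h : DifferentiableAt ℝ T x) (i j l : Fin (n + 1)) :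
    pd i (fun y => gram T y j l) x = fderiv ℝ T x (e n i) (e n j) (e n l) :=
  fderiv_apply₂ h _ _ _

/-- The bilinear map `(u, v) ↦ u_i v_j e_k`. -/
noncomputable def basisBil (i j k : Fin (n + 1)) : E n →L[ℝ] E n →L[ℝ] E n :=
  (EuclideanSpace.proj i : E n →L[ℝ] ℝ).smulRight
    ((EuclideanSpace.proj j : E n →L[ℝ] ℝ).smulRight (e n k))

lemma basisBil_apply (i j k : Fin (n + 1)) (u v : E n) :
    basisBil i j k u v = u i • v j • e n k := rfl

/-- The Christoffel symbols as a field of bilinear maps. -/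
noncomputable def gam (G : E n → Matrix (Fin (n + 1)) (Fin (n + 1)) ℝ) (x : E n) :
    E n →L[ℝ] E n →L[ℝ] E n :=
  ∑ i, ∑ j, ∑ k, christoffel G k i j x • basisBil i j k

lemma gam_apply' (G : E n → Matrix (Fin (n + 1)) (Fin (n + 1)) ℝ) (u v : E n) :
    gam G x u v = ∑ i, ∑ j, ∑ k, christoffel G k i j x • u i • v j • e n k := by
  simp only [gam, sum_apply, smul_apply, basisBil_apply]

lemma gam_apply (G : E n → Matrix (Fin (n + 1)) (Fin (n + 1)) ℝ) (i j k : Fin (n + 1)) :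
    (gam G x (e n i) (e n j)) k = christoffel G k i j x := by
  simp [gam_apply', Finset.sum_ite_eq]

lemma contDiffAt_christoffel (h : RegMetric T x) (i j k : Fin (n + 1)) :
    ContDiffAt ℝ 1 (christoffel (gram T) k i j) x := by
  have hp : ∀ i j l, ContDiffAt ℝ 1 (pd i (fun y => gram T y j l)) x := fun i j l =>
    contDiffAt_pd (contDiffAt_gram h.smooth j l) (by norm_num) i
  have hi : ∀ i j, ContDiffAt ℝ 1 (fun y => (gram T y)⁻¹ i j) x := fun i j =>
    contDiffAt_inv (fun i j => (contDiffAt_gram h.smooth i j).of_le (by norm_num)) h.det_ne i j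
  unfold christoffel
  refine contDiffAt_const.mul (ContDiffAt.sum fun l _ => (hi _ _).mul ?_)
  exact ((hp _ _ _).add (hp _ _ _)).sub (hp _ _ _)

lemma differentiableAt_triple_sum {m V W : Type*} [Fintype m] [NormedAddCommGroup V]
    [NormedSpace ℝ V] [NormedAddCommGroup W] [NormedSpace ℝ W] {x : V} (c : m → m → m → V → ℝ)
    (B : m → m → m → W) (h : ∀ i j k, DifferentiableAt ℝ (c i j k) x) :
    DifferentiableAt ℝ (fun y => ∑ i, ∑ j, ∑ k, c i j k y • B i j k) x :=
  DifferentiableAt.fun_sum fun i _ => DifferentiableAt.fun_sum fun j _ =>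
    DifferentiableAt.fun_sum fun k _ => (h i j k).smul_const _

lemma differentiableAt_gam (h : RegMetric T x) : DifferentiableAt ℝ (gam (gram T)) x := by
  exact differentiableAt_triple_sum (fun i j k => christoffel (gram T) k i j) basisBil
    fun i j k => (contDiffAt_christoffel h i j k).differentiableAt (by simp)

/-- The Koszul formula. -/
lemma koszul (h : RegMetric T x) (u v w : E n) :
    T x (gam (gram T) x u v) w
      = (1 / 2) * (fderiv ℝ T x u v w + fderiv ℝ T x v u w - fderiv ℝ T x w u v) := by
  have hd : DifferentiableAt ℝ T x := h.smooth.differentiableAt (by simp)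
  induction u using e_induction with
  | hadd u u' hu hu' => simp only [map_add, add_apply, hu, hu']; ring
  | hsmul c u hu => simp only [map_smul, smul_apply, smul_eq_mul, hu]; ring
  | he i =>
  induction v using e_induction with
  | hadd u u' hu hu' => simp only [map_add, add_apply, hu, hu']; ring
  | hsmul c u hu => simp only [map_smul, smul_apply, smul_eq_mul, hu]; ring
  | he j =>
  induction w using e_induction with
  | hadd u u' hu hu' => simp only [map_add, add_apply, hu, hu']; ring
  | hsmul c u hu => simp only [map_smul, smul_apply, smul_eq_mul, hu]; ring
  | he m =>
  rw [eq_sum_smul_e (gam (gram T) x (e n i) (e n j))]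
  simp only [gam_apply, map_sum, map_smul, sum_apply, smul_apply, smul_eq_mul]
  simp only [christoffel, pd_gram hd]
  set c : Fin (n + 1) → ℝ := fun l => fderiv ℝ T x (e n i) (e n j) (e n l)
    + fderiv ℝ T x (e n j) (e n i) (e n l) - fderiv ℝ T x (e n l) (e n i) (e n j) with hc
  change ∑ k, (1 / 2 * ∑ l, (gram T x)⁻¹ k l * c l) * T x (e n k) (e n m) = 1 / 2 * c m
  have hG : ∀ k, T x (e n k) (e n m) = gram T x m k := fun k => by
    simp only [gram, Matrix.of_apply]; exact h.symm.self_of_nhds _ _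
  have h1 : ∀ l, ∑ k, gram T x m k * (gram T x)⁻¹ k l = if m = l then 1 else 0 := by
    intro l
    rw [← Matrix.mul_apply, Matrix.mul_nonsing_inv _ (isUnit_iff_ne_zero.2 h.det_ne),
      Matrix.one_apply]
  calc _ = ∑ k, ∑ l, 1 / 2 * (c l * (gram T x m k * (gram T x)⁻¹ k l)) := by
        refine Finset.sum_congr rfl fun k _ => ?_
        rw [Finset.mul_sum, Finset.sum_mul]
        refine Finset.sum_congr rfl fun l _ => ?_
        rw [hG]; ring
    _ = ∑ l, 1 / 2 * (c l * ∑ k, gram T x m k * (gram T x)⁻¹ k l) := by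
        rw [Finset.sum_comm]
        refine Finset.sum_congr rfl fun l _ => ?_
        rw [Finset.mul_sum, Finset.mul_sum]
    _ = 1 / 2 * c m := by simp [h1]

lemma RegMetric.isLeviCivita (h : RegMetric T x) : IsLeviCivita T (gam (gram T)) x where
  diff := h.smooth.differentiableAt (by simp)
  symm := h.symm
  nondeg _ _ hab := WeakAH.nondeg h.det_ne hab
  koszul := WeakAH.koszul h

/-- The Ricci tensor of a connection. -/
noncomputable def ricci (Γ : E n → E n →L[ℝ] E n →L[ℝ] E n) (x : E n) :
    E n →ₗ[ℝ] E n →ₗ[ℝ] ℝ :=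
  LinearMap.mk₂ ℝ (fun v w => ∑ i, (curvVec Γ x (e n i) v w) i)
    (fun v v' w => by
      rw [← Finset.sum_add_distrib]
      refine Finset.sum_congr rfl fun i _ => ?_
      simp only [curvVec, map_add, add_apply, PiLp.add_apply, PiLp.sub_apply]; ring)
    (fun c v w => by
      rw [smul_eq_mul, Finset.mul_sum]
      refine Finset.sum_congr rfl fun i _ => ?_
      simp only [curvVec, map_smul, smul_apply, PiLp.add_apply, PiLp.sub_apply, PiLp.smul_apply,
        smul_eq_mul]; ring)
    (fun v w w' => by
      rw [← Finset.sum_add_distrib]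
      refine Finset.sum_congr rfl fun i _ => ?_
      simp only [curvVec, map_add, PiLp.add_apply, PiLp.sub_apply]; ring)
    (fun c v w => by
      rw [smul_eq_mul, Finset.mul_sum]
      refine Finset.sum_congr rfl fun i _ => ?_
      simp only [curvVec, map_smul, PiLp.add_apply, PiLp.sub_apply, PiLp.smul_apply,
        smul_eq_mul]; ring)

lemma ricci_apply (Γ : E n → E n →L[ℝ] E n →L[ℝ] E n) (v w : E n) :
    ricci Γ x v w = ∑ i, (curvVec Γ x (e n i) v w) i := rfl

lemma riemann_eq (h : RegMetric T x) (i j m k : Fin (n + 1)) :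
    riemann (gram T) i j m k x = (curvVec (gam (gram T)) x (e n i) (e n j) (e n m)) k := by
  have h1 : ∀ i j m k, pd i (christoffel (gram T) k j m) x
      = (fderiv ℝ (gam (gram T)) x (e n i) (e n j) (e n m)) k := by
    intro i j m k
    have h2 := (EuclideanSpace.proj k : E n →L[ℝ] ℝ).hasFDerivAt.comp x
      (hasFDerivAt_apply₂ (differentiableAt_gam h) (e n j) (e n m))
    have h3 : christoffel (gram T) k j m = (EuclideanSpace.proj k : E n →L[ℝ] ℝ) ∘
        fun y => gam (gram T) y (e n j) (e n m) := by
      ext y; exact (gam_apply _ _ _ _).symm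
    rw [pd, h3, h2.fderiv]
    rfl
  have h3 : ∀ i j m k, (gam (gram T) x (e n i) (gam (gram T) x (e n j) (e n m))) k
      = ∑ p, christoffel (gram T) k i p x * christoffel (gram T) p j m x := by
    intro i j m k
    conv_lhs => rw [eq_sum_smul_e (gam (gram T) x (e n j) (e n m))]
    simp only [map_sum, map_smul, gam_apply]
    simp [gam_apply, mul_comm]
  simp only [riemann, curvVec, h1, PiLp.add_apply, PiLp.sub_apply, h3, Finset.sum_sub_distrib]
  ring

/-- The full contraction of the `(2,2)` curvature is reorganised as a trace giving Ricci, followed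
by a contraction with the inverse metric. -/
lemma scalar_eq_contr (h : RegMetric T x) :
    scalar (gram T) x = contr (gram T x) (ricci (gam (gram T)) x) := by
  simp only [scalar, curvOp, contr, ricci_apply, riemann_eq h, Finset.mul_sum]
  rw [Finset.sum_comm]
  refine Finset.sum_congr rfl fun j _ => ?_
  rw [Finset.sum_comm]

/-- The tensor square of the differential. -/
noncomputable def dSq (f : E n → ℝ) (x : E n) : E n →ₗ[ℝ] E n →ₗ[ℝ] ℝ :=
  LinearMap.mk₂ ℝ (fun v w => fderiv ℝ f x v * fderiv ℝ f x w)
    (fun _ _ _ => by simp only [map_add]; ring)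
    (fun _ _ _ => by simp only [map_smul, smul_eq_mul]; ring)
    (fun _ _ _ => by simp only [map_add]; ring)
    (fun _ _ _ => by simp only [map_smul, smul_eq_mul]; ring)

/-- The Hessian with respect to a connection. -/
noncomputable def hess (Γ : E n → E n →L[ℝ] E n →L[ℝ] E n) (f : E n → ℝ) (x : E n) :
    E n →ₗ[ℝ] E n →ₗ[ℝ] ℝ :=
  LinearMap.mk₂ ℝ (fun v w => fderiv ℝ (fderiv ℝ f) x v w - fderiv ℝ f x (Γ x v w))
    (fun _ _ _ => by simp only [map_add, add_apply]; ring)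
    (fun _ _ _ => by simp only [map_smul, smul_apply, smul_eq_mul]; ring)
    (fun _ _ _ => by simp only [map_add]; ring)
    (fun _ _ _ => by simp only [map_smul, smul_eq_mul]; ring)

lemma gradSq_eq_contr (G : E n → Matrix (Fin (n + 1)) (Fin (n + 1)) ℝ) (f : E n → ℝ) :
    gradSq G f x = contr (G x) (dSq f x) := by
  simp [gradSq, contr, dSq, pd, mul_assoc]

lemma laplace_eq_contr (G : E n → Matrix (Fin (n + 1)) (Fin (n + 1)) ℝ) {f : E n → ℝ}
    (hf : ContDiffAt ℝ 2 f x) : laplace G f x = contr (G x) (hess (gam G) f x) := by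
  have hd : DifferentiableAt ℝ (fderiv ℝ f) x :=
    (hf.fderiv_right (m := 1) (by norm_num)).differentiableAt (by simp)
  have h1 : ∀ i j, pd i (pd j f) x = fderiv ℝ (fderiv ℝ f) x (e n i) (e n j) := by
    intro i j
    have := (hd.hasFDerivAt.clm_apply (hasFDerivAt_const (e n j) x)).fderiv
    rw [pd]
    unfold pd
    rw [this]
    simp
  have h2 : ∀ i j, ∑ k, christoffel G k i j x * pd k f x
      = fderiv ℝ f x (gam G x (e n i) (e n j)) := by
    intro i j
    rw [eq_sum_smul_e (gam G x (e n i) (e n j))]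
    simp [gam_apply, pd]
  simp only [laplace, contr, hess, LinearMap.mk₂_apply, h1, h2]

end

end WeakAH

namespace WeakAH

set_option synthInstance.maxHeartbeats 400000
set_option maxHeartbeats 1000000

/-! ### Invariance of gradient norm, Laplacian, scalar curvature and Lie derivative under coordinate
changes -/

section ChangeOfCoordinates

lemma three_le_infty : (3 : WithTop ℕ∞) ≤ ∞ :=
  (mod_cast le_top : ((3 : ℕ∞) : WithTop ℕ∞) ≤ ∞)

variable {n : ℕ} {T T' : E n → Bil n} {φ : E n → E n} {x : E n}

lemma compBil_apply (B : Bil n) (L : E n →L[ℝ] E n) (v w : E n) :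
    compBil B L v w = B (L v) (L w) := rfl

section Flip

variable {U V : Type*} [NormedAddCommGroup U] [NormedSpace ℝ U] [NormedAddCommGroup V]
  [NormedSpace ℝ V] {x : V} {k : WithTop ℕ∞} {B : V → U →L[ℝ] U →L[ℝ] ℝ} {L : V → U →L[ℝ] U}

lemma contDiff_flip : ContDiff ℝ k (fun L : U →L[ℝ] U →L[ℝ] ℝ => L.flip) :=
  LinearIsometryEquiv.contDiff (𝕜 := ℝ) (E := U →L[ℝ] U →L[ℝ] ℝ) (F := U →L[ℝ] U →L[ℝ] ℝ)
    (ContinuousLinearMap.flipₗᵢ ℝ U U ℝ)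

lemma contDiffAt_flip (hB : ContDiffAt ℝ k B x) : ContDiffAt ℝ k (fun y => (B y).flip) x :=
  ContDiffAt.comp (E := V) (F := U →L[ℝ] U →L[ℝ] ℝ) (G := U →L[ℝ] U →L[ℝ] ℝ)
    (g := fun L => L.flip) (f := B) x contDiff_flip.contDiffAt hB

lemma differentiableAt_flip (hB : DifferentiableAt ℝ B x) :
    DifferentiableAt ℝ (fun y => (B y).flip) x :=
  DifferentiableAt.comp (E := V) (F := U →L[ℝ] U →L[ℝ] ℝ) (G := U →L[ℝ] U →L[ℝ] ℝ)
    (g := fun L => L.flip) (f := B) x ((contDiff_flip (k := 1)).differentiable (by simp) _) hB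

lemma contDiffAt_bilinearComp (hB : ContDiffAt ℝ k B x) (hL : ContDiffAt ℝ k L x) :
    ContDiffAt ℝ k (fun y => (B y).bilinearComp (L y) (L y)) x :=
  contDiffAt_flip ((contDiffAt_flip (hB.clm_comp hL)).clm_comp hL)

lemma differentiableAt_bilinearComp (hB : DifferentiableAt ℝ B x) (hL : DifferentiableAt ℝ L x) :
    DifferentiableAt ℝ (fun y => (B y).bilinearComp (L y) (L y)) x :=
  differentiableAt_flip ((differentiableAt_flip (hB.clm_comp hL)).clm_comp hL)

end Flip

lemma contDiffAt_smul_clm {U V W : Type*} [NormedAddCommGroup U] [NormedSpace ℝ U]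
    [NormedAddCommGroup V] [NormedSpace ℝ V] [NormedAddCommGroup W] [NormedSpace ℝ W] {x : V}
    {k : WithTop ℕ∞} {c : V → ℝ} {B : V → U →L[ℝ] W}
    (hc : ContDiffAt ℝ k c x) (hB : ContDiffAt ℝ k B x) :
    ContDiffAt ℝ k (fun y => c y • B y) x :=
  hc.smul hB

lemma contDiffAt_compBil {V : Type*} [NormedAddCommGroup V] [NormedSpace ℝ V] {x : V}
    {k : WithTop ℕ∞} {B : V → Bil n} {L : V → E n →L[ℝ] E n}
    (hB : ContDiffAt ℝ k B x) (hL : ContDiffAt ℝ k L x) :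
    ContDiffAt ℝ k (fun y => compBil (B y) (L y)) x :=
  contDiffAt_bilinearComp hB hL

lemma gram_compBil (B : Bil n) (L : E n →L[ℝ] E n) :
    (Matrix.of fun i j => compBil B L (e n i) (e n j))
      = (linMatrix L).transpose * (Matrix.of fun i j => B (e n i) (e n j)) * linMatrix L := by
  let B₁ : E n →ₗ[ℝ] E n →ₗ[ℝ] ℝ := ContinuousLinearMap.toLinearMap₁₂ B
  let B₂ : E n →ₗ[ℝ] E n →ₗ[ℝ] ℝ := ContinuousLinearMap.toLinearMap₁₂ (compBil B L)
  exact pullback_matrix B₁ B₂ L fun v w => rfl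

lemma linMatrix_isUnit {P Q : E n →L[ℝ] E n} (hQP : Q.comp P = ContinuousLinearMap.id ℝ (E n)) :
    IsUnit (linMatrix P).det := by
  have h2 : linMatrix Q * linMatrix P = 1 := by rw [← linMatrix_mul, hQP, linMatrix_id]
  have h3 := congrArg Matrix.det h2
  rw [Matrix.det_mul, Matrix.det_one] at h3
  exact IsUnit.of_mul_eq_one_right _ h3

lemma RegMetric.pullback (h : RegMetric T (φ x)) (hφ : ContDiffAt ℝ 3 φ x)
    {Q : E n →L[ℝ] E n} (hQP : Q.comp (fderiv ℝ φ x) = ContinuousLinearMap.id ℝ (E n))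
    (hT : T' =ᶠ[𝓝 x] fun y => compBil (T (φ y)) (fderiv ℝ φ y)) : RegMetric T' x := by
  refine RegMetric.congr ⟨?_, ?_, ?_⟩ hT
  · exact contDiffAt_compBil (h.smooth.comp x (hφ.of_le (by norm_num)))
      (hφ.fderiv_right (by norm_num))
  · filter_upwards [hφ.continuousAt.eventually h.symm] with y hy v w
    exact hy _ _
  · rw [gram, gram_compBil, Matrix.det_mul, Matrix.det_mul, Matrix.det_transpose]
    exact mul_ne_zero (mul_ne_zero (linMatrix_isUnit hQP).ne_zero h.det_ne)
      (linMatrix_isUnit hQP).ne_zero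

lemma gam_pullback (h : RegMetric T (φ x)) (hφ : ContDiffAt ℝ 3 φ x)
    {Q : E n →L[ℝ] E n} (hQP : Q.comp (fderiv ℝ φ x) = ContinuousLinearMap.id ℝ (E n))
    (hPQ : (fderiv ℝ φ x).comp Q = ContinuousLinearMap.id ℝ (E n))
    (hT : T' =ᶠ[𝓝 x] fun y => compBil (T (φ y)) (fderiv ℝ φ y)) (u v : E n) :
    fderiv ℝ φ x (gam (gram T') x u v)
      = gam (gram T) (φ x) (fderiv ℝ φ x u) (fderiv ℝ φ x v) + fderiv ℝ (fderiv ℝ φ) x u v := by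
  refine h.isLeviCivita.pullback (hφ.of_le (by norm_num)) (fun v => ⟨Q v, ?_⟩)
    (h.pullback hφ hQP hT).isLeviCivita ?_ u v
  · exact congrArg (fun L : E n →L[ℝ] E n => L v) hPQ
  · filter_upwards [hT] with y hy v w
    rw [hy]; rfl

/-- The hypotheses of a change of coordinates. -/
structure IsCoordChange (φ : E n → E n) (x : E n) : Prop where
  smooth : ContDiffAt ℝ ∞ φ x
  inv : ∀ᶠ y in 𝓝 x, ∃ Q : E n →L[ℝ] E n, Q.comp (fderiv ℝ φ y) = ContinuousLinearMap.id ℝ (E n) ∧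
    (fderiv ℝ φ y).comp Q = ContinuousLinearMap.id ℝ (E n)

lemma gram_pullback (hT : T' =ᶠ[𝓝 x] fun y => compBil (T (φ y)) (fderiv ℝ φ y)) :
    gram T' x = (linMatrix (fderiv ℝ φ x)).transpose * gram T (φ x) * linMatrix (fderiv ℝ φ x) := by
  have : gram T' x = Matrix.of fun i j =>
      compBil (T (φ x)) (fderiv ℝ φ x) (e n i) (e n j) := by
    simp only [gram, hT.eq_of_nhds]
  rw [this, gram_compBil]
  rfl

lemma IsCoordChange.gradSq_eq (hφ : IsCoordChange φ x)
    (hT : T' =ᶠ[𝓝 x] fun y => compBil (T (φ y)) (fderiv ℝ φ y)) {f : E n → ℝ}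
    {f' : E n → ℝ} (hf : DifferentiableAt ℝ f (φ x)) (hff : f' =ᶠ[𝓝 x] fun y => f (φ y)) :
    gradSq (gram T') f' x = gradSq (gram T) f (φ x) := by
  obtain ⟨Q, hQ1, hQ2⟩ := hφ.inv.self_of_nhds
  rw [gradSq_eq_contr, gradSq_eq_contr]
  refine contr_pullback _ _ _ _ (fderiv ℝ φ x) Q hQ2 hQ1 (fun v w => ?_) (gram_pullback hT)
  have h1 : fderiv ℝ f' x = (fderiv ℝ f (φ x)).comp (fderiv ℝ φ x) := by
    rw [hff.fderiv_eq]
    exact fderiv_comp x hf (hφ.smooth.differentiableAt (by simp))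
  simp [dSq, h1]

/-- The Hessian is a tensor: the term `df(D²φ)` in the second derivative of `f ∘ φ` is cancelled by
the inhomogeneous term in the transformation law of `gam`. -/
lemma IsCoordChange.laplace_eq (hφ : IsCoordChange φ x) (h : RegMetric T (φ x))
    (hT : T' =ᶠ[𝓝 x] fun y => compBil (T (φ y)) (fderiv ℝ φ y)) {f : E n → ℝ}
    {f' : E n → ℝ} (hf : ContDiffAt ℝ 2 f (φ x)) (hff : f' =ᶠ[𝓝 x] fun y => f (φ y)) :
    laplace (gram T') f' x = laplace (gram T) f (φ x) := by
  obtain ⟨Q, hQ1, hQ2⟩ := hφ.inv.self_of_nhds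
  have h3 : ContDiffAt ℝ 3 φ x := hφ.smooth.of_le three_le_infty
  have hf' : ContDiffAt ℝ 2 f' x :=
    (hf.comp x (h3.of_le (by norm_num))).congr_of_eventuallyEq hff
  rw [laplace_eq_contr _ hf, laplace_eq_contr _ hf']
  refine contr_pullback _ _ _ _ (fderiv ℝ φ x) Q hQ2 hQ1 (fun v w => ?_) (gram_pullback hT)
  have h1 : ∀ᶠ y in 𝓝 x, fderiv ℝ f' y = (fderiv ℝ f (φ y)).comp (fderiv ℝ φ y) := by
    filter_upwards [eventually_eventually_nhds.2 hff, h3.eventually (by simp),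
      h3.continuousAt.eventually (hf.eventually (by simp))] with y h1 h2 h4
    rw [Filter.EventuallyEq.fderiv_eq h1]
    exact fderiv_comp y (h4.differentiableAt (by simp)) (h2.differentiableAt (by simp))
  have hd' : DifferentiableAt ℝ (fderiv ℝ φ) x :=
    (h3.fderiv_right (m := 2) (by norm_num)).differentiableAt (by simp)
  have hdf : DifferentiableAt ℝ (fderiv ℝ f) (φ x) :=
    (hf.fderiv_right (m := 1) (by norm_num)).differentiableAt (by simp)
  have hdf' : DifferentiableAt ℝ (fderiv ℝ f') x :=
    (hf'.fderiv_right (m := 1) (by norm_num)).differentiableAt (by simp)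
  have h2 : fderiv ℝ (fderiv ℝ f') x v w
      = fderiv ℝ (fderiv ℝ f) (φ x) (fderiv ℝ φ x v) (fderiv ℝ φ x w)
        + fderiv ℝ f (φ x) (fderiv ℝ (fderiv ℝ φ) x v w) := by
    have e1 := (HasFDerivAt.comp (G := E n →L[ℝ] ℝ) x hdf.hasFDerivAt
      (h3.differentiableAt (by simp)).hasFDerivAt).clm_apply
        (hd'.hasFDerivAt.clm_apply (hasFDerivAt_const w x))
    have e2 := hdf'.hasFDerivAt.clm_apply (hasFDerivAt_const w x)
    have e3 := e2.unique (e1.congr_of_eventuallyEq (h1.mono fun y hy => by simp [hy]))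
    have := congrArg (fun L : E n →L[ℝ] ℝ => L v) e3
    simp only [add_apply, ContinuousLinearMap.comp_apply, ContinuousLinearMap.flip_apply,
      zero_apply, map_zero, zero_add, Function.comp_apply] at this
    rw [this, add_comm]
  simp only [hess, LinearMap.mk₂_apply, h2, h1.self_of_nhds, ContinuousLinearMap.comp_apply]
  rw [gam_pullback h h3 hQ1 hQ2 hT, map_add]
  ring

/-- By `curvVec_pullback` the curvature endomorphism is conjugated by `dφ`, so Ricci pulls back as a
bilinear form, and the metric contraction is invariant. -/
lemma IsCoordChange.scalar_eq (hφ : IsCoordChange φ x) (h : RegMetric T (φ x))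
    (hT : T' =ᶠ[𝓝 x] fun y => compBil (T (φ y)) (fderiv ℝ φ y)) :
    scalar (gram T') x = scalar (gram T) (φ x) := by
  obtain ⟨Q, hQ1, hQ2⟩ := hφ.inv.self_of_nhds
  have h3 : ContDiffAt ℝ 3 φ x := hφ.smooth.of_le three_le_infty
  have h' : RegMetric T' x := h.pullback h3 hQ1 hT
  rw [scalar_eq_contr h, scalar_eq_contr h']
  refine contr_pullback _ _ _ _ (fderiv ℝ φ x) Q hQ2 hQ1 (fun v w => ?_) (gram_pullback hT)
  have hg : ∀ᶠ y in 𝓝 x, ∀ u v, fderiv ℝ φ y (gam (gram T') y u v)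
      = gam (gram T) (φ y) (fderiv ℝ φ y u) (fderiv ℝ φ y v) + fderiv ℝ (fderiv ℝ φ) y u v := by
    filter_upwards [eventually_eventually_nhds.2 hT, h3.eventually (by simp),
      h3.continuousAt.eventually h.eventually, hφ.inv] with y h1 h2 h4 ⟨Q, hQ1, hQ2⟩ u v
    exact gam_pullback h4 h2 hQ1 hQ2 h1 u v
  have hc := curvVec_pullback h3 (differentiableAt_gam h) (differentiableAt_gam h')
    h.isLeviCivita.gam_symm hg
  have hQ : ∀ v, Q (fderiv ℝ φ x v) = v := fun v => congrArg (fun L : E n →L[ℝ] E n => L v) hQ1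
  have hc' : ∀ u v w, curvVec (gam (gram T')) x u v w = Q (curvVec (gam (gram T)) (φ x)
      (fderiv ℝ φ x u) (fderiv ℝ φ x v) (fderiv ℝ φ x w)) := fun u v w => by
    rw [← hc, hQ]
  rw [ricci_apply, ricci_apply]
  simp only [hc']
  let A : E n →ₗ[ℝ] E n :=
    { toFun := fun u => curvVec (gam (gram T)) (φ x) u (fderiv ℝ φ x v) (fderiv ℝ φ x w)
      map_add' := fun u u' => by
        simp only [curvVec, map_add, add_apply]; abel
      map_smul' := fun c u => by
        simp only [curvVec, map_smul, smul_apply, RingHom.id_apply]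
        module }
  exact sum_conj_apply A (fderiv ℝ φ x) Q hQ2

/-- The Lie derivative along a field that is constant in the coordinates `φ`. -/
lemma IsCoordChange.lieE_eq (hφ : IsCoordChange φ x) (hTd : DifferentiableAt ℝ T (φ x))
    (hT : T' =ᶠ[𝓝 x] fun y => compBil (T (φ y)) (fderiv ℝ φ y)) {X : E n → E n} {c : E n}
    (hX : DifferentiableAt ℝ X x) (hXc : ∀ᶠ y in 𝓝 x, fderiv ℝ φ y (X y) = c) :
    lieE X T' x = compBil (fderiv ℝ T (φ x) c) (fderiv ℝ φ x) := by
  have h3 : ContDiffAt ℝ 3 φ x := hφ.smooth.of_le three_le_infty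
  have hd : DifferentiableAt ℝ φ x := h3.differentiableAt (by simp)
  have hd' : DifferentiableAt ℝ (fderiv ℝ φ) x :=
    (h3.fderiv_right (m := 2) (by norm_num)).differentiableAt (by simp)
  have hTd' : DifferentiableAt ℝ T' x := by
    refine DifferentiableAt.congr_of_eventuallyEq ?_ hT
    have hTφ : DifferentiableAt ℝ (fun y => T (φ y)) x :=
      DifferentiableAt.comp (G := Bil n) x hTd hd
    exact differentiableAt_bilinearComp hTφ hd'
  -- Differentiating `dφ(X) = c` expresses `dφ(DX)` through `D²φ`. The two `DX` terms of the Lie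
  -- derivative then cancel the two `D²φ` terms in the derivative of the pullback.
  have hXd : ∀ v, fderiv ℝ φ x (fderiv ℝ X x v) = - fderiv ℝ (fderiv ℝ φ) x (X x) v := by
    intro v
    have e1 := hd'.hasFDerivAt.clm_apply hX.hasFDerivAt
    have e2 := (hasFDerivAt_const c x).unique
      (e1.congr_of_eventuallyEq (hXc.mono fun y hy => hy.symm))
    have := congrArg (fun L : E n →L[ℝ] E n => L v) e2
    simp only [add_apply, ContinuousLinearMap.comp_apply, ContinuousLinearMap.flip_apply,
      zero_apply] at this
    rw [second_fderiv_symm (h3.of_le (by norm_num))]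
    exact eq_neg_of_add_eq_zero_left this.symm
  have hT0 := hT.eq_of_nhds
  ext v w
  have h1 := hasFDerivAt_pullback hd hd' hTd (X x) v w
  have h2 : fderiv ℝ T' x (X x) v w
      = fderiv ℝ (fun y => T (φ y) (fderiv ℝ φ y v) (fderiv ℝ φ y w)) x (X x) := by
    rw [← fderiv_apply₂ hTd']
    have : (fun y => T' y v w) =ᶠ[𝓝 x] fun y => T (φ y) (fderiv ℝ φ y v) (fderiv ℝ φ y w) :=
      hT.mono fun y hy => by simp only [hy, compBil_apply]
    rw [this.fderiv_eq]
  simp only [lieE, add_apply, ContinuousLinearMap.bilinearComp_apply,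
    ContinuousLinearMap.id_apply, h2, h1, hT0, compBil_apply, hXd, hXc.self_of_nhds, map_neg,
    neg_apply]
  ring

end ChangeOfCoordinates

/-! ### The scalar curvature of a conformal metric -/

section Conformal

variable {n : ℕ} {T : E n → Bil n} {x : E n}

/-- The gradient of a function. -/
noncomputable def grad (G : E n → Matrix (Fin (n + 1)) (Fin (n + 1)) ℝ) (f : E n → ℝ) (x : E n) :
    E n := ∑ i, ∑ j, ((G x)⁻¹ i j * pd j f x) • e n i

lemma grad_spec (h : RegMetric T x) (f : E n → ℝ) (w : E n) :
    T x (grad (gram T) f x) w = fderiv ℝ f x w := by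
  induction w using e_induction with
  | hadd u v hu hv => rw [map_add, map_add, hu, hv]
  | hsmul c u hu => rw [map_smul, map_smul, hu]
  | he m =>
  have hG : ∀ i, T x (e n i) (e n m) = gram T x m i := fun k => by
    simp only [gram, Matrix.of_apply]; exact h.symm.self_of_nhds _ _
  have h1 : ∀ j, ∑ i, gram T x m i * (gram T x)⁻¹ i j = if m = j then 1 else 0 := by
    intro l
    rw [← Matrix.mul_apply, Matrix.mul_nonsing_inv _ (isUnit_iff_ne_zero.2 h.det_ne),
      Matrix.one_apply]
  simp only [grad, map_sum, map_smul, sum_apply, smul_apply, smul_eq_mul, hG]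
  rw [Finset.sum_comm]
  calc _ = ∑ j, (∑ i, gram T x m i * (gram T x)⁻¹ i j) * pd j f x := by
        refine Finset.sum_congr rfl fun j _ => ?_
        rw [Finset.sum_mul]
        refine Finset.sum_congr rfl fun i _ => ?_
        ring
    _ = _ := by simp [h1, pd]

/-- Lowering an index with `T` and contracting with its inverse cancel, leaving the trace of `A`.
This identifies the Laplacian with the trace of `∇N`, and `|ds|²` with `ds(N)`. -/
lemma contr_metric_left (h : RegMetric T x) (B : E n →ₗ[ℝ] E n →ₗ[ℝ] ℝ) (A : E n →ₗ[ℝ] E n)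
    (hA : ∀ u w, B u w = T x (A u) w) : contr (gram T x) B = ∑ i, (A (e n i)) i := by
  have hG : ∀ k j, T x (e n k) (e n j) = gram T x k j := fun k j => rfl
  have h1 : ∀ k i, ∑ j, gram T x k j * (gram T x)⁻¹ j i = if k = i then 1 else 0 := by
    intro k i
    rw [← Matrix.mul_apply, Matrix.mul_nonsing_inv _ (isUnit_iff_ne_zero.2 h.det_ne),
      Matrix.one_apply]
  have hs : ∀ i j, (gram T x)⁻¹ i j = (gram T x)⁻¹ j i := by
    have : (gram T x).transpose = gram T x := by
      ext i j
      simp only [gram, Matrix.transpose_apply, Matrix.of_apply]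
      exact h.symm.self_of_nhds _ _
    intro i j
    conv_lhs => rw [← this, ← Matrix.transpose_nonsing_inv, Matrix.transpose_apply]
  have h2 : ∀ i j, B (e n i) (e n j) = ∑ k, (A (e n i)) k * gram T x k j := by
    intro i j
    rw [hA]
    conv_lhs => rw [eq_sum_smul_e (A (e n i))]
    simp only [map_sum, map_smul, sum_apply, smul_apply, smul_eq_mul, hG]
  simp only [contr, h2]
  refine Finset.sum_congr rfl fun i _ => ?_
  calc ∑ j, (gram T x)⁻¹ i j * ∑ k, (A (e n i)) k * gram T x k j
      = ∑ k, (A (e n i)) k * ∑ j, gram T x k j * (gram T x)⁻¹ j i := by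
        simp only [Finset.mul_sum]
        rw [Finset.sum_comm]
        refine Finset.sum_congr rfl fun k _ => Finset.sum_congr rfl fun j _ => ?_
        rw [hs i j]; ring
    _ = _ := by simp [h1]

/-- The trace of the rank-one endomorphism `L ⊗ v`; it evaluates each such term in the traced
curvature formula. -/
lemma sum_apply_mul (L : E n →ₗ[ℝ] ℝ) (v : E n) : ∑ i, L (e n i) * v i = L v := by
  conv_rhs => rw [eq_sum_smul_e v]
  simp [mul_comm]

lemma contr_smul_metric {c : ℝ} (hc : c ≠ 0) (G : Matrix (Fin (n + 1)) (Fin (n + 1)) ℝ)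
    (hG : G.det ≠ 0) (B : E n →ₗ[ℝ] E n →ₗ[ℝ] ℝ) : contr (c • G) B = c⁻¹ * contr G B := by
  have h1 : (c • G)⁻¹ = c⁻¹ • G⁻¹ := by
    refine Matrix.inv_eq_left_inv ?_
    rw [Matrix.smul_mul, Matrix.mul_smul, smul_smul, inv_mul_cancel₀ hc, one_smul,
      Matrix.nonsing_inv_mul _ (isUnit_iff_ne_zero.2 hG)]
  simp only [contr, h1, Matrix.smul_apply, smul_eq_mul, Finset.mul_sum, mul_assoc]

lemma contr_add (G : Matrix (Fin (n + 1)) (Fin (n + 1)) ℝ) (B B' : E n →ₗ[ℝ] E n →ₗ[ℝ] ℝ) :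
    contr G (B + B') = contr G B + contr G B' := by
  simp only [contr, LinearMap.add_apply, mul_add, Finset.sum_add_distrib]

lemma contr_smul (G : Matrix (Fin (n + 1)) (Fin (n + 1)) ℝ) (c : ℝ)
    (B : E n →ₗ[ℝ] E n →ₗ[ℝ] ℝ) : contr G (c • B) = c * contr G B := by
  simp only [contr, LinearMap.smul_apply, smul_eq_mul, Finset.mul_sum]
  refine Finset.sum_congr rfl fun i _ => Finset.sum_congr rfl fun j _ => ?_
  ring

lemma differentiableAt_grad (h : RegMetric T x) {f : E n → ℝ} (hf : ContDiffAt ℝ 2 f x) :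
    DifferentiableAt ℝ (grad (gram T) f) x := by
  unfold grad
  refine DifferentiableAt.fun_sum fun i _ => DifferentiableAt.fun_sum fun j _ => ?_
  refine DifferentiableAt.smul_const (DifferentiableAt.mul ?_ ?_) _
  · exact (contDiffAt_inv (fun i j => contDiffAt_gram h.smooth i j) h.det_ne i j).differentiableAt
      (by simp)
  · exact (contDiffAt_pd (m := 1) hf (by norm_num) j).differentiableAt (by simp)

/-- The Ricci tensor of a conformal metric. -/
lemma ricci_conformal {T' : E n → Bil n} {s c : E n → ℝ} (h : RegMetric T x)
    (h' : RegMetric T' x) (hs : ContDiffAt ℝ 2 s x)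
    (hc : ∀ᶠ y in 𝓝 x, HasFDerivAt c (-(2 * c y) • fderiv ℝ s y) y)
    (hT : ∀ᶠ y in 𝓝 x, T' y = c y • T y) :
    ricci (gam (gram T')) x = ricci (gam (gram T)) x
      + ((n : ℝ) - 1) • hess (gam (gram T)) s x + ((n : ℝ) - 1) • dSq s x
      + (contr (gram T x) (hess (gam (gram T)) s x) - ((n : ℝ) - 1) * gradSq (gram T) s x)
        • ContinuousLinearMap.toLinearMap₁₂ (T x) := by
  set Γ := gam (gram T) with hΓ
  set N : E n → E n := grad (gram T) s with hNdef
  have hN : ∀ᶠ y in 𝓝 x, ∀ w, T y (N y) w = fderiv ℝ s y w :=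
    h.eventually.mono fun y hy w => grad_spec hy s w
  have hgam : ∀ᶠ y in 𝓝 x, ∀ u v, gam (gram T') y u v
      = Γ y u v - (fderiv ℝ s y u • v + fderiv ℝ s y v • u - T y u v • N y) := by
    filter_upwards [h.eventually, h'.eventually, hc, eventually_eventually_nhds.2 hT, hN]
      with y h1 h2 h3 h4 h5 u v
    exact h1.isLeviCivita.conformal h2.isLeviCivita h3 h4 h5 u v
  have ha : DifferentiableAt ℝ (fderiv ℝ s) x :=
    (hs.fderiv_right (m := 1) (by norm_num)).differentiableAt (by simp)
  have hNd : DifferentiableAt ℝ N x := differentiableAt_grad h hs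
  have hcv := curvVec_conformal h.isLeviCivita (differentiableAt_gam h) (differentiableAt_gam h')
    ha hNd (second_fderiv_symm hs) hN.self_of_nhds hgam
  have hM := h.isLeviCivita.nabla_grad ha hNd hN
  -- The endomorphism `∇N`, which is the Hessian of `s` with one index raised.
  let M : E n →ₗ[ℝ] E n := (fderiv ℝ N x + (Γ x).flip (N x)).toLinearMap
  have hMa : ∀ u, M u = fderiv ℝ N x u + Γ x u (N x) := fun u => rfl
  have hMT : ∀ u w, T x (M u) w = hess Γ s x u w := fun u w => by
    rw [hMa, hM]; rfl
  have htr : contr (gram T x) (hess Γ s x) = ∑ i, (M (e n i)) i :=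
    contr_metric_left h _ M fun u w => (hMT u w).symm
  have hgr : gradSq (gram T) s x = fderiv ℝ s x (N x) := by
    rw [gradSq_eq_contr, contr_metric_left h _ ((fderiv ℝ s x).toLinearMap.smulRight (N x))
      (fun u w => by simp [dSq, hN.self_of_nhds])]
    exact sum_apply_mul ((fderiv ℝ s x).toLinearMap) (N x)
  rw [htr, hgr]
  refine LinearMap.ext fun v => LinearMap.ext fun w => ?_
  have hcv' : ∀ u, curvVec (gam (gram T')) x u v w = curvVec Γ x u v w
      - hess Γ s x u w • v + hess Γ s x v w • u + T x v w • M u - T x u w • M v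
      + (fderiv ℝ s x w * fderiv ℝ s x v) • u - (fderiv ℝ s x w * fderiv ℝ s x u) • v
      - fderiv ℝ s x (N x) • (T x v w • u - T x u w • v)
      + (T x v w * fderiv ℝ s x u - T x u w * fderiv ℝ s x v) • N x := fun u => hcv u v w
  have s1 : ∑ i, hess Γ s x (e n i) w * v i = hess Γ s x v w :=
    sum_apply_mul ((hess Γ s x).flip w) v
  have s2 : ∑ i, T x (e n i) w * (M v) i = hess Γ s x v w := by
    rw [← hMT]; exact sum_apply_mul (((T x).flip w).toLinearMap) (M v)
  have s3 : ∑ i, fderiv ℝ s x (e n i) * v i = fderiv ℝ s x v :=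
    sum_apply_mul ((fderiv ℝ s x).toLinearMap) v
  have s4 : ∑ i, T x (e n i) w * v i = T x v w :=
    sum_apply_mul (((T x).flip w).toLinearMap) v
  have s5 : ∑ i, T x (e n i) w * (N x) i = fderiv ℝ s x w := by
    rw [← hN.self_of_nhds]; exact sum_apply_mul (((T x).flip w).toLinearMap) (N x)
  have s6 : ∑ i, fderiv ℝ s x (e n i) * (N x) i = fderiv ℝ s x (N x) :=
    sum_apply_mul ((fderiv ℝ s x).toLinearMap) (N x)
  -- The trace in `u` of the conformal curvature formula; each factor `n + 1` is the trace of the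
  -- identity.
  have key : ∑ i, (curvVec (gam (gram T')) x (e n i) v w) i
      = ∑ i, (curvVec Γ x (e n i) v w) i - ∑ i, hess Γ s x (e n i) w * v i
        + (n + 1) * hess Γ s x v w + T x v w * ∑ i, (M (e n i)) i
        - ∑ i, T x (e n i) w * (M v) i
        + (n + 1) * (fderiv ℝ s x w * fderiv ℝ s x v)
        - fderiv ℝ s x w * ∑ i, fderiv ℝ s x (e n i) * v i
        - fderiv ℝ s x (N x) * ((n + 1) * T x v w - ∑ i, T x (e n i) w * v i)
        + (T x v w * ∑ i, fderiv ℝ s x (e n i) * (N x) i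
          - fderiv ℝ s x v * ∑ i, T x (e n i) w * (N x) i) := by
    have hn : ∀ t : ℝ, (n + 1) * t = ∑ _i : Fin (n + 1), t := fun t => by simp
    simp only [hn, Finset.mul_sum, ← Finset.sum_add_distrib, ← Finset.sum_sub_distrib]
    refine Finset.sum_congr rfl fun i _ => ?_
    simp only [hcv', PiLp.add_apply, PiLp.sub_apply, PiLp.smul_apply, smul_eq_mul, e_apply,
      if_true]
    ring
  rw [ricci_apply, key, s1, s2, s3, s4, s5, s6]
  simp only [LinearMap.add_apply, LinearMap.smul_apply, smul_eq_mul, ricci_apply,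
    ContinuousLinearMap.toLinearMap₁₂_apply_apply_apply, dSq, LinearMap.mk₂_apply]
  ring

/-- The scalar curvature of `r⁻² T`. -/
lemma scalar_conformal {T' : E n → Bil n} {r : E n → ℝ} (h : RegMetric T x)
    (hr : ContDiffAt ℝ 2 r x) (hr0 : r x ≠ 0)
    (hT : ∀ᶠ y in 𝓝 x, T' y = (r y ^ 2)⁻¹ • T y) :
    scalar (gram T') x = r x ^ 2 * scalar (gram T) x + 2 * n * (r x * laplace (gram T) r x)
      - n * (n + 1) * gradSq (gram T) r x := by
  have hne : ∀ᶠ y in 𝓝 x, r y ≠ 0 := hr.continuousAt.eventually_ne hr0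
  have hd : DifferentiableAt ℝ r x := hr.differentiableAt (by simp)
  have h' : RegMetric T' x := by
    refine RegMetric.congr (T := fun y => (r y ^ 2)⁻¹ • T y)
      ⟨contDiffAt_smul_clm ((hr.pow 2).inv (pow_ne_zero 2 hr0)) h.smooth, ?_, ?_⟩ hT
    · filter_upwards [h.symm] with y hy v w
      simp [hy v w]
    · have : gram (fun y => (r y ^ 2)⁻¹ • T y) x = (r x ^ 2)⁻¹ • gram T x := by
        ext i j; simp [gram]
      rw [this, Matrix.det_smul]
      exact mul_ne_zero (pow_ne_zero _ (inv_ne_zero (pow_ne_zero 2 hr0))) h.det_ne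
  -- The conformal exponent is `s = log r`, since `r⁻² = exp (-2s)`.
  have hs : ContDiffAt ℝ 2 (fun y => Real.log (r y)) x := hr.log hr0
  have hfs : ∀ᶠ y in 𝓝 x, fderiv ℝ (fun y => Real.log (r y)) y = (r y)⁻¹ • fderiv ℝ r y := by
    filter_upwards [hne, hr.eventually (by simp)] with y h1 h2
    exact fderiv.log (h2.differentiableAt (by simp)) h1
  have hc : ∀ᶠ y in 𝓝 x, HasFDerivAt (fun y => (r y ^ 2)⁻¹)
      (-(2 * (r y ^ 2)⁻¹) • fderiv ℝ (fun y => Real.log (r y)) y) y := by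
    filter_upwards [hne, hr.eventually (by simp), hfs] with y h1 h2 h3
    have h4 := (hasDerivAt_inv (pow_ne_zero 2 h1)).comp_hasFDerivAt y
      ((h2.differentiableAt (by simp)).hasFDerivAt.pow 2)
    refine h4.congr_fderiv ?_
    rw [h3]
    ext u
    simp only [smul_apply, smul_eq_mul]
    field_simp
    simp
    ring
  have hgd : gradSq (gram T) (fun y => Real.log (r y)) x = (r x ^ 2)⁻¹ * gradSq (gram T) r x := by
    rw [gradSq_eq_contr, gradSq_eq_contr, ← contr_smul]
    congr 1
    refine LinearMap.ext fun v => LinearMap.ext fun w => ?_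
    simp only [dSq, LinearMap.mk₂_apply, LinearMap.smul_apply, hfs.self_of_nhds, smul_apply,
      smul_eq_mul]
    field_simp
  have hdr : DifferentiableAt ℝ (fderiv ℝ r) x :=
    (hr.fderiv_right (m := 1) (by norm_num)).differentiableAt (by simp)
  have hhess : hess (gam (gram T)) (fun y => Real.log (r y)) x
      = (r x)⁻¹ • hess (gam (gram T)) r x + (-(r x ^ 2)⁻¹) • dSq r x := by
    refine LinearMap.ext fun v => LinearMap.ext fun w => ?_
    have h1 : fderiv ℝ (fderiv ℝ (fun y => Real.log (r y))) x v w
        = (r x)⁻¹ * fderiv ℝ (fderiv ℝ r) x v w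
          - (r x ^ 2)⁻¹ * (fderiv ℝ r x v * fderiv ℝ r x w) := by
      have e1 := ((hs.fderiv_right (m := 1) (by norm_num)).differentiableAt
        (by simp)).hasFDerivAt.clm_apply (hasFDerivAt_const w x)
      have e2 := ((hasDerivAt_inv hr0).comp_hasFDerivAt x hd.hasFDerivAt).mul
        (hdr.hasFDerivAt.clm_apply (hasFDerivAt_const w x))
      have e3 := e1.unique (e2.congr_of_eventuallyEq (hfs.mono fun y hy => by simp [hy]))
      have := congrArg (fun L : E n →L[ℝ] ℝ => L v) e3
      simp only [add_apply, ContinuousLinearMap.comp_apply, ContinuousLinearMap.flip_apply,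
        zero_apply, map_zero, zero_add, smul_apply, smul_eq_mul, Function.comp_apply] at this
      rw [this]
      ring
    simp only [hess, dSq, LinearMap.mk₂_apply, LinearMap.smul_apply, LinearMap.add_apply, h1,
      hfs.self_of_nhds, smul_apply, smul_eq_mul]
    ring
  have hTT : contr (gram T x) (ContinuousLinearMap.toLinearMap₁₂ (T x)) = n + 1 := by
    rw [contr_metric_left h _ LinearMap.id fun u w => rfl]
    simp
  have hg : gram T' x = (r x ^ 2)⁻¹ • gram T x := by
    ext i j; simp [gram, hT.self_of_nhds]
  -- Contraction yields `r² (R + 2n Δs - n(n-1) |ds|²)`. Inserting `Δ log r = Δr/r - |dr|²/r²` makes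
  -- the gradient coefficient `-2n - n(n-1) = -n(n+1)`.
  rw [scalar_eq_contr h', ricci_conformal h h' hs hc hT, hg,
    contr_smul_metric (inv_ne_zero (pow_ne_zero 2 hr0)) _ h.det_ne, contr_add, contr_add,
    contr_add, contr_smul, contr_smul, contr_smul, hTT, ← scalar_eq_contr h, ← gradSq_eq_contr,
    hgd, hhess, contr_add, contr_smul, contr_smul, ← laplace_eq_contr _ hr, ← gradSq_eq_contr]
  field_simp
  ring

end Conformal

end WeakAH

namespace WeakAH

/-! ### Rescaling -/

section Rescale

variable {n : ℕ}

@[simp] lemma rescale_apply_zero (c z : E n) : rescale c z 0 = c 0 * z 0 := by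
  simp [rescale]; ring

@[simp] lemma rescale_e (c : E n) : rescale c (e n 0) = c := by simp [rescale]

lemma rescale_of_e (z : E n) : rescale (e n 0) z = z := by simp [rescale]

lemma hasFDerivAt_rescale (c z : E n) :
    HasFDerivAt (rescale c) (c 0 • ContinuousLinearMap.id ℝ (E n)) z :=
  (((hasFDerivAt_id z).sub_const (e n 0)).const_smul (c 0)).const_add c

lemma fderiv_comp_rescale {F : Type*} [NormedAddCommGroup F] [NormedSpace ℝ F] {f : E n → F}
    {c z : E n} (hf : DifferentiableAt ℝ f (rescale c z)) :
    HasFDerivAt (fun z => f (rescale c z)) (c 0 • fderiv ℝ f (rescale c z)) z := by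
  refine (HasFDerivAt.comp (G := F) z hf.hasFDerivAt (hasFDerivAt_rescale c z)).congr_fderiv ?_
  ext v; simp

/-- The inverse of `rescale c`. -/
noncomputable def unscale (c x : E n) : E n := e n 0 + (c 0)⁻¹ • (x - c)

lemma unscale_rescale {c : E n} (hc : c 0 ≠ 0) (z : E n) : unscale c (rescale c z) = z := by
  simp [unscale, rescale, smul_smul, inv_mul_cancel₀ hc]

lemma rescale_unscale {c : E n} (hc : c 0 ≠ 0) (x : E n) : rescale c (unscale c x) = x := by
  simp [unscale, rescale, smul_smul, mul_inv_cancel₀ hc]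

lemma contDiff_unscale {k : WithTop ℕ∞} (c : E n) : ContDiff ℝ k (unscale c) :=
  contDiff_const.add ((contDiff_id.sub contDiff_const).const_smul _)

/-- The union of the rescaled balls of radius two. -/
def patch {ι : Type*} (c : ι → E n) : Set (E n) :=
  {x | ∃ i, ∃ z ∈ hypBall n 2, x = rescale (c i) z}

lemma isOpen_patch {ι : Type*} {c : ι → E n} (hc : ∀ i, 0 < c i 0) : IsOpen (patch c) := by
  have : patch c = ⋃ i, unscale (c i) ⁻¹' hypBall n 2 := by
    ext x
    simp only [patch, Set.mem_ofPred_eq, Set.mem_iUnion, Set.mem_preimage]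
    refine exists_congr fun i => ⟨?_, fun h => ⟨_, h, (rescale_unscale (hc i).ne' x).symm⟩⟩
    rintro ⟨z, hz, rfl⟩
    rwa [unscale_rescale (hc i).ne']
  rw [this]
  exact isOpen_iUnion fun i => (isOpen_hypBall_two n).preimage
    (contDiff_unscale (k := 0) (c i)).continuous

lemma rescale_mem_patch {ι : Type*} {c : ι → E n} (i : ι) {z : E n} (hz : z ∈ hypBall n 2) :
    rescale (c i) z ∈ patch c := ⟨i, z, hz, rfl⟩

end Rescale

/-- The function `f` and its coordinate derivatives of order at most `m` are uniformly bounded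
in `C^{k,α}`, respectively in `C^{k-j,α}`, on all rescaled balls. -/
def SmoothBounded {n : ℕ} {ι : Type*} (α : ℝ) (c : ι → E n) : ℕ → ℕ → (E n → ℝ) → Prop
  | 0, k, f => UnifHolder k α (fun i z => f (rescale (c i) z))
  | m + 1, k, f => UnifHolder k α (fun i z => f (rescale (c i) z)) ∧
      (∀ x ∈ patch c, DifferentiableAt ℝ f x) ∧ ∀ l, SmoothBounded α c m (k - 1) (pd l f)

namespace SmoothBounded

variable {n : ℕ} {ι : Type*} {α : ℝ} {c : ι → E n} {m k : ℕ} {f g : E n → ℝ}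

lemma unif (h : SmoothBounded α c m k f) : UnifHolder k α (fun i z => f (rescale (c i) z)) := by
  cases m with
  | zero => exact h
  | succ m => exact h.1

lemma congr (hc : ∀ i, 0 < c i 0) (h : SmoothBounded α c m k f) (hfg : ∀ x ∈ patch c, g x = f x) :
    SmoothBounded α c m k g := by
  induction m generalizing k f g with
  | zero => exact UnifHolder.congr h fun i z hz => hfg _ (rescale_mem_patch i hz)
  | succ m ih =>
    have he : ∀ x ∈ patch c, g =ᶠ[𝓝 x] f := fun x hx =>
      Filter.eventually_of_mem ((isOpen_patch hc).mem_nhds hx) hfg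
    refine ⟨UnifHolder.congr h.1 fun i z hz => hfg _ (rescale_mem_patch i hz),
      fun x hx => (h.2.1 x hx).congr_of_eventuallyEq (he x hx), fun l =>
      ih (h.2.2 l) fun x hx => ?_⟩
    simp only [pd, (he x hx).fderiv_eq]

lemma of_succ (h : SmoothBounded α c (m + 1) k f) : SmoothBounded α c m k f := by
  induction m generalizing k f with
  | zero => exact h.1
  | succ m ih => exact ⟨h.1, h.2.1, fun l => ih (h.2.2 l)⟩

/-- In the product rule a coordinate derivative lies only in `C^{k-1,α}`, so the undifferentiated
factor is lowered to the same order. -/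
lemma pred (hα : α ∈ Set.Ico (0 : ℝ) 1) (h : SmoothBounded α c m k f) :
    SmoothBounded α c m (k - 1) f := by
  induction m generalizing k f with
  | zero => exact UnifHolder.of_le hα h (Nat.sub_le _ _)
  | succ m ih =>
    exact ⟨UnifHolder.of_le hα h.1 (Nat.sub_le _ _), h.2.1, fun l => ih (h.2.2 l)⟩

lemma const (a : ℝ) : SmoothBounded α c m k (fun _ => a) := by
  induction m generalizing k a with
  | zero => exact UnifHolder.const' a
  | succ m ih =>
    refine ⟨UnifHolder.const' a, fun x _ => differentiableAt_const a, fun l => ?_⟩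
    have : pd l (fun _ : E n => a) = fun _ => 0 := by ext x; simp [pd]
    rw [this]
    exact ih 0

lemma add (hc : ∀ i, 0 < c i 0) (hf : SmoothBounded α c m k f) (hg : SmoothBounded α c m k g) :
    SmoothBounded α c m k (fun x => f x + g x) := by
  induction m generalizing k f g with
  | zero => exact UnifHolder.add hf hg
  | succ m ih =>
    refine ⟨UnifHolder.add hf.1 hg.1, fun x hx => (hf.2.1 x hx).add (hg.2.1 x hx), fun l =>
      (ih (hf.2.2 l) (hg.2.2 l)).congr hc fun x hx => ?_⟩
    simp [pd, fderiv_fun_add (hf.2.1 x hx) (hg.2.1 x hx)]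

lemma mul (hα : α ∈ Set.Ico (0 : ℝ) 1) (hc : ∀ i, 0 < c i 0) (hf : SmoothBounded α c m k f)
    (hg : SmoothBounded α c m k g) : SmoothBounded α c m k (fun x => f x * g x) := by
  induction m generalizing k f g with
  | zero => exact UnifHolder.mul hα hf hg
  | succ m ih =>
    refine ⟨UnifHolder.mul hα hf.1 hg.1, fun x hx => (hf.2.1 x hx).mul (hg.2.1 x hx), fun l =>
      ((ih (hf.2.2 l) (hg.of_succ.pred hα)).add hc
        (ih (hf.of_succ.pred hα) (hg.2.2 l))).congr hc fun x hx => ?_⟩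
    exact UnifHolder.pd_mul (hf.2.1 x hx) (hg.2.1 x hx) l

lemma const_mul (hα : α ∈ Set.Ico (0 : ℝ) 1) (hc : ∀ i, 0 < c i 0) (a : ℝ)
    (hf : SmoothBounded α c m k f) : SmoothBounded α c m k (fun x => a * f x) :=
  (const a).mul hα hc hf

lemma sub (hα : α ∈ Set.Ico (0 : ℝ) 1) (hc : ∀ i, 0 < c i 0) (hf : SmoothBounded α c m k f)
    (hg : SmoothBounded α c m k g) : SmoothBounded α c m k (fun x => f x - g x) :=
  (hf.add hc (hg.const_mul hα hc (-1))).congr hc fun x _ => by ring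

lemma sum (hc : ∀ i, 0 < c i 0) {σ : Type*} {s : Finset σ} {u : σ → E n → ℝ}
    (h : ∀ j ∈ s, SmoothBounded α c m k (u j)) :
    SmoothBounded α c m k (fun x => ∑ j ∈ s, u j x) := by
  classical
  induction s using Finset.induction_on with
  | empty => simpa using const 0
  | insert a s ha ih =>
    simp only [Finset.sum_insert ha]
    exact (h a (Finset.mem_insert_self a s)).add hc
      (ih fun j hj => h j (Finset.mem_insert_of_mem hj))

lemma prod (hα : α ∈ Set.Ico (0 : ℝ) 1) (hc : ∀ i, 0 < c i 0) {σ : Type*} {s : Finset σ}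
    {u : σ → E n → ℝ} (h : ∀ j ∈ s, SmoothBounded α c m k (u j)) :
    SmoothBounded α c m k (fun x => ∏ j ∈ s, u j x) := by
  classical
  induction s using Finset.induction_on with
  | empty => simpa using const 1
  | insert a s ha ih =>
    simp only [Finset.prod_insert ha]
    exact (h a (Finset.mem_insert_self a s)).mul hα hc
      (ih fun j hj => h j (Finset.mem_insert_of_mem hj))

lemma inv (hα : α ∈ Set.Ico (0 : ℝ) 1) (hc : ∀ i, 0 < c i 0) (hf : SmoothBounded α c m k f)
    {δ : ℝ} (hδ : 0 < δ) (hlow : ∀ x ∈ patch c, δ ≤ |f x|) :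
    SmoothBounded α c m k (fun x => (f x)⁻¹) := by
  have hne : ∀ x ∈ patch c, f x ≠ 0 := fun x hx h0 => by
    have := hlow x hx
    rw [h0, abs_zero] at this
    linarith
  induction m generalizing k with
  | zero =>
    exact UnifHolder.inv hα hf hδ fun i z hz => hlow _ (rescale_mem_patch i hz)
  | succ m ih =>
    refine ⟨UnifHolder.inv hα hf.1 hδ fun i z hz => hlow _ (rescale_mem_patch i hz),
      fun x hx => (hf.2.1 x hx).inv (hne x hx), fun l => ?_⟩
    have h' := ih (hf.of_succ.pred hα)
    exact (((hf.2.2 l).mul hα hc (h'.mul hα hc h')).const_mul hα hc (-1)).congr hc fun x hx =>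
      UnifHolder.pd_inv (hf.2.1 x hx) (hne x hx) l

lemma det (hα : α ∈ Set.Ico (0 : ℝ) 1) (hc : ∀ i, 0 < c i 0) {σ : Type*} [Fintype σ]
    [DecidableEq σ] {G : E n → Matrix σ σ ℝ}
    (h : ∀ i j, SmoothBounded α c m k (fun x => G x i j)) :
    SmoothBounded α c m k (fun x => (G x).det) := by
  simp only [Matrix.det_apply']
  exact sum hc fun τ _ => (prod hα hc fun i _ => h _ _).const_mul hα hc _

/-- By Cramer's rule the inverse is polynomial in the entries and in `1/det`, so a uniform lower
bound for the determinant suffices. -/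
lemma matrix_inv (hα : α ∈ Set.Ico (0 : ℝ) 1) (hc : ∀ i, 0 < c i 0)
    {G : E n → Matrix (Fin (n + 1)) (Fin (n + 1)) ℝ}
    (h : ∀ i j, SmoothBounded α c m k (fun x => G x i j)) {δ : ℝ} (hδ : 0 < δ)
    (hlow : ∀ x ∈ patch c, δ ≤ |(G x).det|) (i j : Fin (n + 1)) :
    SmoothBounded α c m k (fun x => (G x)⁻¹ i j) := by
  have h1 : (fun y => (G y)⁻¹ i j) = fun y => (G y).det⁻¹ * (G y).adjugate i j := by
    ext y
    rw [Matrix.inv_def, Ring.inverse_eq_inv', Matrix.smul_apply, smul_eq_mul]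
  rw [h1]
  refine ((det hα hc h).inv hα hc hδ hlow).mul hα hc ?_
  simp only [Matrix.adjugate_apply]
  refine det hα hc fun i' j' => ?_
  simp only [Matrix.updateRow_apply]
  by_cases hij : i' = j
  · simp only [hij, if_true]; exact const _
  · simp only [hij, if_false]; exact h _ _

section Metric

variable {G : E n → Matrix (Fin (n + 1)) (Fin (n + 1)) ℝ} (hα : α ∈ Set.Ico (0 : ℝ) 1)
  (hc : ∀ i, 0 < c i 0) (hG : ∀ i j, SmoothBounded α c 2 k (fun x => G x i j)) {δ : ℝ}
  (hδ : 0 < δ) (hlow : ∀ x ∈ patch c, δ ≤ |(G x).det|)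

include hα hc hG hδ hlow

lemma christoffel (a i j : Fin (n + 1)) : SmoothBounded α c 1 (k - 1) (christoffel G a i j) := by
  unfold WeakAH.christoffel
  refine const_mul hα hc _ (sum hc fun l _ => ?_)
  refine ((matrix_inv hα hc hG hδ hlow a l).of_succ.pred hα).mul hα hc ?_
  exact (((hG j l).2.2 i).add hc ((hG i l).2.2 j)).sub hα hc ((hG i j).2.2 l)

/-- Christoffel symbols consume one of the two available coordinate derivatives of `G` and the
curvature the other; each costs one Hölder order. -/
lemma scalar : SmoothBounded α c 0 (k - 1 - 1) (scalar G) := by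
  have hΓ := christoffel hα hc hG hδ hlow
  have hΓ0 := fun a i j => (hΓ a i j).of_succ.pred hα
  unfold WeakAH.scalar curvOp riemann
  refine sum hc fun i _ => sum hc fun j _ => sum hc fun a _ => ?_
  refine (((matrix_inv hα hc hG hδ hlow _ _).of_succ.of_succ.pred hα).pred hα).mul hα hc ?_
  refine (((hΓ _ _ _).2.2 _).sub hα hc ((hΓ _ _ _).2.2 _)).add hc (sum hc fun p _ => ?_)
  exact ((hΓ0 _ _ _).mul hα hc (hΓ0 _ _ _)).sub hα hc ((hΓ0 _ _ _).mul hα hc (hΓ0 _ _ _))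

variable {r : E n → ℝ} (hr : ∀ m k, SmoothBounded α c m k r)

include hr

lemma gradSq : SmoothBounded α c 2 k (gradSq G r) := by
  unfold WeakAH.gradSq
  -- The function `r` is bounded at all orders; starting from `(3, k + 1)`, one coordinate
  -- derivative lands exactly at `(2, k)`.
  exact sum hc fun i _ => sum hc fun j _ => ((matrix_inv hα hc hG hδ hlow _ _).mul hα hc
    ((hr 3 (k + 1)).2.2 i)).mul hα hc ((hr 3 (k + 1)).2.2 j)

lemma laplace : SmoothBounded α c 1 (k - 1) (laplace G r) := by
  unfold WeakAH.laplace
  refine sum hc fun i _ => sum hc fun j _ => ?_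
  refine ((matrix_inv hα hc hG hδ hlow _ _).of_succ.pred hα).mul hα hc ?_
  refine SmoothBounded.sub hα hc (((hr 3 (k + 1)).2.2 j).2.2 i) (sum hc fun a _ => ?_)
  exact (christoffel hα hc hG hδ hlow _ _ _).mul hα hc ((hr 2 (k - 1 + 1)).2.2 a)

end Metric

end SmoothBounded

/-! ### The key estimate -/

namespace UnifHolder

variable {n : ℕ} {ι : Type*} {α : ℝ} {k : ℕ}

lemma norm_fderiv_le {f : E n → ℝ} {x : E n} {C : ℝ} (h : ∀ l, |pd l f x| ≤ C) :
    ‖fderiv ℝ f x‖ ≤ (n + 1) * C := by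
  have hC : 0 ≤ C := (abs_nonneg _).trans (h 0)
  refine ContinuousLinearMap.opNorm_le_bound _ (by positivity) fun v => ?_
  conv_lhs => rw [eq_sum_smul_e v]
  simp only [map_sum, map_smul]
  refine (norm_sum_le _ _).trans ?_
  have : ∀ l ∈ Finset.univ, ‖v l • fderiv ℝ f x (e n l)‖ ≤ C * ‖v‖ := fun l _ => by
    rw [norm_smul, mul_comm]
    exact mul_le_mul (h l) (PiLp.norm_apply_le v l) (norm_nonneg _) hC
  refine (Finset.sum_le_sum this).trans ?_
  simp [mul_assoc]

/-- A family of functions vanishing at a base point is controlled by its derivatives. -/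
lemma of_pd {v : ι → E n → ℝ} (hd : ∀ i, DifferentiableOn ℝ (v i) (hypBall n 2))
    (h0 : ∀ i, v i (e n 0) = 0) (h : ∀ l, UnifHolder k α (fun i => pd l (v i))) :
    UnifHolder (k + 1) α v := by
  refine succ_iff_pd.2 ⟨hd, ?_, h⟩
  choose C hC0 hC using fun l => (h l).bound
  have hle : ∀ l, C l ≤ ∑ l, C l := fun l =>
    Finset.single_le_sum (fun l _ => hC0 l) (Finset.mem_univ l)
  refine ⟨(n + 1) * (∑ l, C l) * (2 * Real.sinh 2), fun i x hx => ?_⟩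
  have h1 := (convex_hypBall_two n).norm_image_sub_le_of_norm_fderiv_le (𝕜 := ℝ)
      (fun z hz => (hd i).differentiableAt ((isOpen_hypBall_two n).mem_nhds hz))
      (fun z hz => norm_fderiv_le fun l => (hC l i z hz).trans (hle l))
      (e_zero_mem_hypBall n two_pos) hx
  rw [h0, sub_zero] at h1
  refine h1.trans (mul_le_mul_of_nonneg_left
    (norm_sub_le_of_mem_hypBall hx (e_zero_mem_hypBall n two_pos)) ?_)
  have : 0 ≤ ∑ l, C l := Finset.sum_nonneg fun l _ => hC0 l
  positivity

/-- A bounded family of affine functions is bounded in every Hölder space. -/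
lemma affine (hα : α ∈ Set.Ico (0 : ℝ) 1) (a : ι → ℝ) (b : ι → Fin (n + 1) → ℝ)
    (h : ∃ C, ∀ i, ∀ x ∈ hypBall n 2, |a i + ∑ l, b i l * (x l - e n 0 l)| ≤ C) :
    UnifHolder k α (fun i x => a i + ∑ l, b i l * (x l - e n 0 l)) := by
  obtain ⟨C, hC⟩ := h
  have ha : ∀ i, |a i| ≤ C := fun i => by
    simpa using hC i (e n 0) (e_zero_mem_hypBall n two_pos)
  have hmax : ∀ i, |a i| ≤ max C 0 := fun i => (ha i).trans (le_max_left _ _)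
  obtain ⟨ε, hε, hball⟩ := Metric.isOpen_iff.1 (isOpen_hypBall_two n) _
    (e_zero_mem_hypBall n two_pos)
  -- The slope `b i l` is a difference quotient between `e n 0` and a point of the ball at distance
  -- `ε / 2` in direction `l`.
  have hb : ∀ l i, |b i l| ≤ 2 * max C 0 / (ε / 2) := by
    intro l i
    have hm : e n 0 + (ε / 2) • e n l ∈ hypBall n 2 := by
      refine hball ?_
      have : ‖e n l‖ = 1 := by simp [e]
      rw [Metric.mem_ball, dist_eq_norm, add_sub_cancel_left, norm_smul, this, mul_one,
        Real.norm_eq_abs, abs_of_pos (by positivity)]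
      linarith
    have h1 := hC i _ hm
    have h2 : ∑ j, b i j * ((e n 0 + (ε / 2) • e n l) j - e n 0 j) = b i l * (ε / 2) := by
      simp [e_apply]
    rw [h2] at h1
    rw [le_div_iff₀ (by positivity)]
    calc |b i l| * (ε / 2) = |(a i + b i l * (ε / 2)) - a i| := by
          rw [add_sub_cancel_left, abs_mul, abs_of_pos (half_pos hε)]
      _ ≤ |a i + b i l * (ε / 2)| + |a i| := abs_sub _ _
      _ ≤ 2 * max C 0 := by linarith [le_max_left C 0, ha i]
  refine (const ⟨max C 0, le_max_right _ _, hmax⟩).add (sum fun l _ => ?_)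
  refine (const ⟨2 * max C 0 / (ε / 2), by positivity, hb l⟩).mul hα ?_
  exact (coordinate hα l).sub hα (const' _)

end UnifHolder

/-- If `f - x₀ h = O(x₀²)` where `f` has two and `h` one bounded coordinate derivatives, then
`x₀⁻² (f - x₀ h)` is bounded in the rescaled Hölder norms. -/
lemma unifHolder_of_isBigO_sq {n : ℕ} {ι : Type*} {α : ℝ} {k : ℕ} {c : ι → E n}
    (hα : α ∈ Set.Ico (0 : ℝ) 1) (hc : ∀ i, 0 < c i 0) {f h : E n → ℝ}
    (hf : SmoothBounded α c 2 (k + 2) f) (hh : SmoothBounded α c 1 (k + 1) h)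
    (hO : ∃ C, ∀ x ∈ patch c, |f x - x 0 * h x| ≤ C * x 0 ^ 2) :
    UnifHolder (k + 1) α (fun i z => (rescale (c i) z 0 ^ 2)⁻¹ *
      (f (rescale (c i) z) - rescale (c i) z 0 * h (rescale (c i) z))) := by
  obtain ⟨C, hC⟩ := hO
  have hR : ∀ i z, z ∈ hypBall n 2 → rescale (c i) z ∈ patch c := fun i z hz =>
    rescale_mem_patch i hz
  have hfd : ∀ i z, z ∈ hypBall n 2 → DifferentiableAt ℝ f (rescale (c i) z) := fun i z hz =>
    hf.2.1 _ (hR i z hz)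
  have hfd' : ∀ l i z, z ∈ hypBall n 2 → DifferentiableAt ℝ (pd l f) (rescale (c i) z) :=
    fun l i z hz => (hf.2.2 l).2.1 _ (hR i z hz)
  have hhd : ∀ i z, z ∈ hypBall n 2 → DifferentiableAt ℝ h (rescale (c i) z) := fun i z hz =>
    hh.2.1 _ (hR i z hz)
  -- the first derivatives of `f`, rescaled
  let q : Fin (n + 1) → ι → E n → ℝ := fun l i z =>
    (c i 0)⁻¹ * (pd l f (rescale (c i) z) - pd l f (c i))
  have hcomp : ∀ {u : E n → ℝ} {i : ι} {z : E n}, DifferentiableAt ℝ u (rescale (c i) z) →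
      DifferentiableAt ℝ (fun z => u (rescale (c i) z)) z := fun hu =>
    (fderiv_comp_rescale hu).differentiableAt
  have pd_q : ∀ {u : E n → ℝ} {a b : ℝ} {i : ι} {z : E n} (l : Fin (n + 1)),
      DifferentiableAt ℝ u (rescale (c i) z) →
      pd l (fun z => a * (u (rescale (c i) z) - b)) z = a * (c i 0 * pd l u (rescale (c i) z)) := by
    intro u a b i z l hu
    have h1 := ((fderiv_comp_rescale hu).sub_const b).const_mul a
    simp only [pd, h1.fderiv, smul_apply, smul_eq_mul]
  -- The factor `c i 0` from the chain rule cancels the inverse one, so the derivatives of `q l` are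
  -- the second coordinate derivatives of `f`, bounded by hypothesis.
  have hq : ∀ l, UnifHolder (k + 1) α (q l) := by
    intro l
    refine UnifHolder.of_pd (fun i z hz => ?_) (fun i => by simp [q]) fun l' => ?_
    · exact (((hcomp (hfd' l i z hz)).sub_const _).const_mul _).differentiableWithinAt
    · refine UnifHolder.congr ((hf.2.2 l).2.2 l').unif fun i z hz => ?_
      rw [pd_q l' (hfd' l i z hz), ← mul_assoc, inv_mul_cancel₀ (hc i).ne', one_mul]
  -- The remainder of `f` after its first-order Taylor polynomial at the centre, divided by the
  -- square of the scale. Its derivatives are the `q l`.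
  let w₁ : ι → E n → ℝ := fun i z => ((c i 0)⁻¹ ^ 2) * (f (rescale (c i) z) - f (c i))
    - ∑ l, (c i 0)⁻¹ * pd l f (c i) * (z l - e n 0 l)
  have hlin : ∀ (b : Fin (n + 1) → ℝ) (z : E n), HasFDerivAt
      (fun z : E n => ∑ l, b l * (z l - e n 0 l))
      (∑ l, b l • (EuclideanSpace.proj l : E n →L[ℝ] ℝ)) z := by
    intro b z
    refine HasFDerivAt.fun_sum fun l _ => ?_
    exact (((EuclideanSpace.proj l : E n →L[ℝ] ℝ).hasFDerivAt (x := z)).sub_const _).const_mul _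
  have hw₁ : UnifHolder (k + 2) α w₁ := by
    refine UnifHolder.of_pd (fun i z hz => ?_) (fun i => by simp [w₁]) fun l => ?_
    · exact ((((hcomp (hfd i z hz)).sub_const _).const_mul _).sub
        (hlin _ z).differentiableAt).differentiableWithinAt
    · refine UnifHolder.congr (hq l) fun i z hz => ?_
      have h1 := (((fderiv_comp_rescale (hfd i z hz)).sub_const (f (c i))).const_mul
        ((c i 0)⁻¹ ^ 2)).sub (hlin (fun l => (c i 0)⁻¹ * pd l f (c i)) z)
      have h2 := hc i
      simp only [pd, w₁, q]
      erw [h1.fderiv]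
      simp [sum_apply, pd]
      field_simp
  -- One scale factor suffices for `h`, because it is multiplied by `x 0 = c i 0 * z 0`.
  let w₂ : ι → E n → ℝ := fun i z => (c i 0)⁻¹ * (h (rescale (c i) z) - h (c i))
  have hw₂ : UnifHolder (k + 1) α w₂ := by
    refine UnifHolder.of_pd (fun i z hz => ?_) (fun i => by simp [w₂]) fun l => ?_
    · exact (((hcomp (hhd i z hz)).sub_const _).const_mul _).differentiableWithinAt
    · refine UnifHolder.congr (hh.2.2 l).unif fun i z hz => ?_
      rw [pd_q l (hhd i z hz), ← mul_assoc, inv_mul_cancel₀ (hc i).ne', one_mul]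
  let U : ι → E n → ℝ := fun i z => ((c i 0)⁻¹ ^ 2) *
    (f (rescale (c i) z) - rescale (c i) z 0 * h (rescale (c i) z))
  let w : ι → E n → ℝ := fun i z => w₁ i z - z 0 * w₂ i z
  have hw : UnifHolder (k + 1) α w :=
    (hw₁.of_succ hα).sub hα ((UnifHolder.coordinate hα 0).mul hα hw₂)
  -- Coefficients of the affine part: the Taylor polynomial of `f` minus `x 0 * h (c i)`, expanded
  -- around `e n 0`. They may a priori blow up as the scale tends to zero.
  let a : ι → ℝ := fun i => (c i 0)⁻¹ ^ 2 * (f (c i) - c i 0 * h (c i))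
  let b : ι → Fin (n + 1) → ℝ := fun i l =>
    (c i 0)⁻¹ * pd l f (c i) - if l = 0 then (c i 0)⁻¹ * h (c i) else 0
  have hdecomp : ∀ i z, U i z = w i z + (a i + ∑ l, b i l * (z l - e n 0 l)) := by
    intro i z
    have h2 := (hc i).ne'
    have h3 : ∑ l, b i l * (z l - e n 0 l)
        = ∑ l, (c i 0)⁻¹ * pd l f (c i) * (z l - e n 0 l) - (c i 0)⁻¹ * h (c i) * (z 0 - 1) := by
      simp only [b, sub_mul, Finset.sum_sub_distrib]
      simp
    simp only [U, w, w₁, w₂, a, h3, rescale_apply_zero]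
    field_simp
    ring
  have hUb : ∀ i, ∀ z ∈ hypBall n 2, |U i z| ≤ |C| * Real.exp 2 ^ 2 := by
    intro i z hz
    have h1 := hC _ (hR i z hz)
    have h2 := apply_zero_le_exp (subset_closure hz)
    have h3 : 0 < z 0 := hz.1
    simp only [U]
    rw [abs_mul, abs_of_nonneg (by positivity : 0 ≤ (c i 0)⁻¹ ^ 2)]
    have h4 : (c i 0)⁻¹ ^ 2 * (C * (c i 0 * z 0) ^ 2) = C * z 0 ^ 2 := by
      have := (hc i).ne'
      field_simp
    rw [rescale_apply_zero] at h1 ⊢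
    calc _ ≤ (c i 0)⁻¹ ^ 2 * (C * (c i 0 * z 0) ^ 2) :=
          mul_le_mul_of_nonneg_left h1 (by positivity)
      _ = C * z 0 ^ 2 := h4
      _ ≤ |C| * z 0 ^ 2 := by gcongr; exact le_abs_self C
      _ ≤ _ := by gcongr
  -- The affine part is the difference of `U`, pointwise bounded by the quadratic decay, and `w`,
  -- bounded by the derivative hypotheses. Being affine, it is then bounded at every order.
  have hA : UnifHolder (k + 1) α (fun i z => a i + ∑ l, b i l * (z l - e n 0 l)) := by
    refine UnifHolder.affine hα a b ?_
    obtain ⟨C', -, hC'⟩ := hw.bound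
    refine ⟨|C| * Real.exp 2 ^ 2 + C', fun i z hz => ?_⟩
    have h1 : a i + ∑ l, b i l * (z l - e n 0 l) = U i z - w i z := by rw [hdecomp]; ring
    rw [h1]
    exact (abs_sub _ _).trans (add_le_add (hUb i z hz) (hC' i z hz))
  have hU : UnifHolder (k + 1) α U := (hw.add hA).congr fun i z _ => hdecomp i z
  -- Two factors `1 / z 0`, harmless on the ball, change the weight `(c i 0)⁻²` into `x₀⁻²`.
  have hinv : UnifHolder (k + 1) α (fun (_ : ι) (z : E n) => (z 0)⁻¹) :=
    (UnifHolder.coordinate hα 0).inv hα (Real.exp_pos (-2)) fun i z hz =>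
      (exp_le_apply_zero (subset_closure hz)).trans (le_abs_self _)
  refine (hinv.mul hα (hinv.mul hα hU)).congr fun i z hz => ?_
  have h1 := (hc i).ne'
  have h2 := hz.1.ne'
  simp only [U, rescale_apply_zero]
  field_simp

end WeakAH

namespace WeakAH

/-! ### Charts of a manifold with boundary -/

set_option linter.unusedSectionVars false

section Charts

variable {n : ℕ} {M : Type*} [TopologicalSpace M] [ChartedSpace (EuclideanHalfSpace (n + 1)) M]

/-- The interior part of the target of a chart. -/
def intTarget (Θ : OpenPartialHomeomorph M (EuclideanHalfSpace (n + 1))) : Set (E n) :=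
  (Θ.extend (𝓡∂ (n + 1))).target ∩ {x | 0 < x 0}

variable {Θ Θ' : OpenPartialHomeomorph M (EuclideanHalfSpace (n + 1))} {x : E n}

lemma intTarget_eq (Θ : OpenPartialHomeomorph M (EuclideanHalfSpace (n + 1))) :
    intTarget Θ = ((𝓡∂ (n + 1)).symm ⁻¹' Θ.target) ∩ {x | 0 < x 0} := by
  ext x
  simp only [intTarget, OpenPartialHomeomorph.extend_target,
    range_modelWithCornersEuclideanHalfSpace, Set.mem_inter_iff, Set.mem_preimage]
  constructor
  · rintro ⟨⟨h1, -⟩, h2⟩; exact ⟨h1, h2⟩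
  · rintro ⟨h1, h2⟩; exact ⟨⟨h1, show 0 ≤ x 0 from le_of_lt h2⟩, h2⟩

lemma isOpen_intTarget (Θ : OpenPartialHomeomorph M (EuclideanHalfSpace (n + 1))) :
    IsOpen (intTarget Θ) := by
  rw [intTarget_eq]
  refine (Θ.open_target.preimage (𝓡∂ (n + 1)).continuous_symm).inter ?_
  exact isOpen_lt continuous_const (EuclideanSpace.proj (0 : Fin (n + 1)) : E n →L[ℝ] ℝ).continuous

lemma symm_mem_source (hx : x ∈ (Θ.extend (𝓡∂ (n + 1))).target) :
    (Θ.extend (𝓡∂ (n + 1))).symm x ∈ Θ.source := by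
  have := (Θ.extend (𝓡∂ (n + 1))).map_target hx
  rwa [OpenPartialHomeomorph.extend_source] at this

lemma contMDiffOn_symm_target [IsManifold (𝓡∂ (n + 1)) ∞ M]
    (he : Θ ∈ IsManifold.maximalAtlas (𝓡∂ (n + 1)) ∞ M) :
    ContMDiffOn 𝓘(ℝ, E n) (𝓡∂ (n + 1)) ∞ (Θ.extend (𝓡∂ (n + 1))).symm
      (Θ.extend (𝓡∂ (n + 1))).target := by
  rw [OpenPartialHomeomorph.extend_target']
  exact contMDiffOn_extend_symm he

section

variable [IsManifold (𝓡∂ (n + 1)) ∞ M] (he : Θ ∈ IsManifold.maximalAtlas (𝓡∂ (n + 1)) ∞ M)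
  (he' : Θ' ∈ IsManifold.maximalAtlas (𝓡∂ (n + 1)) ∞ M)

include he

lemma contMDiffAt_symm (hx : x ∈ intTarget Θ) :
    ContMDiffAt 𝓘(ℝ, E n) (𝓡∂ (n + 1)) ∞ (Θ.extend (𝓡∂ (n + 1))).symm x :=
  (contMDiffOn_symm_target he).contMDiffAt
    (Filter.mem_of_superset ((isOpen_intTarget Θ).mem_nhds hx) Set.inter_subset_left)

lemma mdifferentiableAt_symm (hx : x ∈ intTarget Θ) :
    MDifferentiableAt 𝓘(ℝ, E n) (𝓡∂ (n + 1)) (Θ.extend (𝓡∂ (n + 1))).symm x :=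
  (contMDiffAt_symm he hx).mdifferentiableAt (by simp)

omit he

/-- The differential of the inverse of a chart. -/
noncomputable def dParam (Θ : OpenPartialHomeomorph M (EuclideanHalfSpace (n + 1))) (x : E n) :
    E n →L[ℝ] E n :=
  mfderiv 𝓘(ℝ, E n) (𝓡∂ (n + 1)) (Θ.extend (𝓡∂ (n + 1))).symm x

/-- The differential of a chart. -/
noncomputable def dChart (Θ : OpenPartialHomeomorph M (EuclideanHalfSpace (n + 1))) (q : M) :
    E n →L[ℝ] E n :=
  mfderiv (𝓡∂ (n + 1)) 𝓘(ℝ, E n) (Θ.extend (𝓡∂ (n + 1))) q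

/-- The coordinate change from the chart `Θ` to the chart `Θ'`. -/
noncomputable def transition (Θ Θ' : OpenPartialHomeomorph M (EuclideanHalfSpace (n + 1)))
    (x : E n) : E n :=
  Θ'.extend (𝓡∂ (n + 1)) ((Θ.extend (𝓡∂ (n + 1))).symm x)

include he he'

lemma contDiffAt_transition (hx : x ∈ intTarget Θ)
    (hx' : (Θ.extend (𝓡∂ (n + 1))).symm x ∈ Θ'.source) :
    ContDiffAt ℝ ∞ (transition Θ Θ') x :=
  contMDiffAt_iff_contDiffAt.1
    ((Θ'.contMDiffAt_extend he' hx').comp x (contMDiffAt_symm he hx))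

lemma fderiv_transition (hx : x ∈ intTarget Θ)
    (hx' : (Θ.extend (𝓡∂ (n + 1))).symm x ∈ Θ'.source) :
    fderiv ℝ (transition Θ Θ') x
      = (dChart Θ' ((Θ.extend (𝓡∂ (n + 1))).symm x)).comp (dParam Θ x) := by
  have h1 : mfderiv 𝓘(ℝ, E n) 𝓘(ℝ, E n) (transition Θ Θ') x = fderiv ℝ (transition Θ Θ') x :=
    mfderiv_eq_fderiv
  rw [← h1]
  exact mfderiv_comp x ((Θ'.contMDiffAt_extend he' hx').mdifferentiableAt (by simp))
    (mdifferentiableAt_symm he hx)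

omit he he'

lemma transition_self (hx : x ∈ (Θ.extend (𝓡∂ (n + 1))).target) : transition Θ Θ x = x :=
  (Θ.extend (𝓡∂ (n + 1))).right_inv hx

include he

lemma dChart_comp_dParam (hx : x ∈ intTarget Θ) :
    (dChart Θ ((Θ.extend (𝓡∂ (n + 1))).symm x)).comp (dParam Θ x)
      = ContinuousLinearMap.id ℝ (E n) := by
  rw [← fderiv_transition he he hx (symm_mem_source hx.1)]
  have : transition Θ Θ =ᶠ[𝓝 x] id :=
    Filter.eventually_of_mem ((isOpen_intTarget Θ).mem_nhds hx) fun y hy => transition_self hy.1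
  rw [this.fderiv_eq, fderiv_id]

omit he

/-- In finite dimension a one-sided inverse is two-sided. -/
lemma comp_eq_id_comm {P Q : E n →L[ℝ] E n} (h : P.comp Q = ContinuousLinearMap.id ℝ (E n)) :
    Q.comp P = ContinuousLinearMap.id ℝ (E n) := by
  have h1 : P.toLinearMap ∘ₗ Q.toLinearMap = LinearMap.id := by
    have := congrArg ContinuousLinearMap.toLinearMap h
    simpa using this
  have h2 := (LinearMap.comp_eq_id_comm ℝ (E n)).1 h1
  ext1 v
  exact congrArg (fun L : E n →ₗ[ℝ] E n => L v) h2

include he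

lemma dParam_comp_dChart (hx : x ∈ intTarget Θ) :
    (dParam Θ x).comp (dChart Θ ((Θ.extend (𝓡∂ (n + 1))).symm x))
      = ContinuousLinearMap.id ℝ (E n) := comp_eq_id_comm (dChart_comp_dParam he hx)

/-- Interior points are defined through preferred charts, whereas `intTarget` refers to an arbitrary
one. The bridge is that a map from a boundaryless space with surjective differential takes interior
values. -/
lemma isInteriorPoint_symm (hx : x ∈ intTarget Θ) :
    (𝓡∂ (n + 1)).IsInteriorPoint ((Θ.extend (𝓡∂ (n + 1))).symm x) := by
  refine (mdifferentiableAt_symm he hx).isInteriorPoint_of_surjective_mfderiv ?_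
    BoundarylessManifold.isInteriorPoint
  intro v
  exact ⟨dChart Θ ((Θ.extend (𝓡∂ (n + 1))).symm x) v,
    congrArg (fun L : E n →L[ℝ] E n => L v) (dParam_comp_dChart he hx)⟩

include he'

/-- The coordinate change between two charts near an interior point. -/
lemma transition_spec (hx : x ∈ intTarget Θ)
    (hx' : (Θ.extend (𝓡∂ (n + 1))).symm x ∈ Θ'.source) (hpos : 0 < transition Θ Θ' x 0) :
    IsCoordChange (transition Θ Θ') x ∧ (∀ᶠ y in 𝓝 x, y ∈ intTarget Θ ∧
      transition Θ Θ' y ∈ intTarget Θ' ∧ (Θ.extend (𝓡∂ (n + 1))).symm y ∈ Θ'.source ∧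
      (Θ'.extend (𝓡∂ (n + 1))).symm (transition Θ Θ' y) = (Θ.extend (𝓡∂ (n + 1))).symm y) := by
  have hs := contDiffAt_transition he he' hx hx'
  have h1 : ∀ᶠ y in 𝓝 x, y ∈ intTarget Θ := (isOpen_intTarget Θ).mem_nhds hx
  have h2 : ∀ᶠ y in 𝓝 x, (Θ.extend (𝓡∂ (n + 1))).symm y ∈ Θ'.source :=
    (contMDiffAt_symm he hx).continuousAt.eventually (Θ'.open_source.mem_nhds hx')
  have h3 : ∀ᶠ y in 𝓝 x, 0 < transition Θ Θ' y 0 := by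
    have hc : ContinuousAt (fun y => transition Θ Θ' y 0) x :=
      (EuclideanSpace.proj (0 : Fin (n + 1)) : E n →L[ℝ] ℝ).continuous.continuousAt.comp
        hs.continuousAt
    exact hc.eventually (lt_mem_nhds hpos)
  have h4 : ∀ᶠ y in 𝓝 x, y ∈ intTarget Θ ∧
      transition Θ Θ' y ∈ intTarget Θ' ∧ (Θ.extend (𝓡∂ (n + 1))).symm y ∈ Θ'.source ∧
      (Θ'.extend (𝓡∂ (n + 1))).symm (transition Θ Θ' y) = (Θ.extend (𝓡∂ (n + 1))).symm y := by
    filter_upwards [h1, h2, h3] with y h1 h2 h3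
    have h5 : (Θ.extend (𝓡∂ (n + 1))).symm y ∈ (Θ'.extend (𝓡∂ (n + 1))).source := by
      rwa [OpenPartialHomeomorph.extend_source]
    exact ⟨h1, ⟨(Θ'.extend (𝓡∂ (n + 1))).map_source h5, h3⟩, h2,
      (Θ'.extend (𝓡∂ (n + 1))).left_inv h5⟩
  refine ⟨⟨hs, ?_⟩, h4⟩
  filter_upwards [h4] with y ⟨h1, h2, h3, h5⟩
  have e1 := dParam_comp_dChart he' h2
  have e2 := dParam_comp_dChart he h1
  rw [h5] at e1
  rw [fderiv_transition he he' h1 h3]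
  have e3 : ((dChart Θ' ((Θ.extend (𝓡∂ (n + 1))).symm y)).comp (dParam Θ y)).comp
      ((dChart Θ ((Θ.extend (𝓡∂ (n + 1))).symm y)).comp (dParam Θ' (transition Θ Θ' y)))
      = ContinuousLinearMap.id ℝ (E n) := by
    have e4 := comp_eq_id_comm e1
    ext1 v
    have f2 := congrArg (fun L : E n →L[ℝ] E n => L (dParam Θ' (transition Θ Θ' y) v)) e2
    have f4 := congrArg (fun L : E n →L[ℝ] E n => L v) e4
    simp only [ContinuousLinearMap.comp_apply, ContinuousLinearMap.id_apply] at f2 f4 ⊢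
    rw [f2, f4]
  exact ⟨_, comp_eq_id_comm e3, e3⟩

end

/-! ### Tensor fields in charts -/

lemma pullBil_congr {Φ Φ' : E n → M} {T : BilField n M} (h : Φ =ᶠ[𝓝 x] Φ') :
    pullBil Φ T x = pullBil Φ' T x := by
  -- All tangent spaces are definitionally `E n`; forgetting the dependence on the point allows
  -- rewriting the base point.
  let S : M → Bil n := T
  have h1 : S (Φ x) = S (Φ' x) := congrArg S h.eq_of_nhds
  exact congrArg₂ (compBil (n := n)) h1 h.mfderiv_eq

lemma compBil_comp (B : Bil n) (L L' : E n →L[ℝ] E n) :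
    compBil (compBil B L) L' = compBil B (L.comp L') := rfl

lemma pullBil_comp {Φ : E n → M} {T : BilField n M} {ψ : E n → E n}
    (hΦ : MDifferentiableAt 𝓘(ℝ, E n) (𝓡∂ (n + 1)) Φ (ψ x)) (hψ : DifferentiableAt ℝ ψ x) :
    pullBil (fun y => Φ (ψ y)) T x = compBil (pullBil Φ T (ψ x)) (fderiv ℝ ψ x) := by
  have h1 : mfderiv 𝓘(ℝ, E n) (𝓡∂ (n + 1)) (fun y => Φ (ψ y)) x
      = (mfderiv 𝓘(ℝ, E n) (𝓡∂ (n + 1)) Φ (ψ x)).comp (mfderiv 𝓘(ℝ, E n) 𝓘(ℝ, E n) ψ x) :=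
    mfderiv_comp x hΦ hψ.mdifferentiableAt
  have h2 : mfderiv 𝓘(ℝ, E n) 𝓘(ℝ, E n) ψ x = fderiv ℝ ψ x := mfderiv_eq_fderiv
  have key : ∀ (B : Bil n) (L L₁ L₂ L₃ : E n →L[ℝ] E n), L = L₁.comp L₂ → L₂ = L₃ →
      compBil B L = compBil (compBil B L₁) L₃ := by
    rintro B L L₁ L₂ L₃ rfl rfl; rfl
  exact key _ _ _ _ _ h1 h2

/-- The components of a field of bilinear forms in a chart. -/
noncomputable def chartBil (Θ : OpenPartialHomeomorph M (EuclideanHalfSpace (n + 1)))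
    (T : BilField n M) : E n → Bil n := pullBil (Θ.extend (𝓡∂ (n + 1))).symm T

section

variable [IsManifold (𝓡∂ (n + 1)) ∞ M] (he : Θ ∈ IsManifold.maximalAtlas (𝓡∂ (n + 1)) ∞ M)
  (he' : Θ' ∈ IsManifold.maximalAtlas (𝓡∂ (n + 1)) ∞ M)

include he he'

lemma chartBil_transition (hx : x ∈ intTarget Θ)
    (hx' : (Θ.extend (𝓡∂ (n + 1))).symm x ∈ Θ'.source) (hpos : 0 < transition Θ Θ' x 0)
    (T : BilField n M) : chartBil Θ T =ᶠ[𝓝 x] fun y =>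
      compBil (chartBil Θ' T (transition Θ Θ' y)) (fderiv ℝ (transition Θ Θ') y) := by
  have h := (transition_spec he he' hx hx' hpos).2
  filter_upwards [eventually_eventually_nhds.2 h] with y hy
  have hy0 := hy.self_of_nhds
  have h1 : (Θ.extend (𝓡∂ (n + 1))).symm =ᶠ[𝓝 y]
      fun y => (Θ'.extend (𝓡∂ (n + 1))).symm (transition Θ Θ' y) :=
    hy.mono fun z hz => hz.2.2.2.symm
  rw [chartBil, pullBil_congr h1]
  exact pullBil_comp (mdifferentiableAt_symm he' hy0.2.1)
    ((contDiffAt_transition he he' hy0.1 hy0.2.2.1).differentiableAt (by simp))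

end

end Charts

end WeakAH

namespace WeakAH

/-! ### Geometric quantities computed in an arbitrary chart -/

section Invariance

set_option linter.unusedSectionVars false

variable {n : ℕ} {M : Type*} [TopologicalSpace M] [ChartedSpace (EuclideanHalfSpace (n + 1)) M]
  {Θ : OpenPartialHomeomorph M (EuclideanHalfSpace (n + 1))} {x : E n}

lemma coord_pos {p : M} (hp : (𝓡∂ (n + 1)).IsInteriorPoint p) : 0 < coord (n := n) p 0 := by
  have h := (𝓡∂ (n + 1)).isInteriorPoint_iff.1 hp
  rw [extChartAt] at h
  have h2 := interior_mono (OpenPartialHomeomorph.extend_target_subset_range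
    (chartAt (EuclideanHalfSpace (n + 1)) p) (I := 𝓡∂ (n + 1))) h
  rw [interior_range_modelWithCornersEuclideanHalfSpace] at h2
  exact h2

variable [IsManifold (𝓡∂ (n + 1)) ∞ M]

lemma chartAt_mem (p : M) :
    chartAt (EuclideanHalfSpace (n + 1)) p ∈ IsManifold.maximalAtlas (𝓡∂ (n + 1)) ∞ M :=
  IsManifold.chart_mem_maximalAtlas p

lemma coord_mem_intTarget {p : M} (hp : (𝓡∂ (n + 1)).IsInteriorPoint p) :
    coord (n := n) p ∈ intTarget (chartAt (EuclideanHalfSpace (n + 1)) p) :=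
  ⟨mem_extChartAt_target p, coord_pos hp⟩

lemma param_coord (p : M) : param (n := n) p (coord p) = p := extChartAt_to_inv p

lemma transition_coord (hx : x ∈ intTarget Θ) :
    transition (chartAt (EuclideanHalfSpace (n + 1)) ((Θ.extend (𝓡∂ (n + 1))).symm x)) Θ
      (coord ((Θ.extend (𝓡∂ (n + 1))).symm x)) = x := by
  change Θ.extend (𝓡∂ (n + 1)) (param (n := n) _ (coord (n := n) _)) = x
  rw [param_coord (n := n)]
  exact (Θ.extend (𝓡∂ (n + 1))).right_inv hx.1

variable (he : Θ ∈ IsManifold.maximalAtlas (𝓡∂ (n + 1)) ∞ M)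

include he

/-- The coordinate change from the preferred chart at an interior point to another chart. -/
lemma isCoordChange_coord (hx : x ∈ intTarget Θ) (p : M)
    (hp : p = (Θ.extend (𝓡∂ (n + 1))).symm x) :
    transition (chartAt (EuclideanHalfSpace (n + 1)) p) Θ (coord p) = x ∧
    IsCoordChange (transition (chartAt (EuclideanHalfSpace (n + 1)) p) Θ) (coord p) ∧
    (∀ᶠ y in 𝓝 (coord p), y ∈ intTarget (chartAt (EuclideanHalfSpace (n + 1)) p) ∧
      transition (chartAt (EuclideanHalfSpace (n + 1)) p) Θ y ∈ intTarget Θ ∧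
      param p y ∈ Θ.source ∧ (Θ.extend (𝓡∂ (n + 1))).symm
        (transition (chartAt (EuclideanHalfSpace (n + 1)) p) Θ y) = param p y) ∧
    ∀ T : BilField n M, pullBil (param p) T =ᶠ[𝓝 (coord p)] fun y =>
      compBil (chartBil Θ T (transition (chartAt (EuclideanHalfSpace (n + 1)) p) Θ y))
        (fderiv ℝ (transition (chartAt (EuclideanHalfSpace (n + 1)) p) Θ) y) := by
  have hint : (𝓡∂ (n + 1)).IsInteriorPoint p := hp ▸ isInteriorPoint_symm he hx
  have h1 : transition (chartAt (EuclideanHalfSpace (n + 1)) p) Θ (coord p) = x := by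
    subst hp; exact transition_coord hx
  have h2 : param (n := n) p (coord p) ∈ Θ.source := by
    rw [param_coord, hp]; exact symm_mem_source hx.1
  have h3 : 0 < transition (chartAt (EuclideanHalfSpace (n + 1)) p) Θ (coord p) 0 := by
    rw [h1]; exact hx.2
  have h4 := transition_spec (chartAt_mem p) he (coord_mem_intTarget hint) h2 h3
  exact ⟨h1, h4.1, h4.2, fun T =>
    chartBil_transition (chartAt_mem p) he (coord_mem_intTarget hint) h2 h3 T⟩

lemma eventually_comp_transition (hx : x ∈ intTarget Θ) (p : M)
    (hp : p = (Θ.extend (𝓡∂ (n + 1))).symm x) (f : M → ℝ) :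
    (fun z => f (param p z)) =ᶠ[𝓝 (coord p)] fun y =>
      f ((Θ.extend (𝓡∂ (n + 1))).symm
        (transition (chartAt (EuclideanHalfSpace (n + 1)) p) Θ y)) :=
  (isCoordChange_coord he hx p hp).2.2.1.mono fun _ hy => congrArg f hy.2.2.2.symm

/-- The definition uses a different chart at each point. Coordinate invariance allows one fixed
chart throughout, which is what makes derivative estimates possible. -/
lemma scalarCurvature_symm {T : BilField n M} (hx : x ∈ intTarget Θ)
    (hT : RegMetric (chartBil Θ T) x) :
    scalarCurvature T ((Θ.extend (𝓡∂ (n + 1))).symm x) = scalar (gram (chartBil Θ T)) x := by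
  obtain ⟨h1, h2, -, h4⟩ := isCoordChange_coord he hx _ rfl
  exact (h2.scalar_eq (h1.symm ▸ hT) (h4 T)).trans (by rw [h1])

lemma normDiffSq_symm {T : BilField n M} (hx : x ∈ intTarget Θ) {f : M → ℝ}
    (hf : DifferentiableAt ℝ (fun y => f ((Θ.extend (𝓡∂ (n + 1))).symm y)) x) :
    normDiffSq T f ((Θ.extend (𝓡∂ (n + 1))).symm x)
      = gradSq (gram (chartBil Θ T)) (fun y => f ((Θ.extend (𝓡∂ (n + 1))).symm y)) x := by
  obtain ⟨h1, h2, -, h4⟩ := isCoordChange_coord he hx _ rfl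
  exact (h2.gradSq_eq (f := fun y => f ((Θ.extend (𝓡∂ (n + 1))).symm y)) (h4 T) (h1.symm ▸ hf)
    (eventually_comp_transition he hx _ rfl f)).trans (by rw [h1])

lemma laplacian_symm {T : BilField n M} (hx : x ∈ intTarget Θ) {f : M → ℝ}
    (hT : RegMetric (chartBil Θ T) x)
    (hf : ContDiffAt ℝ 2 (fun y => f ((Θ.extend (𝓡∂ (n + 1))).symm y)) x) :
    laplacian T f ((Θ.extend (𝓡∂ (n + 1))).symm x)
      = laplace (gram (chartBil Θ T)) (fun y => f ((Θ.extend (𝓡∂ (n + 1))).symm y)) x := by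
  obtain ⟨h1, h2, -, h4⟩ := isCoordChange_coord he hx _ rfl
  exact (h2.laplace_eq (f := fun y => f ((Θ.extend (𝓡∂ (n + 1))).symm y)) (h1.symm ▸ hT) (h4 T)
    (h1.symm ▸ hf) (eventually_comp_transition he hx _ rfl f)).trans (by rw [h1])

/-- In a chart for which the vector field has constant components, the Lie derivative is a
directional derivative of the components. -/
lemma chartBil_lieDeriv {T : BilField n M} (hx : x ∈ intTarget Θ)
    (hT : DifferentiableAt ℝ (chartBil Θ T) x) {X : ∀ q : M, TangentSpace (𝓡∂ (n + 1)) q}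
    {c : E n} (hX : ∀ᶠ y in 𝓝 x, X ((Θ.extend (𝓡∂ (n + 1))).symm y) = dParam Θ y c) :
    chartBil Θ (lieDeriv X T) x = fderiv ℝ (chartBil Θ T) x c := by
  obtain ⟨p, hp⟩ : ∃ p, p = (Θ.extend (𝓡∂ (n + 1))).symm x := ⟨_, rfl⟩
  obtain ⟨h1, h2, h3, h4⟩ := isCoordChange_coord he hx p hp
  have hcont : Filter.Tendsto (transition (chartAt (EuclideanHalfSpace (n + 1)) p) Θ)
      (𝓝 (coord p)) (𝓝 x) := by
    have := h2.smooth.continuousAt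
    rwa [ContinuousAt, h1] at this
  have hder : ∀ᶠ y in 𝓝 (coord p), fderiv ℝ (transition (chartAt (EuclideanHalfSpace (n + 1)) p) Θ)
      y = (dChart Θ (param p y)).comp (dParam (chartAt (EuclideanHalfSpace (n + 1)) p) y) :=
    h3.mono fun y hy => fderiv_transition (chartAt_mem p) he hy.1 hy.2.2.1
  have hvf : ∀ᶠ y in 𝓝 (coord p), chartVF p X y
      = dChart (chartAt (EuclideanHalfSpace (n + 1)) p) (param p y)
        (dParam Θ (transition (chartAt (EuclideanHalfSpace (n + 1)) p) Θ y) c) := by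
    filter_upwards [hcont.eventually hX, h3] with y hy hy3
    rw [hy3.2.2.2] at hy
    exact congrArg (dChart (chartAt (EuclideanHalfSpace (n + 1)) p) (param p y)) hy
  have hXc : ∀ᶠ y in 𝓝 (coord p),
      fderiv ℝ (transition (chartAt (EuclideanHalfSpace (n + 1)) p) Θ) y (chartVF p X y) = c := by
    filter_upwards [hder, hvf, h3] with y hy1 hy2 hy3
    have e1 := congrArg (fun L : E n →L[ℝ] E n => L
      (dParam Θ (transition (chartAt (EuclideanHalfSpace (n + 1)) p) Θ y) c))
      (dParam_comp_dChart (chartAt_mem p) hy3.1)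
    have e2 := congrArg (fun L : E n →L[ℝ] E n => L c) (dChart_comp_dParam he hy3.2.1)
    rw [hy3.2.2.2] at e2
    simp only [ContinuousLinearMap.comp_apply, ContinuousLinearMap.id_apply] at e1 e2
    rw [hy1, hy2, ContinuousLinearMap.comp_apply]
    exact (congrArg (dChart Θ (param p y)) e1).trans e2
  have hback : ∀ᶠ y in 𝓝 x, fderiv ℝ
      (transition Θ (chartAt (EuclideanHalfSpace (n + 1)) p)) y
      = (dChart (chartAt (EuclideanHalfSpace (n + 1)) p) ((Θ.extend (𝓡∂ (n + 1))).symm y)).comp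
        (dParam Θ y) := by
    have e1 := (contMDiffAt_symm he hx).continuousAt.eventually
      ((chartAt (EuclideanHalfSpace (n + 1)) p).open_source.mem_nhds
        (hp ▸ mem_chart_source (EuclideanHalfSpace (n + 1)) p))
    filter_upwards [(isOpen_intTarget Θ).mem_nhds hx, e1] with y hy1 hy2
    exact fderiv_transition he (chartAt_mem p) hy1 hy2
  -- No smoothness of `X` is assumed: near the point, `X` in the preferred chart is the image of the
  -- constant `c` under the differential of a smooth coordinate change, hence differentiable.
  have hXd : DifferentiableAt ℝ (chartVF p X) (coord p) := by
    have e1 : chartVF p X =ᶠ[𝓝 (coord p)] fun y => fderiv ℝ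
        (transition Θ (chartAt (EuclideanHalfSpace (n + 1)) p))
        (transition (chartAt (EuclideanHalfSpace (n + 1)) p) Θ y) c := by
      filter_upwards [hvf, hcont.eventually hback, h3] with y hy1 hy2 hy3
      rw [hy1, hy2, hy3.2.2.2]
      rfl
    refine DifferentiableAt.congr_of_eventuallyEq ?_ e1
    have e2 : ContDiffAt ℝ ∞ (transition Θ (chartAt (EuclideanHalfSpace (n + 1)) p)) x :=
      contDiffAt_transition he (chartAt_mem p) hx
        (hp ▸ mem_chart_source (EuclideanHalfSpace (n + 1)) p)
    have e3 : DifferentiableAt ℝ (fderiv ℝ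
        (transition Θ (chartAt (EuclideanHalfSpace (n + 1)) p))) x :=
      (e2.fderiv_right (m := 1) (by exact three_le_infty.trans' (by norm_num))).differentiableAt
        (by simp)
    have e4 : DifferentiableAt ℝ (fun z => fderiv ℝ
        (transition Θ (chartAt (EuclideanHalfSpace (n + 1)) p)) z c)
        (transition (chartAt (EuclideanHalfSpace (n + 1)) p) Θ (coord p)) := by
      rw [h1]
      exact e3.clm_apply (differentiableAt_const c)
    exact e4.comp (coord p) (h2.smooth.differentiableAt (by simp))
  have h5 := h2.lieE_eq (T := chartBil Θ T) (h1.symm ▸ hT) (h4 T) hXd hXc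
  rw [h1] at h5
  have h7 : chartBil Θ (lieDeriv X T) x = compBil (compBil (lieE (chartVF p X)
      (pullBil (param p) T) (coord p)) (dChart (chartAt (EuclideanHalfSpace (n + 1)) p) p))
      (dParam Θ x) := by
    subst hp; rfl
  have hint : (𝓡∂ (n + 1)).IsInteriorPoint p := hp ▸ isInteriorPoint_symm he hx
  have h8 : ((fderiv ℝ (transition (chartAt (EuclideanHalfSpace (n + 1)) p) Θ) (coord p)).comp
      (dChart (chartAt (EuclideanHalfSpace (n + 1)) p) p)).comp (dParam Θ x)
      = ContinuousLinearMap.id ℝ (E n) := by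
    have e0 := hder.self_of_nhds
    have e1 := dParam_comp_dChart (chartAt_mem p) (coord_mem_intTarget hint)
    have e2 := dChart_comp_dParam he hx
    have e3 : ((chartAt (EuclideanHalfSpace (n + 1)) p).extend (𝓡∂ (n + 1))).symm (coord p) = p :=
      param_coord p
    rw [e3] at e1
    rw [param_coord (n := n)] at e0
    rw [← hp] at e2
    rw [e0, ContinuousLinearMap.comp_assoc (dChart Θ p), e1, ContinuousLinearMap.comp_id, e2]
  rw [h7, h5, compBil_comp, compBil_comp, ← ContinuousLinearMap.comp_assoc, h8]
  rfl

end Invariance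

end WeakAH

namespace WeakAH

/-! ### Coordinate vector fields and uniform nondegeneracy up to the boundary -/

section CoordinateFields

set_option linter.unusedSectionVars false

variable {n : ℕ} {M : Type*} [TopologicalSpace M] [ChartedSpace (EuclideanHalfSpace (n + 1)) M]
  [IsManifold (𝓡∂ (n + 1)) ∞ M]
  {Θ : OpenPartialHomeomorph M (EuclideanHalfSpace (n + 1))} {x : E n}

lemma uniqueDiffOn_target (Θ : OpenPartialHomeomorph M (EuclideanHalfSpace (n + 1))) :
    UniqueDiffOn ℝ (Θ.extend (𝓡∂ (n + 1))).target := by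
  rw [OpenPartialHomeomorph.extend_target]
  exact (𝓡∂ (n + 1)).uniqueDiffOn_preimage Θ.open_target

/-- The vector field with constant components `c` in the chart `Θ`. -/
noncomputable def coordField (Θ : OpenPartialHomeomorph M (EuclideanHalfSpace (n + 1))) (c : E n)
    (q : M) : TangentSpace (𝓡∂ (n + 1)) q :=
  (mfderivWithin 𝓘(ℝ, E n) (𝓡∂ (n + 1)) (Θ.extend (𝓡∂ (n + 1))).symm
    (Θ.extend (𝓡∂ (n + 1))).target (Θ.extend (𝓡∂ (n + 1)) q) : E n →L[ℝ] E n) c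

/-- The derivative within the target makes `coordField` meaningful at boundary points, where the
target is not a neighbourhood in `E n`; at interior points it is the ordinary derivative. -/
lemma coordField_symm (hx : x ∈ intTarget Θ) (c : E n) :
    coordField Θ c ((Θ.extend (𝓡∂ (n + 1))).symm x) = dParam Θ x c := by
  have h1 : mfderivWithin 𝓘(ℝ, E n) (𝓡∂ (n + 1)) (Θ.extend (𝓡∂ (n + 1))).symm
      (Θ.extend (𝓡∂ (n + 1))).target x
      = mfderiv 𝓘(ℝ, E n) (𝓡∂ (n + 1)) (Θ.extend (𝓡∂ (n + 1))).symm x :=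
    mfderivWithin_of_mem_nhds (Filter.mem_of_superset ((isOpen_intTarget Θ).mem_nhds hx)
      Set.inter_subset_left)
  have key : ∀ y, y = x → (mfderivWithin 𝓘(ℝ, E n) (𝓡∂ (n + 1)) (Θ.extend (𝓡∂ (n + 1))).symm
      (Θ.extend (𝓡∂ (n + 1))).target y : E n →L[ℝ] E n) c = dParam Θ x c := by
    rintro y rfl
    exact congrArg (fun L : E n →L[ℝ] E n => L c) h1
  exact key _ ((Θ.extend (𝓡∂ (n + 1))).right_inv hx.1)

lemma det_ne_zero_of_pos {B : Bil n} (h : ∀ v, v ≠ 0 → 0 < B v v) :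
    (Matrix.of fun i j => B (e n i) (e n j)).det ≠ 0 := by
  intro hdet
  obtain ⟨v, hv, hv0⟩ := Matrix.exists_vecMul_eq_zero_iff.2 hdet
  set w : E n := ∑ i, v i • e n i with hw
  have h1 : ∀ j, B w (e n j) = 0 := by
    intro j
    have := congrFun hv0 j
    simpa [Matrix.vecMul, dotProduct, hw, map_sum, map_smul, sum_apply, smul_apply] using this
  have h2 : B w w = 0 := by
    conv_lhs => rw [hw, map_sum]
    exact Finset.sum_eq_zero fun i _ => by rw [map_smul, ← hw, h1, smul_zero]
  have h3 : w = 0 := by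
    by_contra hne
    exact (h w hne).ne' h2
  apply hv
  ext i
  have := congrArg (fun u : E n => u i) h3
  simpa [hw] using this

variable (he : Θ ∈ IsManifold.maximalAtlas (𝓡∂ (n + 1)) ∞ M)

include he

lemma coordField_ne_zero {q : M} (hq : q ∈ Θ.source) {c : E n} (hc : c ≠ 0) :
    coordField Θ c q ≠ 0 := by
  have hy : Θ.extend (𝓡∂ (n + 1)) q ∈ (Θ.extend (𝓡∂ (n + 1))).target :=
    (Θ.extend (𝓡∂ (n + 1))).map_source (by rwa [OpenPartialHomeomorph.extend_source])
  have hu : UniqueMDiffWithinAt 𝓘(ℝ, E n) (Θ.extend (𝓡∂ (n + 1))).target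
      (Θ.extend (𝓡∂ (n + 1)) q) := (uniqueDiffOn_target Θ).uniqueMDiffOn _ hy
  have h1 := mfderiv_comp_mfderivWithin (Θ.extend (𝓡∂ (n + 1)) q)
    ((Θ.contMDiffAt_extend he (symm_mem_source hy)).mdifferentiableAt (by simp))
    ((contMDiffOn_symm_target he _ hy).mdifferentiableWithinAt (by simp)) hu
  have h2 : mfderivWithin 𝓘(ℝ, E n) 𝓘(ℝ, E n)
      (Θ.extend (𝓡∂ (n + 1)) ∘ (Θ.extend (𝓡∂ (n + 1))).symm) (Θ.extend (𝓡∂ (n + 1))).target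
      (Θ.extend (𝓡∂ (n + 1)) q) = mfderivWithin 𝓘(ℝ, E n) 𝓘(ℝ, E n) id
        (Θ.extend (𝓡∂ (n + 1))).target (Θ.extend (𝓡∂ (n + 1)) q) :=
    mfderivWithin_congr (fun y hy => (Θ.extend (𝓡∂ (n + 1))).right_inv hy)
      ((Θ.extend (𝓡∂ (n + 1))).right_inv hy)
  have key : ∀ (A P I : E n →L[ℝ] E n), I = A.comp P → I = ContinuousLinearMap.id ℝ (E n) →
      P c ≠ 0 := by
    rintro A P I h1 rfl h3
    have := congrArg (fun L : E n →L[ℝ] E n => L c) h1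
    simp [h3] at this
    exact hc this
  exact key _ _ _ h1 (h2.trans (mfderivWithin_id hu))

/-- The field is the constant section of the tangent bundle of `E n` pushed forward by the tangent
map of the inverse chart, which is smooth up to the boundary. -/
lemma contMDiffOn_coordField (c : E n) :
    ContMDiffOn (𝓡∂ (n + 1)) (𝓡∂ (n + 1)).tangent ∞
      (fun q => (⟨q, coordField Θ c q⟩ : TangentBundle (𝓡∂ (n + 1)) M)) Θ.source := by
  have h1 := (contMDiffOn_symm_target he).contMDiffOn_tangentMapWithin (m := ∞) (by simp)
    (uniqueDiffOn_target Θ).uniqueMDiffOn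
  have h2 : ContMDiff 𝓘(ℝ, E n) 𝓘(ℝ, E n).tangent ∞
      (fun y : E n => (⟨y, c⟩ : TangentBundle 𝓘(ℝ, E n) (E n))) := by
    rw [contMDiff_vectorSpace_iff_contDiff (V := fun _ => c)]
    exact contDiff_const
  have h3 : ContMDiffOn (𝓡∂ (n + 1)) 𝓘(ℝ, E n).tangent ∞
      (fun q : M => (⟨Θ.extend (𝓡∂ (n + 1)) q, c⟩ : TangentBundle 𝓘(ℝ, E n) (E n))) Θ.source :=
    h2.comp_contMDiffOn (Θ.contMDiffOn_extend he)
  refine (h1.comp h3 fun q hq => ?_).congr fun q hq => ?_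
  · refine (Θ.extend (𝓡∂ (n + 1))).map_source ?_
    rwa [OpenPartialHomeomorph.extend_source]
  · have h4 : (Θ.extend (𝓡∂ (n + 1))).symm (Θ.extend (𝓡∂ (n + 1)) q) = q :=
      (Θ.extend (𝓡∂ (n + 1))).left_inv (by rwa [OpenPartialHomeomorph.extend_source])
    have key : ∀ (p q : M) (v : E n), p = q →
        (⟨q, v⟩ : TangentBundle (𝓡∂ (n + 1)) M) = ⟨p, v⟩ := by
      rintro p q v rfl; rfl
    exact key _ _ _ h4

/-- Coordinate vector fields extend from a closed subset of the chart domain to smooth vector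
fields on the whole manifold. -/
lemma exists_smoothVF [T2Space M] [CompactSpace M] {K : Set M} (hK : IsClosed K)
    (hKs : K ⊆ Θ.source) (c : E n) :
    ∃ X : SmoothVF n M, ∀ y ∈ intTarget Θ, (Θ.extend (𝓡∂ (n + 1))).symm y ∈ K →
      X ((Θ.extend (𝓡∂ (n + 1))).symm y) = dParam Θ y c := by
  -- A cutoff equal to 1 near `K` and vanishing near the complement of the chart domain; the
  -- coordinate field times `f` extends smoothly by zero.
  obtain ⟨f, hf0, hf1, -⟩ := exists_contMDiffMap_zero_one_nhds_of_isClosed (𝓡∂ (n + 1)) (n := (⊤ : ℕ∞))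
    Θ.open_source.isClosed_compl hK (Set.disjoint_left.2 fun q hq hq' => hq (hKs hq'))
  have hts : tsupport f ⊆ Θ.source := by
    intro q hq
    by_contra hqs
    have h1 : ∀ᶠ y in 𝓝 q, f y = 0 := hf0.filter_mono (nhds_le_nhdsSet hqs)
    exact (notMem_tsupport_iff_eventuallyEq.2 h1) hq
  have hs := ContMDiffOn.smul_section_of_tsupport (ψ := f) f.contMDiff.contMDiffOn Θ.open_source hts
    (contMDiffOn_coordField he c)
  refine ⟨⟨_, hs⟩, fun y hy hyK => ?_⟩
  have h2 : f ((Θ.extend (𝓡∂ (n + 1))).symm y) = 1 := (hf1.filter_mono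
    (nhds_le_nhdsSet hyK)).self_of_nhds
  have h3 := coordField_symm hy c
  change f ((Θ.extend (𝓡∂ (n + 1))).symm y) • coordField Θ c _ = _
  rw [h2, one_smul]
  exact h3

/-- A metric that is continuous up to the boundary is uniformly nondegenerate in a chart on
compact sets. -/
lemma exists_det_lower_bound [T2Space M] [CompactSpace M] {K : Set M} (hK : IsClosed K)
    (hKs : K ⊆ Θ.source) {T : BilField n M}
    (hT : ∃ G : Bundle.ContinuousRiemannianMetric (E n)
      (fun p : M => TangentSpace (𝓡∂ (n + 1)) p),
      ∀ p ∈ (𝓡∂ (n + 1)).interior M, G.inner p = T p) :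
    ∃ δ > 0, ∀ y ∈ intTarget Θ, (Θ.extend (𝓡∂ (n + 1))).symm y ∈ K →
      δ ≤ |(gram (chartBil Θ T) y).det| := by
  obtain ⟨G, hG⟩ := hT
  -- The Gram matrix of the continuous extension in the coordinate frame, defined on the boundary
  -- too. Its determinant is continuous and nowhere zero on the chart domain, so its modulus has a
  -- positive minimum on compact `K`.
  let S : M → Matrix (Fin (n + 1)) (Fin (n + 1)) ℝ := fun q => Matrix.of fun i j =>
    G.inner q (coordField Θ (e n i) q) (coordField Θ (e n j) q)
  have hS : ContinuousOn S Θ.source := by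
    refine continuousOn_pi.2 fun i => continuousOn_pi.2 fun j q hq => ?_
    have h1 : ContinuousWithinAt (fun m ↦ Bundle.TotalSpace.mk' ℝ (E := Bundle.Trivial M ℝ) m
        (G.inner m (coordField Θ (e n i) m) (coordField Θ (e n j) m))) Θ.source q :=
      G.continuous.continuousAt.continuousWithinAt.clm_bundle_apply₂ (F₁ := E n) (F₂ := E n)
        ((contMDiffOn_coordField he (e n i)).continuousOn q hq)
        ((contMDiffOn_coordField he (e n j)).continuousOn q hq)
    simp only [FiberBundle.continuousWithinAt_totalSpace] at h1
    exact h1.2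
  have hS0 : ∀ q ∈ Θ.source, (S q).det ≠ 0 := by
    intro q hq
    let P : E n →L[ℝ] E n := mfderivWithin 𝓘(ℝ, E n) (𝓡∂ (n + 1)) (Θ.extend (𝓡∂ (n + 1))).symm
      (Θ.extend (𝓡∂ (n + 1))).target (Θ.extend (𝓡∂ (n + 1)) q)
    exact det_ne_zero_of_pos (B := compBil (n := n) (G.inner q) P) fun v hv =>
      G.pos q _ (coordField_ne_zero he hq hv)
  have hSd : ContinuousOn (fun q => |(S q).det|) K :=
    (continuous_abs.comp continuous_id.matrix_det).comp_continuousOn (hS.mono hKs)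
  have hcmp : ∀ y ∈ intTarget Θ, gram (chartBil Θ T) y = S ((Θ.extend (𝓡∂ (n + 1))).symm y) := by
    intro y hy
    have h1 := hG _ (isInteriorPoint_symm he hy)
    ext i j
    change T ((Θ.extend (𝓡∂ (n + 1))).symm y) (dParam Θ y (e n i)) (dParam Θ y (e n j))
      = G.inner _ (coordField Θ (e n i) _) (coordField Θ (e n j) _)
    rw [coordField_symm hy, coordField_symm hy, h1]
  rcases K.eq_empty_or_nonempty with hne | hne
  · exact ⟨1, one_pos, fun y _ hy => by simp [hne] at hy⟩
  · obtain ⟨q, hq, hmin⟩ := hK.isCompact.exists_isMinOn hne hSd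
    refine ⟨|(S q).det|, abs_pos.2 (hS0 q (hKs hq)), fun y hy hyK => ?_⟩
    rw [hcmp y hy]
    exact hmin hyK

end CoordinateFields

end WeakAH

namespace WeakAH

/-! ### Tensor fields on rescaled balls -/

section Patches

set_option linter.unusedSectionVars false
set_option synthInstance.maxHeartbeats 400000
set_option maxHeartbeats 1000000

variable {n : ℕ} {M : Type*} [TopologicalSpace M] [ChartedSpace (EuclideanHalfSpace (n + 1)) M]
  [IsManifold (𝓡∂ (n + 1)) ∞ M] {ρ : M → ℝ}

/-- The parametrizations `z ↦ Θ⁻¹ (rescale (c i) z)` belong to the Möbius cover `A`, and the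
defining function is uniformly controlled on them. -/
structure PatchChart {ι : Type*} (A : MobiusCover n ρ) (α : ℝ) (c : ι → E n)
    (Θ : OpenPartialHomeomorph M (EuclideanHalfSpace (n + 1))) : Prop where
  mem : Θ ∈ IsManifold.maximalAtlas (𝓡∂ (n + 1)) ∞ M
  pos : ∀ i, 0 < c i 0
  maps : ∀ i, (fun z => (Θ.extend (𝓡∂ (n + 1))).symm (rescale (c i) z)) ∈ A.maps
  dom : ∃ K, IsClosed K ∧ K ⊆ Θ.source ∧
    ∀ y ∈ patch c, y ∈ intTarget Θ ∧ (Θ.extend (𝓡∂ (n + 1))).symm y ∈ K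
  rho_pos : ∀ y ∈ patch c, 0 < ρ ((Θ.extend (𝓡∂ (n + 1))).symm y)
  rho : ∀ m k, SmoothBounded α c m k (fun y => ρ ((Θ.extend (𝓡∂ (n + 1))).symm y))
  weight : ∀ k, UnifHolder k α
    (fun i z => (c i 0)⁻¹ * ρ ((Θ.extend (𝓡∂ (n + 1))).symm (rescale (c i) z)))
  rho_alt : (∀ y ∈ patch c, ρ ((Θ.extend (𝓡∂ (n + 1))).symm y) = y 0) ∨
    ∃ δ > 0, ∀ y ∈ patch c, δ ≤ ρ ((Θ.extend (𝓡∂ (n + 1))).symm y)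

namespace PatchChart

variable {ι : Type*} {A : MobiusCover n ρ} {α : ℝ} {c : ι → E n}
  {Θ : OpenPartialHomeomorph M (EuclideanHalfSpace (n + 1))} (P : PatchChart A α c Θ)
  {k : ℕ} {S : BilField n M} {y : E n}

include P

lemma mem_intTarget (hy : y ∈ patch c) : y ∈ intTarget Θ := by
  obtain ⟨K, -, -, h⟩ := P.dom
  exact (h y hy).1

/-- Pulling back under the rescaling multiplies a bilinear form by `(c i 0)²`, which joins the
weight `ρ⁻²` to form `(ρ / c i 0)⁻²`. This ratio is uniformly controlled, so weight 2 means bounded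
components. -/
lemma pullBil_eq (S : BilField n M) (i : ι) {z : E n} (hz : z ∈ hypBall n 2) :
    pullBil (fun z => (Θ.extend (𝓡∂ (n + 1))).symm (rescale (c i) z))
        (fun p => ρ p ^ (-(2 : ℝ)) • S p) z
      = (((c i 0)⁻¹ * ρ ((Θ.extend (𝓡∂ (n + 1))).symm (rescale (c i) z))) ^ 2)⁻¹ •
        chartBil Θ S (rescale (c i) z) := by
  have hy := rescale_mem_patch (c := c) i hz
  have hc := (P.pos i).ne'
  have hr := P.rho_pos _ hy
  rw [pullBil_comp (mdifferentiableAt_symm P.mem (P.mem_intTarget hy))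
    (hasFDerivAt_rescale _ _).differentiableAt, (hasFDerivAt_rescale _ _).fderiv]
  have h2 : ρ ((Θ.extend (𝓡∂ (n + 1))).symm (rescale (c i) z)) ^ (-(2 : ℝ))
      = (ρ ((Θ.extend (𝓡∂ (n + 1))).symm (rescale (c i) z)) ^ 2)⁻¹ := by
    rw [Real.rpow_neg hr.le, Real.rpow_two]
  have h3 : ∀ (B : Bil n) (L : E n →L[ℝ] E n) (s t : ℝ),
      compBil (compBil (s • B) L) (t • ContinuousLinearMap.id ℝ (E n))
        = (s * t ^ 2) • compBil B L := by
    intro B L s t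
    ext v w
    simp only [compBil, ContinuousLinearMap.bilinearComp_apply, smul_apply,
      ContinuousLinearMap.id_apply, map_smul, smul_eq_mul]
    ring
  refine (h3 (S _) _ _ _).trans ?_
  rw [h2]
  refine congrArg (fun s : ℝ => s • chartBil Θ S (rescale (c i) z)) ?_
  field_simp

lemma unifHolder_pullBil (h : HolderBil A k α 2 S) :
    UnifHolder k α fun i z =>
      (((c i 0)⁻¹ * ρ ((Θ.extend (𝓡∂ (n + 1))).symm (rescale (c i) z))) ^ 2)⁻¹ •
        chartBil Θ S (rescale (c i) z) := by
  obtain ⟨C, hC⟩ := h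
  have h1 : UnifHolder k α fun i => pullBil
      (fun z => (Θ.extend (𝓡∂ (n + 1))).symm (rescale (c i) z))
        (fun p => ρ p ^ (-(2 : ℝ)) • S p) := ⟨C, fun i => hC _ (P.maps i)⟩
  exact h1.congr fun i z hz => (P.pullBil_eq S i hz).symm

lemma weight_pos (i : ι) {z : E n} (hz : z ∈ hypBall n 2) :
    0 < (c i 0)⁻¹ * ρ ((Θ.extend (𝓡∂ (n + 1))).symm (rescale (c i) z)) :=
  mul_pos (inv_pos.2 (P.pos i)) (P.rho_pos _ (rescale_mem_patch i hz))

lemma unifHolder_gram (hα : α ∈ Set.Ico (0 : ℝ) 1) (h : HolderBil A k α 2 S)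
    (a b : Fin (n + 1)) :
    UnifHolder k α fun i z => gram (chartBil Θ S) (rescale (c i) z) a b := by
  have h1 := (P.unifHolder_pullBil h).clm_comp
    ((ContinuousLinearMap.apply ℝ ℝ (e n b)).comp
      (ContinuousLinearMap.apply ℝ (E n →L[ℝ] ℝ) (e n a)))
  refine (((P.weight k).mul hα (P.weight k)).mul hα h1).congr fun i z hz => ?_
  have hw := (P.weight_pos i hz).ne'
  simp only [ContinuousLinearMap.comp_apply, ContinuousLinearMap.apply_apply, smul_apply,
    smul_eq_mul, gram, Matrix.of_apply]
  generalize (c i 0)⁻¹ * ρ ((Θ.extend (𝓡∂ (n + 1))).symm (rescale (c i) z)) = w at hw ⊢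
  field_simp

lemma contDiffAt_chartBil (h : HolderBil A k α 2 S) (hy : y ∈ patch c) :
    ContDiffAt ℝ k (chartBil Θ S) y := by
  obtain ⟨i, z, hz, rfl⟩ := hy
  obtain ⟨C, hC⟩ := P.unifHolder_pullBil h
  obtain ⟨C', hC'⟩ := P.weight k
  have hB := isOpen_hypBall_two n
  have hc := (P.pos i).ne'
  have h1 := (hC i).1.contDiffAt (hB.mem_nhds hz)
  have h2 := (hC' i).1.contDiffAt (hB.mem_nhds hz)
  have h3 : ContDiffAt ℝ k (fun z => chartBil Θ S (rescale (c i) z)) z := by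
    refine (contDiffAt_smul_clm (h2.pow 2) h1).congr_of_eventuallyEq ?_
    refine Filter.eventually_of_mem (hB.mem_nhds hz) fun x hx => ?_
    have hw := (P.weight_pos i hx).ne'
    simp only
    rw [smul_smul, mul_inv_cancel₀ (pow_ne_zero 2 hw), one_smul]
  have h4 : ContDiffAt ℝ k (fun y => chartBil Θ S (rescale (c i) (unscale (c i) y)))
      (rescale (c i) z) :=
    ContDiffAt.comp (G := Bil n) (g := fun z => chartBil Θ S (rescale (c i) z))
      (rescale (c i) z) (by rwa [unscale_rescale hc])
      (contDiff_unscale (c i)).contDiffAt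
  simpa only [rescale_unscale hc] using h4

variable [T2Space M] [CompactSpace M]

/-- The patch is open and mapped into `K`, so the cut-off field has constant components near every
point of the patch. -/
lemma exists_vectorField (v : E n) : ∃ X : SmoothVF n M, ∀ T : BilField n M, ∀ y ∈ patch c,
    DifferentiableAt ℝ (chartBil Θ T) y →
      chartBil Θ (lieDeriv (fun p => X p) T) y = fderiv ℝ (chartBil Θ T) y v := by
  obtain ⟨K, hK, hKs, hKp⟩ := P.dom
  obtain ⟨X, hX⟩ := exists_smoothVF P.mem hK hKs v
  refine ⟨X, fun T y hy hT => chartBil_lieDeriv P.mem (P.mem_intTarget hy) hT ?_⟩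
  filter_upwards [(isOpen_patch P.pos).mem_nhds hy] with x hx
  exact hX x (P.mem_intTarget hx) (hKp x hx).2

lemma pd_gram_eq {X : SmoothVF n M} {l : Fin (n + 1)}
    (hX : ∀ T : BilField n M, ∀ y ∈ patch c, DifferentiableAt ℝ (chartBil Θ T) y →
      chartBil Θ (lieDeriv (fun p => X p) T) y = fderiv ℝ (chartBil Θ T) y (e n l))
    (hS : ∀ y ∈ patch c, DifferentiableAt ℝ (chartBil Θ S) y) (a b : Fin (n + 1))
    (hy : y ∈ patch c) : pd l (fun y => gram (chartBil Θ S) y a b) y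
      = gram (chartBil Θ (lieDeriv (fun p => X p) S)) y a b := by
  rw [pd_gram (hS y hy), gram, Matrix.of_apply, hX S y hy (hS y hy)]

/-- Coordinate derivatives of the components are components of Lie derivatives along global smooth
fields, and the class bounds two of these. The derivatives are in background coordinates, hence
stronger than the rescaled ones. -/
lemma smoothBounded_gram (hα : α ∈ Set.Ico (0 : ℝ) 1) (hk : 2 ≤ k) {T : BilField n M}
    (hT : MemScriptC A k α 2 T) (a b : Fin (n + 1)) :
    SmoothBounded α c 2 k (fun y => gram (chartBil Θ T) y a b) := by
  choose X hX using fun l => P.exists_vectorField (e n l)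
  have h0 : HolderBil A k α 2 T := hT [] (by simp)
  have h1 : ∀ l, HolderBil A (k - 1) α 2 (lieDeriv (fun p => X l p) T) :=
    fun l => hT [X l] (by simp)
  have h2 : ∀ l m, HolderBil A (k - 1 - 1) α 2
      (lieDeriv (fun p => X m p) (lieDeriv (fun p => X l p) T)) :=
    -- `List.foldr` applies the last field of the list first.
    fun l m => hT [X m, X l] (by simp)
  have hd : ∀ (j : ℕ) (S : BilField n M), 1 ≤ j → HolderBil A j α 2 S → ∀ y ∈ patch c,
      DifferentiableAt ℝ (chartBil Θ S) y := fun j S hj hS y hy =>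
    (P.contDiffAt_chartBil hS hy).differentiableAt (by exact_mod_cast (by omega : j ≠ 0))
  have hd' : ∀ (j : ℕ) (S : BilField n M), 1 ≤ j → HolderBil A j α 2 S → ∀ y ∈ patch c,
      DifferentiableAt ℝ (fun y => gram (chartBil Θ S) y a b) y := fun j S hj hS y hy =>
    (contDiffAt_gram (k := 1) ((P.contDiffAt_chartBil hS hy).of_le (by exact_mod_cast hj))
      a b).differentiableAt (by simp)
  refine ⟨P.unifHolder_gram hα h0 a b, hd' k T (by omega) h0, fun l => ?_⟩
  refine SmoothBounded.congr P.pos (f := fun y => gram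
    (chartBil Θ (lieDeriv (fun p => X l p) T)) y a b) ?_
    fun y hy => P.pd_gram_eq (hX l) (hd k T (by omega) h0) a b hy
  refine ⟨P.unifHolder_gram hα (h1 l) a b, hd' (k - 1) _ (by omega) (h1 l), fun m => ?_⟩
  refine SmoothBounded.congr P.pos (f := fun y => gram
    (chartBil Θ (lieDeriv (fun p => X m p) (lieDeriv (fun p => X l p) T))) y a b) ?_
    fun y hy => P.pd_gram_eq (hX m) (hd (k - 1) _ (by omega) (h1 l)) a b hy
  exact P.unifHolder_gram hα (h2 l m) a b

end PatchChart

end Patches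

end WeakAH

namespace WeakAH

/-! ### Boundary and interior parametrizations as patch charts -/

lemma SmoothBounded.height {n : ℕ} {ι : Type*} {α : ℝ} {c : ι → E n} {m k : ℕ}
    (hα : α ∈ Set.Ico (0 : ℝ) 1) (hb : ∃ C, 0 ≤ C ∧ ∀ i, |c i 0| ≤ C) :
    SmoothBounded α c m k (fun y => y 0) := by
  have h0 : UnifHolder k α (fun i z => rescale (c i) z 0) :=
    ((UnifHolder.const hb).mul hα (UnifHolder.coordinate hα 0)).congr fun i z _ =>
      rescale_apply_zero _ _
  have hd : ∀ x : E n, fderiv ℝ (fun x : E n => x 0) x = EuclideanSpace.proj 0 := fun x =>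
    (EuclideanSpace.proj 0 : E n →L[ℝ] ℝ).fderiv
  cases m with
  | zero => exact h0
  | succ m =>
    refine ⟨h0, fun x _ => (EuclideanSpace.proj 0 : E n →L[ℝ] ℝ).differentiableAt, fun l => ?_⟩
    have : pd l (fun x : E n => x 0) = fun _ => e n l 0 := by ext x; simp [pd, hd]
    rw [this]
    exact SmoothBounded.const _

lemma SmoothBounded.of_contDiffOn {n : ℕ} {ι : Type*} {α : ℝ} {m k : ℕ}
    (hα : α ∈ Set.Ico (0 : ℝ) 1) {V : Set (E n)} (hV : IsOpen V)
    (hBV : closure (hypBall n 2) ⊆ V) {f : E n → ℝ} (hf : ContDiffOn ℝ ∞ f V) :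
    SmoothBounded α (fun _ : ι => e n 0) m k f := by
  induction m generalizing k f with
  | zero =>
    exact (UnifHolder.of_contDiffOn hα hV hBV hf).congr fun i z _ => by rw [rescale_of_e]
  | succ m ih =>
    refine ⟨(UnifHolder.of_contDiffOn hα hV hBV hf).congr fun i z _ => by rw [rescale_of_e],
      fun x hx => ?_, fun l => ih ?_⟩
    · obtain ⟨i, z, hz, rfl⟩ := hx
      rw [rescale_of_e]
      exact (hf.contDiffAt (hV.mem_nhds (hBV (subset_closure hz)))).differentiableAt (by simp)
    · exact (hf.fderiv_of_isOpen hV (by simp)).clm_apply contDiffOn_const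

section

set_option linter.unusedSectionVars false

variable {n : ℕ} {M : Type*} [TopologicalSpace M] [ChartedSpace (EuclideanHalfSpace (n + 1)) M]
  [IsManifold (𝓡∂ (n + 1)) ∞ M] {ρ : M → ℝ}

lemma IsDefiningFunction.pos (hρ : IsDefiningFunction n ρ) {p : M}
    (hp : (𝓡∂ (n + 1)).IsInteriorPoint p) : 0 < ρ p := by
  refine lt_of_le_of_ne (hρ.nonneg p) fun h => ?_
  exact (𝓡∂ (n + 1)).isInteriorPoint_iff_not_isBoundaryPoint p |>.1 hp ((hρ.zero_iff p).1 h.symm)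

lemma contDiffOn_comp_symm (hρ : IsDefiningFunction n ρ)
    {Θ : OpenPartialHomeomorph M (EuclideanHalfSpace (n + 1))}
    (he : Θ ∈ IsManifold.maximalAtlas (𝓡∂ (n + 1)) ∞ M) :
    ContDiffOn ℝ ∞ (fun y => ρ ((Θ.extend (𝓡∂ (n + 1))).symm y)) (intTarget Θ) := fun y hy =>
  (contMDiffAt_iff_contDiffAt.1 ((hρ.smooth _).comp y (contMDiffAt_symm he hy))).contDiffWithinAt

variable (hρ : IsDefiningFunction n ρ) (A : MobiusCover n ρ) {α : ℝ}
  (hα : α ∈ Set.Ico (0 : ℝ) 1)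

include hρ hα

/-- All centres of one background chart form a single family. Since `ρ` is the coordinate of index
0, the ratio `ρ / c 0` is just `z 0`, independent of the centre. -/
lemma patchChart_bg [CompactSpace M] (b : Fin A.numBg) :
    PatchChart A α (fun c : A.centers b => (c : E n)) (A.bg b) := by
  have hpos : ∀ c : A.centers b, 0 < (c : E n) 0 := fun c => A.centers_pos b c c.2
  have hdom : ∀ y ∈ patch (fun c : A.centers b => (c : E n)), y ∈ intTarget (A.bg b) ∧
      ((A.bg b).extend (𝓡∂ (n + 1))).symm y ∈ closure (A.dom b) ∧
      ρ (((A.bg b).extend (𝓡∂ (n + 1))).symm y) = y 0 := by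
    rintro y ⟨c, z, hz, rfl⟩
    have h0 : 0 < rescale (c : E n) z 0 := by
      rw [rescale_apply_zero]; exact mul_pos (hpos c) hz.1
    obtain ⟨q, hq, hqy⟩ := A.centers_dom b c c.2 z hz
    have hqs := A.closure_dom b (subset_closure hq)
    have hqs' : q ∈ ((A.bg b).extend (𝓡∂ (n + 1))).source := by
      rwa [OpenPartialHomeomorph.extend_source]
    rw [← hqy] at h0 ⊢
    rw [((A.bg b).extend (𝓡∂ (n + 1))).left_inv hqs']
    exact ⟨⟨((A.bg b).extend (𝓡∂ (n + 1))).map_source hqs', h0⟩, subset_closure hq,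
      (A.bg_zero b q hqs).symm⟩
  obtain ⟨C, hC⟩ : ∃ C, ∀ p, ρ p ≤ C := by
    obtain ⟨C, hC⟩ := isCompact_univ.exists_bound_of_continuousOn hρ.smooth.continuous.continuousOn
    exact ⟨C, fun p => (le_abs_self _).trans (hC p (Set.mem_univ p))⟩
  -- The height of a centre is the value of `ρ` at the image of `e n 0`, and `ρ` is bounded on
  -- compact `M`.
  have hbd : ∃ C, 0 ≤ C ∧ ∀ c : A.centers b, |(c : E n) 0| ≤ C := by
    refine ⟨max C 0, le_max_right _ _, fun c => ?_⟩
    have h1 := (hdom _ (rescale_mem_patch (c := fun c : A.centers b => (c : E n)) c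
      (e_zero_mem_hypBall n two_pos))).2.2
    rw [rescale_e] at h1
    rw [abs_of_pos (hpos c), ← h1]
    exact (hC _).trans (le_max_left _ _)
  have hrho : ∀ y ∈ patch (fun c : A.centers b => (c : E n)),
      ρ (((A.bg b).extend (𝓡∂ (n + 1))).symm y) = y 0 := fun y hy => (hdom y hy).2.2
  exact
  { mem := A.bg_mem b
    pos := hpos
    maps := fun c => Or.inl ⟨b, c, c.2, rfl⟩
    dom := ⟨closure (A.dom b), isClosed_closure, A.closure_dom b,
      fun y hy => ⟨(hdom y hy).1, (hdom y hy).2.1⟩⟩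
    rho_pos := fun y hy => by rw [hrho y hy]; exact (hdom y hy).1.2
    rho := fun m k => (SmoothBounded.height hα hbd).congr hpos hrho
    weight := fun k => (UnifHolder.coordinate hα 0).congr fun c z hz => by
      rw [hrho _ (rescale_mem_patch (c := fun c : A.centers b => (c : E n)) c hz),
        rescale_apply_zero, inv_mul_cancel_left₀ (hpos c).ne']
    rho_alt := Or.inl hrho }

/-- A one-element family with centre `e n 0`, for which the rescaling is the identity. The closed
ball is mapped to a compact subset of the interior, where `ρ` is smooth and bounded below. -/
lemma patchChart_int [T2Space M] (i : Fin A.numInt) :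
    PatchChart A α (fun _ : Unit => e n 0) (A.int i) := by
  have hcl : closure (hypBall n 2) ⊆ intTarget (A.int i) := fun y hy =>
    ⟨A.int_target i hy, (Real.exp_pos _).trans_le (exp_le_apply_zero hy)⟩
  have hpatch : ∀ y ∈ patch (fun _ : Unit => e n 0), y ∈ closure (hypBall n 2) := by
    rintro y ⟨-, z, hz, rfl⟩
    rw [rescale_of_e]
    exact subset_closure hz
  have hpos : ∀ _ : Unit, 0 < e n 0 0 := fun _ => by simp
  have hsm := contDiffOn_comp_symm hρ (A.int_mem i)
  have hrp : ∀ y ∈ intTarget (A.int i), 0 < ρ (((A.int i).extend (𝓡∂ (n + 1))).symm y) :=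
    fun y hy => hρ.pos (isInteriorPoint_symm (A.int_mem i) hy)
  have hK := isCompact_closure_hypBall_two n
  exact
  { mem := A.int_mem i
    pos := hpos
    maps := fun _ => Or.inr ⟨i, by simp only [rescale_of_e]⟩
    dom := ⟨((A.int i).extend (𝓡∂ (n + 1))).symm '' closure (hypBall n 2),
      (hK.image_of_continuousOn ((contMDiffOn_symm_target (A.int_mem i)).continuousOn.mono
        (A.int_target i))).isClosed,
      by rintro _ ⟨y, hy, rfl⟩; exact symm_mem_source (A.int_target i hy),
      fun y hy => ⟨hcl (hpatch y hy), y, hpatch y hy, rfl⟩⟩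
    rho_pos := fun y hy => hrp y (hcl (hpatch y hy))
    rho := fun m k => SmoothBounded.of_contDiffOn hα (isOpen_intTarget _) hcl hsm
    weight := fun k => (UnifHolder.of_contDiffOn hα (isOpen_intTarget _) hcl hsm).congr
      fun _ z _ => by simp [rescale_of_e]
    rho_alt := by
      obtain ⟨y, hy, hmin⟩ := hK.exists_isMinOn
        ⟨e n 0, subset_closure (e_zero_mem_hypBall n two_pos)⟩ (hsm.continuousOn.mono hcl)
      exact Or.inr ⟨_, hrp y (hcl hy), fun x hx => hmin (hpatch x hx)⟩ }

end

end WeakAH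

namespace WeakAH

/-! ### The conformal identity and Hölder bounds for its terms -/

section Consequences

set_option linter.unusedSectionVars false

variable {n : ℕ} {M : Type*} [TopologicalSpace M] [ChartedSpace (EuclideanHalfSpace (n + 1)) M]
  [IsManifold (𝓡∂ (n + 1)) ∞ M] {ρ : M → ℝ}

/-- The transformation law of the scalar curvature under `g = ρ⁻² ḡ`. -/
lemma scalarCurvature_compactify (hρ : IsDefiningFunction n ρ) {g : BilField n M}
    {Θ : OpenPartialHomeomorph M (EuclideanHalfSpace (n + 1))}
    (he : Θ ∈ IsManifold.maximalAtlas (𝓡∂ (n + 1)) ∞ M) {x : E n} (hx : x ∈ intTarget Θ)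
    (hT : RegMetric (chartBil Θ (compactify ρ g)) x) {p : M}
    (hp : p = (Θ.extend (𝓡∂ (n + 1))).symm x) :
    scalarCurvature g p = ρ p ^ 2 * scalarCurvature (compactify ρ g) p
      + 2 * n * (ρ p * laplacian (compactify ρ g) ρ p)
      - n * (n + 1) * normDiffSq (compactify ρ g) ρ p := by
  obtain ⟨h1, h2, -, h4⟩ := isCoordChange_coord he hx p hp
  obtain ⟨Q, hQ, -⟩ := h2.inv.self_of_nhds
  have hint : (𝓡∂ (n + 1)).IsInteriorPoint p := hp ▸ isInteriorPoint_symm he hx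
  have hcoord := coord_mem_intTarget hint
  have hreg : RegMetric (pullBil (param p) (compactify ρ g)) (coord p) :=
    RegMetric.pullback (h1.symm ▸ hT) (h2.smooth.of_le three_le_infty) hQ (h4 _)
  have hpc : param (n := n) p (coord (n := n) p) = p := param_coord p
  have hr : ContDiffAt ℝ 2 (fun z => ρ (param (n := n) p z)) (coord p) :=
    ((contDiffOn_comp_symm hρ (chartAt_mem p)).contDiffAt
      ((isOpen_intTarget _).mem_nhds hcoord)).of_le (three_le_infty.trans' (by norm_num))
  have hpos : ∀ y ∈ intTarget (chartAt (EuclideanHalfSpace (n + 1)) p),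
      0 < ρ (param (n := n) p y) := fun y hy => hρ.pos (isInteriorPoint_symm (chartAt_mem p) hy)
  have hconf : ∀ᶠ y in 𝓝 (coord (n := n) p), pullBil (param p) g y
      = (ρ (param (n := n) p y) ^ 2)⁻¹ • pullBil (param p) (compactify ρ g) y := by
    filter_upwards [(isOpen_intTarget _).mem_nhds hcoord] with y hy
    have h0 := (hpos y hy).ne'
    ext v w
    have key : ∀ (B : Bil n) (L : E n →L[ℝ] E n) (s : ℝ), s ≠ 0 →
        compBil B L v w = (s ^ 2)⁻¹ * (compBil (s ^ 2 • B) L v w) := by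
      intro B L s hs
      simp only [compBil, ContinuousLinearMap.bilinearComp_apply, smul_apply, smul_eq_mul]
      field_simp
    exact key (g (param p y)) _ _ h0
  have h := scalar_conformal hreg hr (hpos _ hcoord).ne' hconf
  simp only [hpc] at h
  exact h

/-- The function `|dρ|² - 1 - 2/(n+1) ρ Δρ`. -/
noncomputable def gradDefect (ρ : M → ℝ) (g : BilField n M) (p : M) : ℝ :=
  normDiffSq (compactify ρ g) ρ p - 1
    - 2 / ((n : ℝ) + 1) * (ρ p * laplacian (compactify ρ g) ρ p)

variable {A : MobiusCover n ρ} {α : ℝ} {k : ℕ} {g : BilField n M} [T2Space M] [CompactSpace M]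

section Patch

variable {ι : Type*} {c : ι → E n} {Θ : OpenPartialHomeomorph M (EuclideanHalfSpace (n + 1))}
  (P : PatchChart A α c Θ) (hρ : IsDefiningFunction n ρ) (hα : α ∈ Set.Ico (0 : ℝ) 1)
  (hk : 2 ≤ k) (hg : MWeak A k α 2 g)

include P hg

lemma PatchChart.exists_det_lower_bound : ∃ δ > 0, ∀ y ∈ patch c,
    δ ≤ |(gram (chartBil Θ (compactify ρ g)) y).det| := by
  obtain ⟨K, hK, hKs, hKp⟩ := P.dom
  obtain ⟨δ, hδ, h⟩ := WeakAH.exists_det_lower_bound P.mem hK hKs hg.extends_continuously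
  exact ⟨δ, hδ, fun y hy => h y (hKp y hy).1 (hKp y hy).2⟩

include hk

lemma PatchChart.regMetric {y : E n} (hy : y ∈ patch c) :
    RegMetric (chartBil Θ (compactify ρ g)) y where
  smooth := (P.contDiffAt_chartBil (hg.memScriptC [] (by simp)) hy).of_le (by exact_mod_cast hk)
  symm := by
    filter_upwards [(isOpen_patch P.pos).mem_nhds hy] with x hx v w
    have h := hg.isMetric.symm _ (isInteriorPoint_symm P.mem (P.mem_intTarget hx))
      (dParam Θ x v) (dParam Θ x w)
    exact congrArg (fun t => ρ ((Θ.extend (𝓡∂ (n + 1))).symm x) ^ 2 * t) h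
  det_ne := by
    obtain ⟨δ, hδ, h⟩ := P.exists_det_lower_bound hg
    exact abs_pos.1 (hδ.trans_le (h y hy))

include hρ

/-- Arranges the defect as `f - ρ h`, with `f` one derivative more regular than `h`, the form
required by `unifHolder_of_isBigO_sq`. -/
lemma PatchChart.gradDefect_eq {y : E n} (hy : y ∈ patch c) :
    gradDefect ρ g ((Θ.extend (𝓡∂ (n + 1))).symm y)
      = (gradSq (gram (chartBil Θ (compactify ρ g)))
          (fun y => ρ ((Θ.extend (𝓡∂ (n + 1))).symm y)) y - 1)
        - ρ ((Θ.extend (𝓡∂ (n + 1))).symm y) * (2 / ((n : ℝ) + 1)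
          * laplace (gram (chartBil Θ (compactify ρ g)))
            (fun y => ρ ((Θ.extend (𝓡∂ (n + 1))).symm y)) y) := by
  have hx := P.mem_intTarget hy
  have hr := (contDiffOn_comp_symm hρ P.mem).contDiffAt ((isOpen_intTarget _).mem_nhds hx)
  rw [gradDefect, normDiffSq_symm P.mem hx (hr.differentiableAt (by simp)),
    laplacian_symm P.mem hx (P.regMetric hk hg hy)
      (hr.of_le (three_le_infty.trans' (by norm_num)))]
  ring

/-- The constant `-1` in the defect absorbs `n(n+1)`, so the two quantities of the theorem are
proportional modulo `ρ² R[ḡ]`. -/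
lemma PatchChart.scalarCurvature_eq {p : M} (hp : ∃ y ∈ patch c,
    (Θ.extend (𝓡∂ (n + 1))).symm y = p) :
    scalarCurvature g p + n * (n + 1) = ρ p ^ 2 * scalarCurvature (compactify ρ g) p
      - n * (n + 1) * gradDefect ρ g p := by
  obtain ⟨y, hy, hp⟩ := hp
  rw [scalarCurvature_compactify hρ P.mem (P.mem_intTarget hy) (P.regMetric hk hg hy) hp.symm,
    gradDefect]
  field_simp
  ring

include hα

lemma PatchChart.unifHolder_scalarCurvature : UnifHolder (k - 2) α fun i z =>
    scalarCurvature (compactify ρ g) ((Θ.extend (𝓡∂ (n + 1))).symm (rescale (c i) z)) := by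
  obtain ⟨δ, hδ, hlow⟩ := P.exists_det_lower_bound hg
  have h : UnifHolder (k - 2) α _ :=
    SmoothBounded.scalar hα P.pos (P.smoothBounded_gram hα hk hg.memScriptC) hδ hlow
  exact h.congr fun i z hz => scalarCurvature_symm P.mem
    (P.mem_intTarget (rescale_mem_patch i hz)) (P.regMetric hk hg (rescale_mem_patch i hz))

lemma PatchChart.smoothBounded_gradSq : SmoothBounded α c 2 k fun y =>
    gradSq (gram (chartBil Θ (compactify ρ g)))
      (fun y => ρ ((Θ.extend (𝓡∂ (n + 1))).symm y)) y - 1 := by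
  obtain ⟨δ, hδ, hlow⟩ := P.exists_det_lower_bound hg
  exact (SmoothBounded.gradSq hα P.pos (P.smoothBounded_gram hα hk hg.memScriptC) hδ hlow
    P.rho).sub hα P.pos (SmoothBounded.const 1)

lemma PatchChart.smoothBounded_laplace : SmoothBounded α c 1 (k - 1) fun y =>
    2 / ((n : ℝ) + 1) * laplace (gram (chartBil Θ (compactify ρ g)))
      (fun y => ρ ((Θ.extend (𝓡∂ (n + 1))).symm y)) y := by
  obtain ⟨δ, hδ, hlow⟩ := P.exists_det_lower_bound hg
  exact (SmoothBounded.laplace hα P.pos (P.smoothBounded_gram hα hk hg.memScriptC) hδ hlow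
    P.rho).const_mul hα P.pos _

/-- The bound in weight zero, valid without any decay assumption; it takes care of the region away
from the boundary. -/
lemma PatchChart.unifHolder_gradDefect : UnifHolder (k - 1) α fun i z =>
    gradDefect ρ g ((Θ.extend (𝓡∂ (n + 1))).symm (rescale (c i) z)) := by
  have h1 := (P.smoothBounded_gradSq hρ hα hk hg).unif.of_le hα (Nat.sub_le k 1)
  have h2 := (P.rho 0 (k - 1)).unif.mul hα (P.smoothBounded_laplace hρ hα hk hg).unif
  exact (h1.sub hα h2).congr fun i z hz => P.gradDefect_eq hρ hk hg (rescale_mem_patch i hz)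

/-- Taylor expansion at the centres of the rescaled balls improves a quadratic pointwise bound to
a Hölder bound. -/
lemma PatchChart.unifHolder_rpow_mul_gradDefect
    (hO : ∃ C, ∀ p ∈ (𝓡∂ (n + 1)).interior M, |gradDefect ρ g p| ≤ C * ρ p ^ 2) :
    UnifHolder (k - 1) α fun i z =>
      ρ ((Θ.extend (𝓡∂ (n + 1))).symm (rescale (c i) z)) ^ (-(2 : ℝ)) *
        gradDefect ρ g ((Θ.extend (𝓡∂ (n + 1))).symm (rescale (c i) z)) := by
  have hpow : ∀ y ∈ patch c, ρ ((Θ.extend (𝓡∂ (n + 1))).symm y) ^ (-(2 : ℝ))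
      = (ρ ((Θ.extend (𝓡∂ (n + 1))).symm y) ^ 2)⁻¹ := fun y hy => by
    rw [Real.rpow_neg (P.rho_pos y hy).le, Real.rpow_two]
  -- On boundary patches `ρ` is the height and the key estimate applies; on interior patches `ρ` is
  -- bounded below, so the weight is harmless.
  rcases P.rho_alt with h | ⟨δ, hδ, h⟩
  · obtain ⟨C, hC⟩ := hO
    -- With `k = l + 2` the conclusion of order `l + 1` is the order `k - 1` sought.
    obtain ⟨l, rfl⟩ := Nat.exists_eq_add_of_le' hk
    have key := unifHolder_of_isBigO_sq hα P.pos (P.smoothBounded_gradSq hρ hα hk hg)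
      (P.smoothBounded_laplace hρ hα hk hg) ⟨C, fun y hy => by
        have h1 := hC _ (isInteriorPoint_symm P.mem (P.mem_intTarget hy))
        rwa [P.gradDefect_eq hρ hk hg hy, h y hy] at h1⟩
    refine UnifHolder.congr key fun i z hz => ?_
    have hy := rescale_mem_patch (c := c) i hz
    rw [hpow _ hy, P.gradDefect_eq hρ hk hg hy, h _ hy]
  · have hr := (P.rho 0 (k - 1)).unif.inv hα hδ fun i z hz => by
      rw [abs_of_pos (P.rho_pos _ (rescale_mem_patch i hz))]
      exact h _ (rescale_mem_patch i hz)
    refine ((hr.mul hα hr).mul hα (P.unifHolder_gradDefect hρ hα hk hg)).congr fun i z hz => ?_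
    rw [hpow _ (rescale_mem_patch i hz), sq, mul_inv]

end Patch

/-! ### The Möbius cover -/

variable (hρ : IsDefiningFunction n ρ) (hα : α ∈ Set.Ico (0 : ℝ) 1)

include hρ hα

/-- There are finitely many background and interior charts, so the constants of the families can be
added. -/
lemma holderFun_of_patchChart {δ : ℝ} {u : M → ℝ}
    (H : ∀ (ι : Type) (c : ι → E n) (Θ : OpenPartialHomeomorph M (EuclideanHalfSpace (n + 1))),
      PatchChart A α c Θ → UnifHolder k α fun i z =>
        ρ ((Θ.extend (𝓡∂ (n + 1))).symm (rescale (c i) z)) ^ (-δ) *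
          u ((Θ.extend (𝓡∂ (n + 1))).symm (rescale (c i) z))) :
    HolderFun A k α δ u := by
  choose C hC0 hC using fun b => (H _ _ _ (patchChart_bg hρ A hα b)).exists_nonneg
  choose C' hC'0 hC' using fun i => (H _ _ _ (patchChart_int hρ A hα i)).exists_nonneg
  refine ⟨∑ b, C b + ∑ i, C' i, ?_⟩
  have hs : 0 ≤ ∑ b, C b := Finset.sum_nonneg fun b _ => hC0 b
  have hs' : 0 ≤ ∑ i, C' i := Finset.sum_nonneg fun i _ => hC'0 i
  rintro Φ (⟨b, c, hc, rfl⟩ | ⟨i, rfl⟩)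
  · have h1 := Finset.single_le_sum (fun b _ => hC0 b) (Finset.mem_univ b)
    exact (hC b ⟨c, hc⟩).mono (by linarith)
  · have h1 := Finset.single_le_sum (fun i _ => hC'0 i) (Finset.mem_univ i)
    have h2 := hC' i ()
    simp only [rescale_of_e] at h2
    exact h2.mono (by linarith)

lemma exists_patchChart {p : M} (hp : p ∈ (𝓡∂ (n + 1)).interior M) :
    ∃ (ι : Type) (c : ι → E n) (Θ : OpenPartialHomeomorph M (EuclideanHalfSpace (n + 1))),
      PatchChart A α c Θ ∧ ∃ y ∈ patch c, (Θ.extend (𝓡∂ (n + 1))).symm y = p := by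
  rcases A.cover p hp with ⟨b, c, hc, z, hz, hzp⟩ | ⟨i, z, hz, hzp⟩
  · exact ⟨_, _, _, patchChart_bg hρ A hα b, _, ⟨⟨c, hc⟩, z, hypBall_mono n hz, rfl⟩, hzp⟩
  · exact ⟨_, _, _, patchChart_int hρ A hα i, _, ⟨(), z, hypBall_mono n hz, rfl⟩, by
      rwa [rescale_of_e]⟩

omit hα in
lemma HolderFun.bound {δ : ℝ} {u : M → ℝ} (h : HolderFun A k α δ u) :
    ∃ C, 0 ≤ C ∧ ∀ p ∈ (𝓡∂ (n + 1)).interior M, |u p| ≤ C * ρ p ^ δ := by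
  obtain ⟨C, hC⟩ := h
  refine ⟨max C 0, le_max_right _ _, fun p hp => ?_⟩
  obtain ⟨Φ, hΦ, z, hz, rfl⟩ : ∃ Φ ∈ A.maps, ∃ z ∈ hypBall n 1, Φ z = p := by
    rcases A.cover p hp with ⟨b, c, hc, z, hz, hzp⟩ | ⟨i, z, hz, hzp⟩
    · exact ⟨_, Or.inl ⟨b, c, hc, rfl⟩, z, hz, hzp⟩
    · exact ⟨_, Or.inr ⟨i, rfl⟩, z, hz, hzp⟩
  have hr := hρ.pos hp
  have h1 := (hC Φ hΦ).2.1 0 (Nat.zero_le _) z (hypBall_mono n hz)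
  rw [norm_iteratedFDeriv_zero, Real.norm_eq_abs, abs_mul, Real.rpow_neg hr.le,
    abs_of_pos (inv_pos.2 (Real.rpow_pos_of_pos hr δ))] at h1
  have h2 := Real.rpow_pos_of_pos hr δ
  calc |u (Φ z)| = ((ρ (Φ z) ^ δ)⁻¹ * |u (Φ z)|) * ρ (Φ z) ^ δ := by field_simp
    _ ≤ max C 0 * ρ (Φ z) ^ δ := by gcongr; exact h1.trans (le_max_left _ _)

omit [T2Space M] [CompactSpace M] hα in
lemma eventually_interior : ∀ᶠ p in nearBoundary ρ, p ∈ (𝓡∂ (n + 1)).interior M := by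
  filter_upwards [Filter.preimage_mem_comap self_mem_nhdsWithin] with p hp
  by_contra hb
  have h1 : p ∈ (𝓡∂ (n + 1)).boundary M := by
    rw [← ModelWithCorners.compl_interior]; exact hb
  exact (ne_of_gt hp) ((hρ.zero_iff p).2 h1)

end Consequences

end WeakAH

open WeakAH

/-! ### The equivalence -/

theorem mainTheorem6 {n : ℕ} (hn : 1 ≤ n)
    {M : Type*} [TopologicalSpace M] [ChartedSpace (EuclideanHalfSpace (n + 1)) M]
    [IsManifold (𝓡∂ (n + 1)) ∞ M] [T2Space M] [CompactSpace M]
    (ρ : M → ℝ) (hρ : WeakAH.IsDefiningFunction n ρ) (A : WeakAH.MobiusCover n ρ)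
    (k : ℕ) (hk : 2 ≤ k) (α : ℝ) (hα : α ∈ Set.Ico (0 : ℝ) 1)
    (g : WeakAH.BilField n M) (hg : WeakAH.MWeak A k α 2 g) :
    List.TFAE [
      WeakAH.HolderFun A (k - 1) α 2 (fun p =>
        WeakAH.normDiffSq (WeakAH.compactify ρ g) ρ p - 1
          - 2 / ((n : ℝ) + 1) * (ρ p * WeakAH.laplacian (WeakAH.compactify ρ g) ρ p)),
      (fun p => WeakAH.normDiffSq (WeakAH.compactify ρ g) ρ p - 1
          - 2 / ((n : ℝ) + 1) * (ρ p * WeakAH.laplacian (WeakAH.compactify ρ g) ρ p))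
        =O[WeakAH.nearBoundary ρ] (fun p => ρ p ^ 2),
      WeakAH.HolderFun A (k - 2) α 2 (fun p =>
        WeakAH.scalarCurvature g p + (n : ℝ) * ((n : ℝ) + 1)),
      (fun p => WeakAH.scalarCurvature g p + (n : ℝ) * ((n : ℝ) + 1))
        =O[WeakAH.nearBoundary ρ] (fun p => ρ p ^ 2)] := by
  have hF : (fun p => normDiffSq (compactify ρ g) ρ p - 1
      - 2 / ((n : ℝ) + 1) * (ρ p * laplacian (compactify ρ g) ρ p)) = gradDefect ρ g := rfl
  rw [hF]
  have hid : ∀ p ∈ (𝓡∂ (n + 1)).interior M, scalarCurvature g p + (n : ℝ) * ((n : ℝ) + 1)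
      = ρ p ^ 2 * scalarCurvature (compactify ρ g) p - n * (n + 1) * gradDefect ρ g p := by
    intro p hp
    obtain ⟨ι, c, Θ, P, hy⟩ := exists_patchChart (A := A) hρ hα hp
    exact P.scalarCurvature_eq hρ hk hg hy
  -- Dividing the identity `hid` by `ρ²` leaves `R[ḡ]`, bounded in `C^{k-2,α}`, minus a multiple of
  -- the weighted defect.
  tfae_have 1 → 3 := by
    rintro ⟨C, hC⟩
    refine holderFun_of_patchChart hρ hα fun ι c Θ P => ?_
    have h1 : UnifHolder (k - 1) α fun i z =>
        ρ ((Θ.extend (𝓡∂ (n + 1))).symm (rescale (c i) z)) ^ (-(2 : ℝ)) *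
          gradDefect ρ g ((Θ.extend (𝓡∂ (n + 1))).symm (rescale (c i) z)) :=
      ⟨C, fun i => hC _ (P.maps i)⟩
    refine ((P.unifHolder_scalarCurvature hρ hα hk hg).sub hα
      ((h1.of_le hα (by omega)).const_mul hα ((n : ℝ) * (n + 1)))).congr fun i z hz => ?_
    have hy := rescale_mem_patch (c := c) i hz
    have hr := P.rho_pos _ hy
    rw [hid _ (isInteriorPoint_symm P.mem (P.mem_intTarget hy)), Real.rpow_neg hr.le,
      Real.rpow_two]
    field_simp
  tfae_have 3 → 4 := by
    intro h
    obtain ⟨C, -, hC⟩ := HolderFun.bound hρ h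
    refine Asymptotics.IsBigO.of_bound C ?_
    filter_upwards [eventually_interior hρ] with p hp
    have := hC p hp
    rw [Real.rpow_two] at this
    rwa [Real.norm_eq_abs, Real.norm_eq_abs, abs_of_nonneg (sq_nonneg (ρ p))]
  -- Solve `hid` for the defect: the term `ρ² R[ḡ]` is `O(ρ²)` because `R[ḡ]` is bounded, and `n ≥
  -- 1` permits division by `n(n+1)`.
  tfae_have 4 → 2 := by
    intro h
    have hR : HolderFun A (k - 2) α 0 (scalarCurvature (compactify ρ g)) :=
      holderFun_of_patchChart hρ hα fun ι c Θ P => by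
        simpa using P.unifHolder_scalarCurvature hρ hα hk hg
    obtain ⟨C, -, hC⟩ := HolderFun.bound hρ hR
    have h1 : (fun p => ρ p ^ 2 * scalarCurvature (compactify ρ g) p)
        =O[nearBoundary ρ] fun p => ρ p ^ 2 := by
      refine Asymptotics.IsBigO.of_bound C ?_
      filter_upwards [eventually_interior hρ] with p hp
      have h2 := hC p hp
      rw [Real.rpow_zero, mul_one] at h2
      rw [norm_mul, mul_comm C]
      gcongr
      exact h2
    have hn0 : (n : ℝ) ≠ 0 := by positivity
    refine ((h1.sub h).const_mul_left ((n : ℝ) * (n + 1))⁻¹).congr' ?_ Filter.EventuallyEq.rfl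
    filter_upwards [eventually_interior hρ] with p hp
    rw [hid p hp]
    field_simp
    ring
  tfae_have 2 → 1 := by
    intro h
    refine holderFun_of_patchChart hρ hα fun ι c Θ P =>
      P.unifHolder_rpow_mul_gradDefect hρ hα hk hg ?_
    have hB : HolderFun A (k - 1) α 0 (gradDefect ρ g) :=
      holderFun_of_patchChart hρ hα fun ι c Θ P => by
        simpa using P.unifHolder_gradDefect hρ hα hk hg
    obtain ⟨C, hC0, hC⟩ := HolderFun.bound hρ hB
    obtain ⟨C', hC'⟩ := h.bound
    obtain ⟨s, hs, hsub⟩ := Filter.mem_comap.1 hC'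
    obtain ⟨ε, hε, hεs⟩ := mem_nhdsGT_iff_exists_Ioo_subset.1 hs
    have hε : 0 < ε := hε
    -- The asymptotic bound holds only for `ρ < ε`. Where `ρ ≥ ε`, the global bound `C` is at most
    -- `(C / ε²) ρ²`.
    refine ⟨max C' (C / ε ^ 2), fun p hp => ?_⟩
    have hr := hρ.pos hp
    rcases lt_or_ge (ρ p) ε with hlt | hge
    · have h1 : ‖gradDefect ρ g p‖ ≤ C' * ‖ρ p ^ 2‖ := hsub (hεs ⟨hr, hlt⟩)
      rw [Real.norm_eq_abs, Real.norm_eq_abs, abs_of_pos (pow_pos hr 2)] at h1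
      exact h1.trans (by gcongr; exact le_max_left _ _)
    · have h1 := hC p hp
      rw [Real.rpow_zero, mul_one] at h1
      calc |gradDefect ρ g p| ≤ C / ε ^ 2 * ε ^ 2 := by rwa [div_mul_cancel₀ _ (by positivity)]
        _ ≤ max C' (C / ε ^ 2) * ρ p ^ 2 := by gcongr; exact le_max_right _ _
  tfae_finish
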